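/- **Setting.** Let $X$ be a proper metric space (closed bounded sets are compact) with a measure $\mu$, defined on the completion of the Borel $\sigma$-algebra, such that $0<\mu(B)<\infty$ for all (open, nonempty) balls $B$. Let $1<p<\infty$. *Curves and upper gradients.* Let $Y$ be $X$, or an open subset of $X$ with the restricted metric and measure. A curve in $Y$ is a nonconstant rectifiable continuous map from a compact interval into $Y$, parametrized by arc length. A Borel function $g\colon Y\to[0,\infty]$ is an upper gradient of $u\colon Y\to[-\infty,\infty]$ if $|u(x)-u(y)|\le\int_\gamma g\,ds$ for all $x,y\in Y$ and all curves $\gamma$ in $Y$ joining $x$ and $y$, where the left-hand side is $\infty$ if $u(x)$ or $u(y)$ is infinite. A property holds for $p$-a.e. curve if the family $\Gamma$ of exceptional curves satisfies $\inf_\rho\int_Y\rho^p\,d\mu=0$, the infimum being over all Borel $\rho\colon Y\to[0,\infty]$ with $\int_\gamma\rho\,ds\ge1$ for all $\gamma\in\Gamma$. A measurable $g\colon Y\to[0,\infty]$ is a $p$-weak upper gradient of $u$ if, for $p$-a.e. curve $\gamma$ in $Y$, $\int_\gamma g\,ds$ is defined and the inequality above holds. The minimal $p$-weak upper gradient $g_u$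 is the (a.e. unique) $p$-weak upper gradient of $u$ in $L^p_{\mathrm{loc}}(Y)$ with $g_u\le g$ a.e. for all $p$-weak upper gradients $g\in L^p_{\mathrm{loc}}(Y)$ of $u$. *Function spaces and capacity.* $D^p(Y)$ is the set of everywhere defined measurable functions $u\colon Y\to[-\infty,\infty]$ that have an upper gradient in $L^p(Y)$, and $u\in D^p_{\mathrm{loc}}(Y)$ if every point of $Y$ lies in a ball $B$ of $Y$ with $u|_B\in D^p(B)$. For an open set $V\subset X$, $D^p_0(V)=\{F|_V:F\in D^p(X),\ F=0\text{ in }X\setminus V\}$. Let $\|u\|_{N^{1,p}(X)}^p=\int_X|u|^p\,d\mu+\int_X g_u^p\,d\mu$ and $N^{1,p}(X)=\{u\in D^p_{\mathrm{loc}}(X):\|u\|_{N^{1,p}(X)}<\infty\}$. The capacity of $E\subset X$ is $C_p(E)=\inf\|u\|_{N^{1,p}(X)}^p$ over all $u\in N^{1,p}(X)$ with $u\ge1$ on $E$; a property holds quasieverywhere (q.e.) if it fails only on a set of capacity $C_p$ zero. *Poincaré inequality.* Suppose that $X$ supports a $(p,p)$-Poincaré inequality: there are $C>0$ and $\lambda\ge1$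 such that for all balls $B$ in $X$, all integrable functions $u$ on $X$ and all upper gradients $g$ of $u$, with $u_B=\frac1{\mu(B)}\int_B u\,d\mu$, $$\Bigl(\frac1{\mu(B)}\int_B|u-u_B|^p\,d\mu\Bigr)^{1/p}\le C\operatorname{diam}(B)\Bigl(\frac1{\mu(\lambda B)}\int_{\lambda B}g^p\,d\mu\Bigr)^{1/p}.$$ *Obstacle problem.* Let $\Omega\subset X$ be a nonempty, possibly unbounded, open set with $C_p(X\setminus\Omega)>0$, let $\psi\colon\Omega\to[-\infty,\infty]$ be arbitrary and let $f\in D^p(\Omega)$. Put $$\mathcal K_{\psi,f}=\{v\in D^p(\Omega): v-f\in D^p_0(\Omega)\text{ and } v\ge\psi\text{ q.e. in }\Omega\}.$$ A solution of the $\mathcal K_{\psi,f}$-obstacle problem is a function $u\in\mathcal K_{\psi,f}$ with $\int_\Omega g_u^p\,d\mu\le\int_\Omega g_v^p\,d\mu$ for all $v\in\mathcal K_{\psi,f}$, where minimal $p$-weak upper gradients are taken with respect to $\Omega$. **Theorem.** If $\mathcal K_{\psi,f}$ is nonempty, then the $\mathcal K_{\psi,f}$-obstacle problem has a solution, and any two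 solutions $u_1,u_2$ satisfy $u_1=u_2$ q.e. in $\Omega$, that is, $C_p(\{x\in\Omega:u_1(x)\ne u_2(x)\})=0$. -/

import Mathlib

open MeasureTheory Set
open scoped ENNReal NNReal

/-! Sobolev-type calculus on a metric measure space, based on upper gradients.

Throughout, `Y` carries its Borel σ-algebra and `μ` is a Borel measure. A function that is measurable
with respect to the completion of the Borel σ-algebra is an `AEMeasurable` one. A measurable subset
`E` of `X` is a metric measure space in its own right: the subtype `↥E` with the restricted metric
and the restricted measure `μ.comap Subtype.val`. -/

namespace ObstacleProblem

noncomputable section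

/-- A (nonconstant, rectifiable) curve, parametrized by arc length on `[0, length]`. Only the values
of `toFun` on `[0, length]` are ever used. -/
structure Curve (Y : Type*) [PseudoEMetricSpace Y] where
  length : ℝ
  length_pos : 0 < length
  toFun : ℝ → Y
  unitSpeed : HasUnitSpeedOn toFun (Icc 0 length)

/-- With the conventions of `EReal`, `|a - b|` is infinite when `a` or `b` is. -/
theorem abs_sub_eq_top {a b : EReal} (h : a = ⊤ ∨ a = ⊥ ∨ b = ⊤ ∨ b = ⊥) : (a - b).abs = ∞ := by
  rcases h with h | h | h | h <;> subst h
  · induction b <;> simp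
  · induction b <;> simp
  · induction a <;> simp
  · induction a <;> simp

section Space

variable {Y : Type*} [MetricSpace Y] [MeasurableSpace Y]

/-- The line integral `∫_γ g ds`. -/
def Curve.lineIntegral (γ : Curve Y) (g : Y → ℝ≥0∞) : ℝ≥0∞ :=
  ∫⁻ t in Icc 0 γ.length, g (γ.toFun t)

/-- The oscillation `|u(x) - u(y)|` of `u` between the end points of `γ`. It is infinite as soon as
one of the two values is (see `abs_sub_eq_top`). -/
def Curve.osc (γ : Curve Y) (u : Y → EReal) : ℝ≥0∞ :=
  (u (γ.toFun 0) - u (γ.toFun γ.length)).abs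

/-- `g` is an upper gradient of `u`. -/
def IsUpperGradient (g : Y → ℝ≥0∞) (u : Y → EReal) : Prop :=
  Measurable g ∧ ∀ γ : Curve Y, γ.osc u ≤ γ.lineIntegral g

/-- The `p`-modulus of a family of curves. -/
def modulus (p : ℝ) (μ : Measure Y) (Γ : Set (Curve Y)) : ℝ≥0∞ :=
  ⨅ (ρ : Y → ℝ≥0∞) (_ : Measurable ρ) (_ : ∀ γ ∈ Γ, 1 ≤ γ.lineIntegral ρ), ∫⁻ x, ρ x ^ p ∂μ

/-- `P` holds for `p`-almost every curve. -/
def AECurve (p : ℝ) (μ : Measure Y) (P : Curve Y → Prop) : Prop :=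
  modulus p μ {γ | ¬ P γ} = 0

/-- `g` is a `p`-weak upper gradient of `u`: it is measurable, and on `p`-almost every curve its line
integral is defined and the upper gradient inequality holds. -/
def IsWeakUpperGradient (p : ℝ) (μ : Measure Y) (g : Y → ℝ≥0∞) (u : Y → EReal) : Prop :=
  AEMeasurable g μ ∧ AECurve p μ fun γ =>
    AEMeasurable (fun t => g (γ.toFun t)) (volume.restrict (Icc 0 γ.length)) ∧
      γ.osc u ≤ γ.lineIntegral g

/-- Local `p`-integrability of a nonnegative function. -/
def LocLp (p : ℝ) (μ : Measure Y) (g : Y → ℝ≥0∞) : Prop :=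
  ∀ x : Y, ∃ (z : Y) (r : ℝ), x ∈ Metric.ball z r ∧ ∫⁻ y in Metric.ball z r, g y ^ p ∂μ < ∞

/-- `g` is a minimal `p`-weak upper gradient of `u`: a locally `p`-integrable one that is a.e. not
larger than any other locally `p`-integrable one. -/
def IsMinimalWeakUpperGradient (p : ℝ) (μ : Measure Y) (g : Y → ℝ≥0∞) (u : Y → EReal) : Prop :=
  IsWeakUpperGradient p μ g u ∧ LocLp p μ g ∧
    ∀ g' : Y → ℝ≥0∞, IsWeakUpperGradient p μ g' u → LocLp p μ g' → g ≤ᵐ[μ] g'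

open Classical in
/-- The minimal `p`-weak upper gradient `g_u` of `u` (determined up to a.e. equality), and `∞` for
functions that have none. -/
def minGrad (p : ℝ) (μ : Measure Y) (u : Y → EReal) : Y → ℝ≥0∞ :=
  if h : ∃ g, IsMinimalWeakUpperGradient p μ g u then h.choose else fun _ => ∞

/-- The energy `∫ g_u ^ p dμ`. -/
def energy (p : ℝ) (μ : Measure Y) (u : Y → EReal) : ℝ≥0∞ :=
  ∫⁻ x, minGrad p μ u x ^ p ∂μ

/-- The Dirichlet space `D^p(Y)`. -/
def MemDirichlet (p : ℝ) (μ : Measure Y) (u : Y → EReal) : Prop :=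
  AEMeasurable u μ ∧ ∃ g : Y → ℝ≥0∞, IsUpperGradient g u ∧ ∫⁻ x, g x ^ p ∂μ < ∞

/-- The local Dirichlet space `D^p_loc(Y)`. -/
def MemDirichletLoc (p : ℝ) (μ : Measure Y) (u : Y → EReal) : Prop :=
  ∀ x : Y, ∃ (z : Y) (r : ℝ), x ∈ Metric.ball z r ∧
    MemDirichlet p (μ.comap ((↑) : Metric.ball z r → Y)) (fun y => u y)

/-- The `p`-th power of the Newtonian norm, `∫ |u| ^ p dμ + ∫ g_u ^ p dμ`. -/
def newtonNormPow (p : ℝ) (μ : Measure Y) (u : Y → EReal) : ℝ≥0∞ :=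
  ∫⁻ x, (u x).abs ^ p ∂μ + energy p μ u

/-- The Newtonian space `N^{1,p}(Y)`. -/
def MemNewton (p : ℝ) (μ : Measure Y) (u : Y → EReal) : Prop :=
  MemDirichletLoc p μ u ∧ newtonNormPow p μ u < ∞

/-- The Sobolev capacity `C_p(E)`. -/
def capacity (p : ℝ) (μ : Measure Y) (E : Set Y) : ℝ≥0∞ :=
  ⨅ (u : Y → EReal) (_ : MemNewton p μ u) (_ : ∀ x ∈ E, 1 ≤ u x), newtonNormPow p μ u

/-- `Y` supports a `(q, p)`-Poincaré inequality. -/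
def SupportsPoincare (q p : ℝ) (μ : Measure Y) : Prop :=
  ∃ C dil : ℝ≥0, 0 < C ∧ 1 ≤ dil ∧ ∀ (z : Y) (r : ℝ), 0 < r →
    ∀ (u : Y → ℝ) (g : Y → ℝ≥0∞), Integrable u μ → IsUpperGradient g (fun x => (u x : EReal)) →
      (⨍⁻ x in Metric.ball z r, ‖u x - ⨍ y in Metric.ball z r, u y ∂μ‖ₑ ^ q ∂μ) ^ (1 / q) ≤
        C * Metric.ediam (Metric.ball z r) *
          (⨍⁻ x in Metric.ball z (dil * r), g x ^ p ∂μ) ^ (1 / p)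

end Space

section Obstacle

variable {X : Type*} [MetricSpace X] [MeasurableSpace X]

/-- The Dirichlet space `D^p_0(E)` of functions on `E` with zero boundary values: the restrictions to
`E` of the functions in `D^p(X)` that vanish outside `E`. -/
def MemDirichletZero (p : ℝ) (μ : Measure X) (E : Set X) (h : E → EReal) : Prop :=
  ∃ F : X → EReal, MemDirichlet p μ F ∧ (∀ x, x ∉ E → F x = 0) ∧ ∀ x : E, F x = h x

/-- `P` holds quasieverywhere in `E`, with respect to the capacity of the whole space `X`. -/
def QEOn (p : ℝ) (μ : Measure X) (E : Set X) (P : E → Prop) : Prop :=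
  capacity p μ ((↑) '' {x : E | ¬ P x}) = 0

/-- The class `K_{ψ,f}(V)` of admissible functions. -/
def admissible (p : ℝ) (μ : Measure X) (V : Set X) (ψ f : V → EReal) : Set (V → EReal) :=
  {v | MemDirichlet p (μ.comap ((↑) : V → X)) v ∧
    MemDirichletZero p μ V (fun x => v x - f x) ∧
    QEOn p μ V fun x => ψ x ≤ v x}

/-- `u` is a solution of the `K_{ψ,f}(V)`-obstacle problem. -/
def IsObstacleSolution (p : ℝ) (μ : Measure X) (V : Set X) (ψ f u : V → EReal) : Prop :=
  u ∈ admissible p μ V ψ f ∧ ∀ v ∈ admissible p μ V ψ f,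
    energy p (μ.comap ((↑) : V → X)) u ≤ energy p (μ.comap ((↑) : V → X)) v

end Obstacle

end

end ObstacleProblem

namespace ObstacleProblem

noncomputable section

open Filter Topology

set_option linter.unusedSectionVars false

/-! ### Arithmetic of oscillations in the extended reals -/

/-! Existence is a direct method without weak compactness. Let `I` be the infimum of the energy over
the admissible class. Midpoints of admissible functions are admissible, and half the sum of two weak
upper gradients is a weak upper gradient of the midpoint. Uniform convexity of the p-th power
(`exists_uniform_convexity_integral`) therefore makes the minimal gradients of a minimizing sequence
Cauchy in L^p. Since u ↦ g_u is not linear, this says nothing about the functions. They are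
controlled by a second minimization: among admissible functions of energy close to `I`, those are
taken for which the integral of |v - f|^p is almost least, with respect to a weighted measure
equivalent to `μ`. That integral is finite by a Maz'ya inequality (`exists_weighted_mazya`), since v
- f extends by zero to the complement of Ω, a set of positive capacity. Uniform convexity then gives
a Cauchy sequence of functions as well.

Along a rapidly converging subsequence the solution is the pointwise upper limit, which is defined
everywhere. By `weakGrad_limsup` the lower limit of the gradients is a weak upper gradient of it, so
Fatou's lemma bounds its energy by `I`. The obstacle condition survives because countable unions of
sets of capacity zero have capacity zero.

For uniqueness, convexity gives two solutions a common gradient `G`. Comparison with max(u₁, min(u₂,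
q)) for rational q shows that `G` vanishes a.e. where u₁ ≠ u₂ (`ae_eq_zero_of_le_of_le`). The
difference then has weak upper gradient zero, and Maz'ya's inequality makes it zero a.e. Since it is
constant along almost every curve, almost every curve avoids the set where it is nonzero. By
`capacity_eq_zero_iff` that set has capacity zero.

All curve arguments use the filter `aeCurve`: a property holds for almost every curve if some Borel
ρ with finite p-energy has infinite line integral along every exceptional curve. This passes to
subcurves, so a gradient inequality becomes `ControlledOn`, a statement about one function on an
interval. -/

theorem abs_coe_sub_coe (a b : ℝ) : ((a : EReal) - b).abs = ENNReal.ofReal |a - b| := by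
  rw [← EReal.coe_sub, EReal.abs_def]

theorem exists_real_of_abs_ne_top {a : EReal} (h : a.abs ≠ ∞) : ∃ x : ℝ, a = x := by
  induction a with
  | bot => simp at h
  | coe x => exact ⟨x, rfl⟩
  | top => simp at h

theorem exists_real_of_abs_sub_ne_top {a b : EReal} (h : (a - b).abs ≠ ∞) :
    ∃ x y : ℝ, a = x ∧ b = y := by
  have h1 : ¬ (a = ⊤ ∨ a = ⊥ ∨ b = ⊤ ∨ b = ⊥) := fun h' => h (abs_sub_eq_top h')
  push Not at h1
  exact ⟨a.toReal, b.toReal, (EReal.coe_toReal h1.1 h1.2.1).symm,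
    (EReal.coe_toReal h1.2.2.1 h1.2.2.2).symm⟩

theorem abs_sub_comm_ereal (a b : EReal) : (a - b).abs = (b - a).abs := by
  by_cases h : (a - b).abs = ∞
  · by_contra h'
    rw [h] at h'
    obtain ⟨x, y, rfl, rfl⟩ := exists_real_of_abs_sub_ne_top (Ne.symm h')
    rw [abs_coe_sub_coe] at h
    exact ENNReal.ofReal_ne_top h
  · obtain ⟨x, y, rfl, rfl⟩ := exists_real_of_abs_sub_ne_top h
    rw [abs_coe_sub_coe, abs_coe_sub_coe, abs_sub_comm]

theorem abs_sub_le_ereal (a b c : EReal) : (a - c).abs ≤ (a - b).abs + (b - c).abs := by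
  by_cases h : (a - b).abs = ∞
  · simp [h]
  by_cases h' : (b - c).abs = ∞
  · simp [h']
  obtain ⟨x, y, rfl, rfl⟩ := exists_real_of_abs_sub_ne_top h
  obtain ⟨y', z, hy, rfl⟩ := exists_real_of_abs_sub_ne_top h'
  rw [abs_coe_sub_coe, abs_coe_sub_coe, abs_coe_sub_coe, ← ENNReal.ofReal_add (abs_nonneg _)
    (abs_nonneg _)]
  exact ENNReal.ofReal_le_ofReal (abs_sub_le _ _ _)

theorem abs_sub_le_add_ereal (a b : EReal) : (a - b).abs ≤ a.abs + b.abs := by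
  by_cases h : a.abs = ∞
  · simp [h]
  by_cases h' : b.abs = ∞
  · simp [h']
  obtain ⟨x, rfl⟩ := exists_real_of_abs_ne_top h
  obtain ⟨y, rfl⟩ := exists_real_of_abs_ne_top h'
  rw [abs_coe_sub_coe, EReal.abs_def, EReal.abs_def, ← ENNReal.ofReal_add (abs_nonneg _)
    (abs_nonneg _)]
  exact ENNReal.ofReal_le_ofReal (abs_sub _ _)

theorem abs_le_abs_sub_add_ereal (a b : EReal) : a.abs ≤ (a - b).abs + b.abs := by
  by_cases h : (a - b).abs = ∞
  · simp [h]
  obtain ⟨x, y, rfl, rfl⟩ := exists_real_of_abs_sub_ne_top h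
  rw [abs_coe_sub_coe, EReal.abs_def, EReal.abs_def, ← ENNReal.ofReal_add (abs_nonneg _)
    (abs_nonneg _)]
  refine ENNReal.ofReal_le_ofReal ?_
  have := abs_add_le (x - y) y
  simpa using this

theorem measurable_abs_ereal : Measurable EReal.abs := by
  refine EReal.measurable_of_measurable_real ?_
  simp only [EReal.abs_def]
  fun_prop

/-! ### Functions on an interval whose oscillation is controlled by an integral -/

/-- The oscillation of `h` over each subinterval of `[a, b]` is at most the integral of `G`. -/
def ControlledOn (h : ℝ → EReal) (G : ℝ → ℝ≥0∞) (a b : ℝ) : Prop :=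
  ∀ s t, a ≤ s → s < t → t ≤ b → (h s - h t).abs ≤ ∫⁻ x in Icc s t, G x

theorem ControlledOn.mono_ae {h : ℝ → EReal} {G G' : ℝ → ℝ≥0∞} {a b : ℝ}
    (H : ControlledOn h G a b) (hG : ∀ᵐ x ∂volume.restrict (Icc a b), G x ≤ G' x) :
    ControlledOn h G' a b := fun s t hs hst ht =>
  (H s t hs hst ht).trans (lintegral_mono_ae (ae_mono
    (Measure.restrict_mono (Icc_subset_Icc hs ht) le_rfl) hG))

theorem setLIntegral_add_of_subset {α : Type*} [MeasurableSpace α] {μ : Measure α} {A B C : Set α}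
    (hB : MeasurableSet B) (hd : Disjoint A B) (hsub : A ∪ B ⊆ C) (G : α → ℝ≥0∞) :
    ∫⁻ x in A, G x ∂μ + ∫⁻ x in B, G x ∂μ ≤ ∫⁻ x in C, G x ∂μ := by
  rw [← lintegral_union hB hd]
  exact lintegral_mono_set hsub

/-- Zeros of `k` are zeros of `h`. From `s` one goes to the first zero of `k`, from the last zero to
`t`; the stretch between these zeros costs nothing. On the outer stretches the hypothesis applies up
to points near the zero, and continuity of `k` closes the gap. This serves level sets, with `k = h -
c`, and extensions by zero, with `k` a dominating function. -/
theorem ControlledOn.of_pointwise {h : ℝ → EReal} {k : ℝ → ℝ} {G : ℝ → ℝ≥0∞} {a b : ℝ}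
    (hk : ContinuousOn k (Icc a b)) (hhk : ∀ t ∈ Icc a b, (h t).abs ≤ ENNReal.ofReal |k t|)
    (H : ∀ s t, a ≤ s → s < t → t ≤ b → (∀ x ∈ Icc s t, k x ≠ 0) →
      (h s - h t).abs ≤ ∫⁻ x in Icc s t, G x) :
    ControlledOn h G a b := by
  intro s t hs hst ht
  by_cases hz : ∀ x ∈ Icc s t, k x ≠ 0
  · exact H s t hs hst ht hz
  push Not at hz
  have hsub : Icc s t ⊆ Icc a b := Icc_subset_Icc hs ht
  set C : Set ℝ := Icc s t ∩ k ⁻¹' {0} with hC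
  have hCc : IsClosed C := (hk.mono hsub).preimage_isClosed_of_isClosed isClosed_Icc
    isClosed_singleton
  have hCne : C.Nonempty := by
    obtain ⟨x, hx, hx0⟩ := hz
    exact ⟨x, hx, hx0⟩
  have hbb : BddBelow C := ⟨s, fun x hx => hx.1.1⟩
  have hba : BddAbove C := ⟨t, fun x hx => hx.1.2⟩
  have hm : sInf C ∈ C := hCc.csInf_mem hCne hbb
  have hM : sSup C ∈ C := hCc.csSup_mem hCne hba
  set m := sInf C
  set M := sSup C
  have hmM : m ≤ M := csInf_le hbb hM
  have hzero : ∀ x ∈ C, h x = 0 := by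
    intro x hx
    have h1 := hhk x (hsub hx.1)
    have h2 : k x = 0 := hx.2
    rw [h2] at h1
    simpa using h1
  have hlow : ∀ x, s ≤ x → x < m → k x ≠ 0 := fun x hx hxm h0 =>
    absurd (csInf_le hbb (show x ∈ C from ⟨⟨hx, hxm.le.trans hm.1.2⟩, h0⟩)) (not_le.2 hxm)
  have hupp : ∀ x, M < x → x ≤ t → k x ≠ 0 := fun x hx hxm h0 =>
    absurd (le_csSup hba (show x ∈ C from ⟨⟨hM.1.1.trans hx.le, hxm⟩, h0⟩)) (not_le.2 hx)
  -- Half-open intervals keep this and the next estimate on disjoint sets even when `m = M`, so that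
  -- their right-hand sides can be added.
  have e1 : (h s).abs ≤ ∫⁻ x in Ico s m, G x := by
    rcases eq_or_lt_of_le hm.1.1 with hsm | hsm
    · have : h s = 0 := by rw [hsm]; exact hzero _ hm
      simp [this]
    · have hlim : Tendsto (fun x => (∫⁻ y in Ico s m, G y) + ENNReal.ofReal |k x|) (𝓝[Ioo s m] m)
          (𝓝 ((∫⁻ y in Ico s m, G y) + ENNReal.ofReal |k m|)) := by
        refine Tendsto.const_add _ (ENNReal.tendsto_ofReal (Tendsto.abs ?_))
        exact ((hk m (hsub hm.1)).mono (fun x hx => hsub ⟨hx.1.le, hx.2.le.trans hm.1.2⟩))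
      have : k m = 0 := hm.2
      rw [this] at hlim
      simp only [abs_zero, ENNReal.ofReal_zero, add_zero] at hlim
      have : (𝓝[Ioo s m] m).NeBot := right_nhdsWithin_Ioo_neBot hsm
      refine ge_of_tendsto hlim ?_
      filter_upwards [self_mem_nhdsWithin] with x hx
      refine (abs_le_abs_sub_add_ereal (h s) (h x)).trans (add_le_add ?_ ?_)
      · refine (H s x hs hx.1 (hx.2.le.trans (hm.1.2.trans ht)) fun y hy => hlow y hy.1
          (hy.2.trans_lt hx.2)).trans (lintegral_mono_set fun y hy => ⟨hy.1, hy.2.trans_lt hx.2⟩)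
      · exact hhk x (hsub ⟨hx.1.le, hx.2.le.trans hm.1.2⟩)
  have e2 : (h t).abs ≤ ∫⁻ x in Ioc M t, G x := by
    rcases eq_or_lt_of_le hM.1.2 with hsm | hsm
    · have : h t = 0 := by rw [← hsm]; exact hzero _ hM
      simp [this]
    · have hlim : Tendsto (fun x => (∫⁻ y in Ioc M t, G y) + ENNReal.ofReal |k x|) (𝓝[Ioo M t] M)
          (𝓝 ((∫⁻ y in Ioc M t, G y) + ENNReal.ofReal |k M|)) := by
        refine Tendsto.const_add _ (ENNReal.tendsto_ofReal (Tendsto.abs ?_))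
        exact ((hk M (hsub hM.1)).mono (fun x hx => hsub ⟨hM.1.1.trans hx.1.le, hx.2.le⟩))
      have : k M = 0 := hM.2
      rw [this] at hlim
      simp only [abs_zero, ENNReal.ofReal_zero, add_zero] at hlim
      have : (𝓝[Ioo M t] M).NeBot := left_nhdsWithin_Ioo_neBot hsm
      refine ge_of_tendsto hlim ?_
      filter_upwards [self_mem_nhdsWithin] with x hx
      refine (abs_le_abs_sub_add_ereal (h t) (h x)).trans (add_le_add ?_ ?_)
      · rw [abs_sub_comm_ereal]
        refine (H x t (hs.trans (hM.1.1.trans hx.1.le)) hx.2 ht fun y hy => hupp y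
          (hx.1.trans_le hy.1) hy.2).trans
          (lintegral_mono_set fun y hy => ⟨hx.1.trans_le hy.1, hy.2⟩)
      · exact hhk x (hsub ⟨hM.1.1.trans hx.1.le, hx.2.le⟩)
  refine (abs_sub_le_add_ereal _ _).trans ((add_le_add e1 e2).trans ?_)
  refine setLIntegral_add_of_subset measurableSet_Ioc ?_ ?_ G
  · exact Set.disjoint_left.2 fun x hx hx' => absurd (hx.2.trans_le hmM) (not_lt.2 hx'.1.le)
  · rintro x (hx | hx)
    · exact ⟨hx.1, hx.2.le.trans hm.1.2⟩
    · exact ⟨hM.1.1.trans hx.1.le, hx.2⟩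

/-- A finite oscillation forces both end values to be real, and absolute continuity of the integral
gives continuity. -/
theorem ControlledOn.exists_real {h : ℝ → EReal} {G : ℝ → ℝ≥0∞} {a b : ℝ} (hab : a < b)
    (H : ControlledOn h G a b) (hG : ∫⁻ x in Icc a b, G x ≠ ∞) :
    ∃ k : ℝ → ℝ, (∀ t ∈ Icc a b, h t = k t) ∧ ContinuousOn k (Icc a b) := by
  have hfin : ∀ t ∈ Icc a b, h t = (h t).toReal := by
    have key : ∀ s t, a ≤ s → s < t → t ≤ b → h s = (h s).toReal ∧ h t = (h t).toReal := by
      intro s t hs hst ht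
      have h1 : (h s - h t).abs ≠ ∞ := ne_top_of_le_ne_top hG
        ((H s t hs hst ht).trans (lintegral_mono_set (Icc_subset_Icc hs ht)))
      obtain ⟨x, y, hx, hy⟩ := exists_real_of_abs_sub_ne_top h1
      simp [hx, hy]
    intro t ht
    rcases eq_or_lt_of_le ht.1 with h1 | h1
    · exact h1 ▸ (key a b le_rfl hab le_rfl).1
    · exact (key a t le_rfl h1 ht.2).2
  refine ⟨fun t => (h t).toReal, hfin, ?_⟩
  have key : ∀ ε : ℝ≥0∞, ε ≠ 0 → ∃ δ : ℝ, 0 < δ ∧ ∀ s ∈ Icc a b, ∀ t ∈ Icc a b, s < t →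
      t - s < δ → ENNReal.ofReal |(h s).toReal - (h t).toReal| < ε := by
    intro ε hε
    obtain ⟨δ, hδ, H'⟩ := exists_pos_setLIntegral_lt_of_measure_lt hG hε
    obtain ⟨d, hd0, hd⟩ : ∃ d : ℝ, 0 < d ∧ ENNReal.ofReal d ≤ δ := by
      rcases eq_or_ne δ ∞ with h1 | h1
      · exact ⟨1, one_pos, by simp [h1]⟩
      · exact ⟨δ.toReal, ENNReal.toReal_pos hδ.ne' h1, (ENNReal.ofReal_toReal h1).le⟩
    refine ⟨d, hd0, fun s hs t ht hst hlt => ?_⟩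
    have h1 := H s t hs.1 hst ht.2
    rw [hfin s hs, hfin t ht, abs_coe_sub_coe] at h1
    refine h1.trans_lt ?_
    have h2 := H' (Icc s t) ?_
    · rwa [Measure.restrict_restrict measurableSet_Icc,
        inter_eq_left.2 (Icc_subset_Icc hs.1 ht.2)] at h2
    · rw [Measure.restrict_apply measurableSet_Icc, inter_eq_left.2 (Icc_subset_Icc hs.1 ht.2),
        Real.volume_Icc]
      exact ((ENNReal.ofReal_lt_ofReal_iff hd0).2 hlt).trans_le hd
  refine Metric.continuousOn_iff.2 fun t ht ε hε => ?_
  obtain ⟨δ, hδ, H'⟩ := key (ENNReal.ofReal ε) (by simpa using hε)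
  refine ⟨δ, hδ, fun s hs hst => ?_⟩
  rw [Real.dist_eq] at hst ⊢
  rcases lt_trichotomy s t with h1 | h1 | h1
  · have := H' s hs t ht h1 (by rw [abs_lt] at hst; linarith)
    exact (ENNReal.ofReal_lt_ofReal_iff hε).1 this
  · simpa [h1] using hε
  · have := H' t ht s hs h1 (by rw [abs_lt] at hst; linarith)
    rw [abs_sub_comm]
    exact (ENNReal.ofReal_lt_ofReal_iff hε).1 this

/-- On a level set the control may be dropped. -/
theorem ControlledOn.of_ne {h : ℝ → EReal} {G G' : ℝ → ℝ≥0∞} {a b : ℝ} (hab : a < b)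
    (H : ControlledOn h G a b) (hG : ∫⁻ x in Icc a b, G x ≠ ∞) (c : ℝ)
    (hG' : ∀ᵐ x ∂volume.restrict (Icc a b), h x ≠ c → G x ≤ G' x) :
    ControlledOn h G' a b := by
  obtain ⟨k, hk, hkc⟩ := H.exists_real hab hG
  -- With `k = h - c` only subintervals on which `h` avoids `c` have to be treated, and there `G ≤
  -- G'` a.e.
  have : ControlledOn (fun t => h t - c) G' a b := by
    refine ControlledOn.of_pointwise (k := fun t => k t - c) (hkc.sub continuousOn_const) ?_ ?_
    · intro t ht
      simp only [hk t ht, abs_coe_sub_coe, le_refl]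
    · intro s t hs hst ht hne
      have hsI : s ∈ Icc a b := ⟨hs, hst.le.trans ht⟩
      have htI : t ∈ Icc a b := ⟨hs.trans hst.le, ht⟩
      have e : (h s - c - (h t - c)).abs = (h s - h t).abs := by
        rw [hk s hsI, hk t htI, ← EReal.coe_sub, ← EReal.coe_sub, ← EReal.coe_sub, ← EReal.coe_sub]
        simp
      rw [e]
      refine (H s t hs hst ht).trans (lintegral_mono_ae ?_)
      have h1 := ae_mono (Measure.restrict_mono (Icc_subset_Icc hs ht) le_rfl) hG'
      filter_upwards [h1, ae_restrict_mem measurableSet_Icc] with x hx hxI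
      refine hx ?_
      rw [hk x (Icc_subset_Icc hs ht hxI)]
      have := hne x hxI
      rw [sub_ne_zero] at this
      exact_mod_cast this
  intro s t hs hst ht
  have hsI : s ∈ Icc a b := ⟨hs, hst.le.trans ht⟩
  have htI : t ∈ Icc a b := ⟨hs.trans hst.le, ht⟩
  have h1 := this s t hs hst ht
  simp only [hk s hsI, hk t htI, ← EReal.coe_sub] at h1 ⊢
  simpa using h1

/-- Intervals can be cut, so one may switch from `G₁` to `G₂` at a point; this is the case `B = Iic
c`. The general Borel set follows by induction. The quantifiers over `G₁` and `G₂` stay inside,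
because complements swap the two functions and unions replace one of them by a glued function. No
differentiation of `h` is involved. -/
theorem ControlledOn.piecewise {h : ℝ → EReal} {a b : ℝ} {B : Set ℝ} (hB : MeasurableSet B) :
    ∀ G₁ G₂ : ℝ → ℝ≥0∞, Measurable G₁ → Measurable G₂ → ∫⁻ x in Icc a b, G₁ x ≠ ∞ →
      ∫⁻ x in Icc a b, G₂ x ≠ ∞ → ControlledOn h G₁ a b → ControlledOn h G₂ a b →
      ControlledOn h (fun x => (B.indicator G₁ x) + (Bᶜ.indicator G₂ x)) a b := by
  have hfin : ∀ (B : Set ℝ) (G₁ G₂ : ℝ → ℝ≥0∞), MeasurableSet B → Measurable G₁ →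
      ∫⁻ x in Icc a b, G₁ x ≠ ∞ → ∫⁻ x in Icc a b, G₂ x ≠ ∞ →
      ∫⁻ x in Icc a b, (B.indicator G₁ x) + (Bᶜ.indicator G₂ x) ≠ ∞ := by
    intro B G₁ G₂ hB h1 h2 h3
    rw [lintegral_add_left (h1.indicator hB)]
    exact ENNReal.add_ne_top.2 ⟨ne_top_of_le_ne_top h2 (lintegral_mono (indicator_le_self _ _)),
      ne_top_of_le_ne_top h3 (lintegral_mono (indicator_le_self _ _))⟩
  have hmeas : ∀ (B : Set ℝ) (G₁ G₂ : ℝ → ℝ≥0∞), MeasurableSet B → Measurable G₁ → Measurable G₂ →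
      Measurable fun x => (B.indicator G₁ x) + (Bᶜ.indicator G₂ x) := fun B G₁ G₂ hB h1 h2 =>
    (h1.indicator hB).add (h2.indicator hB.compl)
  induction B, hB using MeasurableSpace.induction_on_inter
    ((BorelSpace.measurable_eq (α := ℝ)).trans (borel_eq_generateFrom_Iic ℝ))
    isPiSystem_Iic with
  | basic B hBC =>
    obtain ⟨c, rfl⟩ := hBC
    intro G₁ G₂ m1 m2 f1 f2 c1 c2 s t hs hst ht
    rcases le_or_gt t c with h1 | h1
    · refine (c1 s t hs hst ht).trans (setLIntegral_mono' measurableSet_Icc fun x hx => ?_)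
      have : x ∈ Iic c := hx.2.trans h1
      simp [this]
    rcases lt_or_ge s c with h2 | h2
    · refine (abs_sub_le_ereal _ (h c) _).trans ((add_le_add (c1 s c hs h2 (h1.le.trans ht))
        (c2 c t (hs.trans h2.le) h1 ht)).trans ?_)
      rw [← restrict_Ioc_eq_restrict_Icc (a := c) (b := t)]
      refine le_trans (add_le_add (setLIntegral_mono' (g := fun x => ((Iic c).indicator G₁ x) +
        ((Iic c)ᶜ.indicator G₂ x)) measurableSet_Icc fun x hx => ?_)
        (setLIntegral_mono' (g := fun x => ((Iic c).indicator G₁ x) +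
        ((Iic c)ᶜ.indicator G₂ x)) measurableSet_Ioc fun x hx => ?_)) ?_
      · have : x ∈ Iic c := hx.2
        simp [this]
      · have : x ∉ Iic c := not_le.2 hx.1
        simp only [indicator_of_notMem this, indicator_of_mem (mem_compl this), zero_add, le_refl]
      · refine setLIntegral_add_of_subset measurableSet_Ioc ?_ ?_ _
        · exact Set.disjoint_left.2 fun x hx hx' => absurd hx.2 (not_le.2 hx'.1)
        · rintro x (hx | hx)
          · exact ⟨hx.1, hx.2.trans h1.le⟩
          · exact ⟨h2.le.trans hx.1.le, hx.2⟩
    · refine (c2 s t hs hst ht).trans ?_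
      rw [← restrict_Ioc_eq_restrict_Icc (a := s) (b := t)]
      refine setLIntegral_mono' measurableSet_Ioc fun x hx => ?_
      have : x ∉ Iic c := not_le.2 (h2.trans_lt hx.1)
      simp only [indicator_of_notMem this, indicator_of_mem (mem_compl this), zero_add, le_refl]
  | empty =>
    intro G₁ G₂ m1 m2 f1 f2 c1 c2
    simpa using c2
  | compl B hB IH =>
    intro G₁ G₂ m1 m2 f1 f2 c1 c2
    have := IH G₂ G₁ m2 m1 f2 f1 c2 c1
    simpa [compl_compl, add_comm] using this
  | iUnion B _ hBm IH =>
    intro G₁ G₂ m1 m2 f1 f2 c1 c2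
    have hAm : ∀ n, MeasurableSet (Set.accumulate B n) := fun n =>
      MeasurableSet.biUnion (to_countable _) fun i _ => hBm i
    have hA : ∀ n, ControlledOn h (fun x => ((Set.accumulate B n).indicator G₁ x) +
        ((Set.accumulate B n)ᶜ.indicator G₂ x)) a b := by
      intro n
      induction n with
      | zero =>
        rw [accumulate_zero_nat]
        exact IH 0 G₁ G₂ m1 m2 f1 f2 c1 c2
      | succ n ih =>
        -- The function glued along the earlier sets plays the role of `G₂`.
        have h1 := IH (n + 1) G₁ _ m1 (hmeas _ _ _ (hAm n) m1 m2) f1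
          (hfin _ _ _ (hAm n) m1 f1 f2) c1 ih
        refine h1.mono_ae (Eventually.of_forall fun x => ?_)
        rw [accumulate_succ]
        by_cases hx : x ∈ B (n + 1) <;> by_cases hx' : x ∈ accumulate B n <;> simp [hx, hx']
    intro s t hs hst ht
    have hlim : Tendsto (fun n => ∫⁻ x in Icc s t, ((Set.accumulate B n).indicator G₁ x) +
        ((Set.accumulate B n)ᶜ.indicator G₂ x)) atTop
        (𝓝 (∫⁻ x in Icc s t, ((⋃ n, B n).indicator G₁ x) + ((⋃ n, B n)ᶜ.indicator G₂ x))) := by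
      refine tendsto_lintegral_of_dominated_convergence (fun x => G₁ x + G₂ x)
        (fun n => hmeas _ _ _ (hAm n) m1 m2) (fun n => Eventually.of_forall fun x =>
          add_le_add (indicator_le_self _ _ _) (indicator_le_self _ _ _)) ?_ ?_
      · rw [lintegral_add_left m1]
        exact ENNReal.add_ne_top.2
          ⟨ne_top_of_le_ne_top f1 (lintegral_mono_set (Icc_subset_Icc hs ht)),
          ne_top_of_le_ne_top f2 (lintegral_mono_set (Icc_subset_Icc hs ht))⟩
      · refine Eventually.of_forall fun x => tendsto_const_nhds.congr' ?_
        by_cases hx : x ∈ ⋃ n, B n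
        · obtain ⟨N, hN⟩ := mem_iUnion.1 hx
          filter_upwards [eventually_ge_atTop N] with n hn
          have : x ∈ accumulate B n := mem_accumulate.2 ⟨N, hn, hN⟩
          simp only [indicator_of_mem hx, indicator_of_mem this,
            indicator_of_notMem (notMem_compl_iff.2 hx),
            indicator_of_notMem (notMem_compl_iff.2 this)]
        · refine Eventually.of_forall fun n => ?_
          have : x ∉ accumulate B n := fun h' => hx (accumulate_subset_iUnion n h')
          simp only [indicator_of_notMem hx, indicator_of_notMem this,
            indicator_of_mem (mem_compl hx), indicator_of_mem (mem_compl this)]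
    exact ge_of_tendsto' hlim fun n => hA n s t hs hst ht

/-- Glue along the set where the Borel version of the first function is the smaller one. -/
theorem ControlledOn.inf {h : ℝ → EReal} {a b : ℝ} {G₁ G₂ : ℝ → ℝ≥0∞}
    (m1 : AEMeasurable G₁ (volume.restrict (Icc a b)))
    (m2 : AEMeasurable G₂ (volume.restrict (Icc a b)))
    (f1 : ∫⁻ x in Icc a b, G₁ x ≠ ∞) (f2 : ∫⁻ x in Icc a b, G₂ x ≠ ∞)
    (c1 : ControlledOn h G₁ a b) (c2 : ControlledOn h G₂ a b) :
    ControlledOn h (fun x => min (G₁ x) (G₂ x)) a b := by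
  have key := ControlledOn.piecewise (h := h) (a := a) (b := b)
    (measurableSet_le m1.measurable_mk m2.measurable_mk) _ _ m1.measurable_mk m2.measurable_mk
    (by rwa [← lintegral_congr_ae m1.ae_eq_mk]) (by rwa [← lintegral_congr_ae m2.ae_eq_mk])
    (c1.mono_ae (m1.ae_eq_mk.mono fun x hx => hx.le))
    (c2.mono_ae (m2.ae_eq_mk.mono fun x hx => hx.le))
  refine key.mono_ae ?_
  filter_upwards [m1.ae_eq_mk, m2.ae_eq_mk] with x h1 h2
  rw [h1, h2]
  by_cases hx : m1.mk G₁ x ≤ m2.mk G₂ x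
  · simp [indicator, hx]
  · simp [indicator, hx, (not_le.1 hx).le]

/-! ### Powers and suprema -/

/-- Suprema are used in place of sums of functions because the p-th power of a supremum is at most
the sum of the p-th powers, so Minkowski's inequality is not needed. -/
theorem lintegral_iSup_rpow_le {α : Type*} [MeasurableSpace α] {μ : Measure α} {p : ℝ} (hp : 0 < p)
    {f : ℕ → α → ℝ≥0∞} (hf : ∀ n, Measurable (f n)) :
    ∫⁻ x, (⨆ n, f n x) ^ p ∂μ ≤ ∑' n, ∫⁻ x, f n x ^ p ∂μ := by
  rw [← lintegral_tsum fun n => ((hf n).pow_const p).aemeasurable]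
  refine lintegral_mono fun x => ?_
  rw [← ENNReal.le_rpow_inv_iff hp]
  refine iSup_le fun n => ?_
  rw [ENNReal.le_rpow_inv_iff hp]
  exact ENNReal.le_tsum (f := fun n => f n x ^ p) n

theorem lintegral_sup_rpow_le {α : Type*} [MeasurableSpace α] {μ : Measure α} {p : ℝ}
    {f g : α → ℝ≥0∞} (hf : Measurable f) :
    ∫⁻ x, (max (f x) (g x)) ^ p ∂μ ≤ ∫⁻ x, f x ^ p ∂μ + ∫⁻ x, g x ^ p ∂μ := by
  rw [← lintegral_add_left (hf.pow_const p)]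
  refine lintegral_mono fun x => ?_
  rcases le_total (f x) (g x) with h | h
  · simp [h]
  · simp [h]

theorem lintegral_const_mul_rpow {α : Type*} [MeasurableSpace α] {μ : Measure α} {p : ℝ}
    (hp : 0 < p) {f : α → ℝ≥0∞} (hf : Measurable f) (c : ℝ≥0∞) :
    ∫⁻ x, (c * f x) ^ p ∂μ = c ^ p * ∫⁻ x, f x ^ p ∂μ := by
  rw [← lintegral_const_mul _ (hf.pow_const p)]
  exact lintegral_congr fun x => ENNReal.mul_rpow_of_nonneg _ _ hp.le

/-- Countably many functions with `f n ^ p` integrable are dominated, up to positive factors, by a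
single one. -/
theorem exists_dominating {α : Type*} [MeasurableSpace α] {μ : Measure α} {p : ℝ} (hp : 0 < p)
    {f : ℕ → α → ℝ≥0∞} (hf : ∀ n, Measurable (f n)) (hfin : ∀ n, ∫⁻ x, f n x ^ p ∂μ ≠ ∞) :
    ∃ (F : α → ℝ≥0∞) (c : ℕ → ℝ≥0∞), Measurable F ∧ ∫⁻ x, F x ^ p ∂μ ≠ ∞ ∧
      (∀ n, c n ≠ ∞) ∧ ∀ n x, f n x ≤ c n * F x := by
  -- The factor `d n` shrinks the n-th energy below a geometric term; the dominating function is the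
  -- supremum of the `d n * f n`.
  have hd : ∀ n, ∃ d : ℝ≥0∞, d ≠ 0 ∧ d ≠ ∞ ∧ d ^ p * ∫⁻ x, f n x ^ p ∂μ ≤ (2⁻¹ : ℝ≥0∞) ^ n := by
    intro n
    have h0 : Tendsto (fun d : ℝ≥0∞ => d ^ p * ∫⁻ x, f n x ^ p ∂μ) (𝓝 0) (𝓝 0) := by
      have h1 : Tendsto (fun d : ℝ≥0∞ => d ^ p) (𝓝 0) (𝓝 0) := by
        have := (ENNReal.continuous_rpow_const (y := p)).tendsto 0
        rwa [ENNReal.zero_rpow_of_pos hp] at this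
      have := ENNReal.Tendsto.mul_const h1 (b := ∫⁻ x, f n x ^ p ∂μ) (Or.inr (hfin n))
      rwa [zero_mul] at this
    have h2 : (0 : ℝ≥0∞) < (2⁻¹ : ℝ≥0∞) ^ n := ENNReal.pow_pos (by simp) n
    have h3 := (h0.eventually_lt_const h2)
    rw [ENNReal.nhds_zero_basis_Iic.eventually_iff] at h3
    obtain ⟨d, hd0, hd⟩ := h3
    refine ⟨min d 1, (lt_min hd0 one_pos).ne', ne_top_of_le_ne_top ENNReal.one_ne_top
      (min_le_right _ _), (hd (min_le_left d 1)).le⟩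
  choose d d0 dt hd using hd
  refine ⟨fun x => ⨆ n, d n * f n x, fun n => (d n)⁻¹, Measurable.iSup fun n => (hf n).const_mul _,
    ?_, fun n => ENNReal.inv_ne_top.2 (d0 n), fun n x => ?_⟩
  · refine ne_top_of_le_ne_top ?_ (lintegral_iSup_rpow_le hp fun n => (hf n).const_mul _)
    refine ne_top_of_le_ne_top (b := ∑' n : ℕ, (2⁻¹ : ℝ≥0∞) ^ n) ?_ (ENNReal.tsum_le_tsum fun n => ?_)
    · rw [ENNReal.tsum_geometric]; simp
    · rw [lintegral_const_mul_rpow hp (hf n)]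
      exact hd n
  · rw [mul_comm, ← div_eq_mul_inv, ENNReal.le_div_iff_mul_le (Or.inl (d0 n)) (Or.inl (dt n)),
      mul_comm]
    exact le_iSup (fun n => d n * f n x) n

/-! ### Curves -/

section Space

variable {Y : Type*} [MetricSpace Y]

theorem Curve.edist_le (γ : Curve Y) {s t : ℝ} (hs : 0 ≤ s) (hst : s ≤ t) (ht : t ≤ γ.length) :
    edist (γ.toFun s) (γ.toFun t) ≤ ENNReal.ofReal (t - s) := by
  have h := γ.unitSpeed (x := s) ⟨hs, hst.trans ht⟩ (y := t) ⟨hs.trans hst, ht⟩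
  rw [NNReal.coe_one, one_mul] at h
  rw [← h]
  exact eVariationOn.edist_le _ ⟨⟨hs, hst.trans ht⟩, ⟨le_rfl, hst⟩⟩
    ⟨⟨hs.trans hst, ht⟩, ⟨hst, le_rfl⟩⟩

theorem Curve.dist_le (γ : Curve Y) {s t : ℝ} (hs : s ∈ Icc 0 γ.length) (ht : t ∈ Icc 0 γ.length) :
    dist (γ.toFun s) (γ.toFun t) ≤ |s - t| := by
  have key : ∀ s t : ℝ, 0 ≤ s → s ≤ t → t ≤ γ.length → dist (γ.toFun s) (γ.toFun t) ≤ |s - t| := by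
    intro s t hs hst ht
    have := γ.edist_le hs hst ht
    rw [edist_dist] at this
    have h2 := (ENNReal.ofReal_le_ofReal_iff (by linarith)).1 this
    rw [abs_sub_comm, abs_of_nonneg (by linarith)]
    exact h2
  rcases le_total s t with h | h
  · exact key s t hs.1 h ht.2
  · rw [dist_comm, abs_sub_comm]
    exact key t s ht.1 h hs.2

theorem Curve.continuousOn (γ : Curve Y) : ContinuousOn γ.toFun (Icc 0 γ.length) := by
  have : LipschitzOnWith 1 γ.toFun (Icc 0 γ.length) :=
    LipschitzOnWith.of_dist_le_mul fun s hs t ht => by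
      simpa [Real.dist_eq] using γ.dist_le hs ht
  exact this.continuousOn

/-- The part of a curve between two parameters. -/
def Curve.sub (γ : Curve Y) (s t : ℝ) (hs : 0 ≤ s) (hst : s < t) (ht : t ≤ γ.length) : Curve Y where
  length := t - s
  length_pos := sub_pos.2 hst
  toFun x := γ.toFun (s + x)
  unitSpeed := by
    intro x hx y hy
    rcases le_or_gt x y with hxy | hxy
    · have h := γ.unitSpeed (x := s + x) ⟨by linarith [hx.1], by linarith [hx.2]⟩ (y := s + y)
        ⟨by linarith [hy.1], by linarith [hy.2]⟩
      rw [show s + y - (s + x) = y - x by ring] at h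
      rw [← h]
      have e1 : Icc 0 (t - s) ∩ Icc x y = Icc x y :=
        inter_eq_right.2 (Icc_subset_Icc hx.1 hy.2)
      have e2 : Icc 0 γ.length ∩ Icc (s + x) (s + y) = Icc (s + x) (s + y) :=
        inter_eq_right.2 (Icc_subset_Icc (by linarith [hx.1]) (by linarith [hy.2]))
      rw [e1, e2]
      have := eVariationOn.comp_eq_of_monotoneOn γ.toFun (t := Icc x y) (fun x => s + x)
        (fun a _ b _ hab => by simpa using hab)
      rw [image_const_add_Icc] at this
      exact this
    -- `HasUnitSpeedOn` also quantifies over pairs in the wrong order, for which both sides are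
    -- zero.
    · rw [Icc_eq_empty (not_le.2 hxy), inter_empty, eVariationOn.subsingleton _ subsingleton_empty,
        ENNReal.ofReal_of_nonpos]
      simp only [NNReal.coe_one, one_mul]
      linarith

@[simp] theorem Curve.sub_length (γ : Curve Y) {s t : ℝ} (hs : 0 ≤ s) (hst : s < t)
    (ht : t ≤ γ.length) : (γ.sub s t hs hst ht).length = t - s := rfl

@[simp] theorem Curve.sub_toFun (γ : Curve Y) {s t : ℝ} (hs : 0 ≤ s) (hst : s < t)
    (ht : t ≤ γ.length) (x : ℝ) : (γ.sub s t hs hst ht).toFun x = γ.toFun (s + x) := rfl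

theorem setLIntegral_Icc_add_left (G : ℝ → ℝ≥0∞) (s t : ℝ) :
    ∫⁻ x in Icc 0 (t - s), G (s + x) = ∫⁻ x in Icc s t, G x := by
  have h := (measurePreserving_add_left (volume : Measure ℝ) s).setLIntegral_comp_preimage_emb
    (measurableEmbedding_addLeft s) G (Icc s t)
  rw [← h]
  congr 2
  ext x
  simp

variable [MeasurableSpace Y]

theorem Curve.lineIntegral_sub (γ : Curve Y) {s t : ℝ} (hs : 0 ≤ s) (hst : s < t)
    (ht : t ≤ γ.length) (g : Y → ℝ≥0∞) :
    (γ.sub s t hs hst ht).lineIntegral g = ∫⁻ x in Icc s t, g (γ.toFun x) :=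
  setLIntegral_Icc_add_left (fun x => g (γ.toFun x)) s t

theorem Curve.osc_sub (γ : Curve Y) {s t : ℝ} (hs : 0 ≤ s) (hst : s < t)
    (ht : t ≤ γ.length) (u : Y → EReal) :
    (γ.sub s t hs hst ht).osc u = (u (γ.toFun s) - u (γ.toFun t)).abs := by
  simp [Curve.osc]

theorem Curve.lineIntegral_sub_le (γ : Curve Y) {s t : ℝ} (hs : 0 ≤ s) (hst : s < t)
    (ht : t ≤ γ.length) (g : Y → ℝ≥0∞) :
    (γ.sub s t hs hst ht).lineIntegral g ≤ γ.lineIntegral g := by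
  rw [γ.lineIntegral_sub]
  exact lintegral_mono_set (Icc_subset_Icc hs ht)

theorem Curve.lineIntegral_mono (γ : Curve Y) {g g' : Y → ℝ≥0∞} (h : ∀ x, g x ≤ g' x) :
    γ.lineIntegral g ≤ γ.lineIntegral g' := lintegral_mono fun _ => h _

theorem Curve.aemeasurable [BorelSpace Y] (γ : Curve Y) :
    AEMeasurable γ.toFun (volume.restrict (Icc 0 γ.length)) :=
  γ.continuousOn.aemeasurable measurableSet_Icc

theorem Curve.aemeasurable_comp [BorelSpace Y] (γ : Curve Y) {β : Type*} [MeasurableSpace β]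
    {g : Y → β} (hg : Measurable g) :
    AEMeasurable (fun t => g (γ.toFun t)) (volume.restrict (Icc 0 γ.length)) :=
  hg.comp_aemeasurable γ.aemeasurable

theorem Curve.lineIntegral_const_mul [BorelSpace Y] (γ : Curve Y) {g : Y → ℝ≥0∞}
    (hg : Measurable g) (c : ℝ≥0∞) :
    γ.lineIntegral (fun x => c * g x) = c * γ.lineIntegral g :=
  lintegral_const_mul'' _ (γ.aemeasurable_comp hg)

theorem Curve.lineIntegral_add [BorelSpace Y] (γ : Curve Y) {g g' : Y → ℝ≥0∞}
    (hg : Measurable g) :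
    γ.lineIntegral (fun x => g x + g' x) = γ.lineIntegral g + γ.lineIntegral g' :=
  lintegral_add_left' (γ.aemeasurable_comp hg) _

/-! ### The filter of almost every curve -/

variable [BorelSpace Y] {p : ℝ} {μ : Measure Y}

/-- The filter of the sets containing `p`-almost every curve. -/
def aeCurve (hp : 0 < p) (μ : Measure Y) : Filter (Curve Y) where
  sets := {S | ∃ ρ : Y → ℝ≥0∞, Measurable ρ ∧ ∫⁻ x, ρ x ^ p ∂μ ≠ ∞ ∧
    ∀ γ : Curve Y, γ.lineIntegral ρ ≠ ∞ → γ ∈ S}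
  univ_sets := ⟨fun _ => 0, measurable_const, by simp [hp], fun _ _ => mem_univ _⟩
  sets_of_superset := by
    rintro S T ⟨ρ, h1, h2, h3⟩ hST
    exact ⟨ρ, h1, h2, fun γ hγ => hST (h3 γ hγ)⟩
  inter_sets := by
    rintro S T ⟨ρ, h1, h2, h3⟩ ⟨σ, k1, k2, k3⟩
    refine ⟨fun x => max (ρ x) (σ x), h1.max k1, ne_top_of_le_ne_top (ENNReal.add_ne_top.2 ⟨h2, k2⟩)
      (lintegral_sup_rpow_le h1), fun γ hγ => ⟨h3 γ ?_, k3 γ ?_⟩⟩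
    · exact ne_top_of_le_ne_top hγ (γ.lineIntegral_mono fun x => le_max_left _ _)
    · exact ne_top_of_le_ne_top hγ (γ.lineIntegral_mono fun x => le_max_right _ _)

theorem eventually_aeCurve_iff (hp : 0 < p) {P : Curve Y → Prop} :
    (∀ᶠ γ in aeCurve hp μ, P γ) ↔ ∃ ρ : Y → ℝ≥0∞, Measurable ρ ∧ ∫⁻ x, ρ x ^ p ∂μ ≠ ∞ ∧
      ∀ γ : Curve Y, γ.lineIntegral ρ ≠ ∞ → P γ := Iff.rfl

theorem eventually_lineIntegral_ne_top (hp : 0 < p) {g : Y → ℝ≥0∞} (hg : Measurable g)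
    (h : ∫⁻ x, g x ^ p ∂μ ≠ ∞) : ∀ᶠ γ in aeCurve hp μ, γ.lineIntegral g ≠ ∞ :=
  ⟨g, hg, h, fun _ h => h⟩

/-- `exists_dominating` merges the countably many witnesses into one of finite energy. -/
theorem eventually_forall_nat (hp : 0 < p) {P : ℕ → Curve Y → Prop}
    (h : ∀ n, ∀ᶠ γ in aeCurve hp μ, P n γ) : ∀ᶠ γ in aeCurve hp μ, ∀ n, P n γ := by
  choose ρ m f hρ using fun n => (eventually_aeCurve_iff hp).1 (h n)
  obtain ⟨F, c, hF, hFf, hc, hle⟩ := exists_dominating hp m f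
  refine ⟨F, hF, hFf, fun γ hγ n => hρ n γ ?_⟩
  refine ne_top_of_le_ne_top ?_ (γ.lineIntegral_mono (hle n))
  rw [γ.lineIntegral_const_mul hF]
  exact ENNReal.mul_ne_top (hc n) hγ

/-- Finiteness of a line integral is inherited by subcurves, so the same witness works. -/
theorem eventually_sub (hp : 0 < p) {P : Curve Y → Prop} (h : ∀ᶠ γ in aeCurve hp μ, P γ) :
    ∀ᶠ γ in aeCurve hp μ, ∀ s t hs hst ht, P (γ.sub s t hs hst ht) := by
  obtain ⟨ρ, h1, h2, h3⟩ := h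
  exact ⟨ρ, h1, h2, fun γ hγ s t hs hst ht => h3 _
    (ne_top_of_le_ne_top hγ (γ.lineIntegral_sub_le hs hst ht ρ))⟩

/-- The witness is infinite on a null set and zero elsewhere: its energy vanishes, and a curve along
which its integral is finite spends zero length in the null set. -/
theorem eventually_ae_of_ae (hp : 0 < p) {P : Y → Prop} (h : ∀ᵐ x ∂μ, P x) :
    ∀ᶠ γ in aeCurve hp μ, ∀ᵐ t ∂volume.restrict (Icc 0 γ.length), P (γ.toFun t) := by
  set N := toMeasurable μ {x | ¬ P x} with hN
  have hNm : MeasurableSet N := measurableSet_toMeasurable _ _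
  have hN0 : μ N = 0 := by rw [hN, measure_toMeasurable]; exact h
  refine ⟨N.indicator fun _ => ∞, measurable_const.indicator hNm, ?_, fun γ hγ => ?_⟩
  · have : ∀ᵐ x ∂μ, (N.indicator (fun _ => ∞) x : ℝ≥0∞) ^ p = 0 := by
      filter_upwards [measure_eq_zero_iff_ae_notMem.1 hN0] with x hx
      simp [hx, hp]
    rw [lintegral_congr_ae this]
    simp
  · have h1 := ae_lt_top' (γ.aemeasurable_comp (measurable_const.indicator hNm)) hγ
    filter_upwards [h1] with t ht
    by_contra hP
    have : γ.toFun t ∈ N := subset_toMeasurable _ _ hP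
    simp [this] at ht

/-- If the modulus is zero, admissible `ρ n` of rapidly decreasing energy exist, and the supremum of
`2 ^ n * ρ n` has finite energy but infinite integral along every exceptional curve. Conversely `ρ /
n` is admissible for each `n ≥ 1`, and its energy tends to zero. -/
theorem aeCurve_iff (hp : 0 < p) {P : Curve Y → Prop} :
    AECurve p μ P ↔ ∀ᶠ γ in aeCurve hp μ, P γ := by
  constructor
  · intro h
    have h1 : ∀ n : ℕ, ∃ ρ : Y → ℝ≥0∞, Measurable ρ ∧ (∀ γ : Curve Y, ¬ P γ → 1 ≤ γ.lineIntegral ρ) ∧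
        ∫⁻ x, ρ x ^ p ∂μ < ((2 : ℝ≥0∞) ^ n) ^ (-p) * (2⁻¹) ^ n := by
      intro n
      have h2 : modulus p μ {γ | ¬ P γ} < ((2 : ℝ≥0∞) ^ n) ^ (-p) * (2⁻¹) ^ n := by
        rw [show modulus p μ {γ | ¬ P γ} = 0 from h]
        refine ENNReal.mul_pos (ENNReal.rpow_pos (by positivity) (by finiteness)).ne' ?_
        exact (ENNReal.pow_pos (by simp) n).ne'
      unfold modulus at h2
      simp only [iInf_lt_iff] at h2
      obtain ⟨ρ, hρ, hρ', h3⟩ := h2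
      exact ⟨ρ, hρ, hρ', h3⟩
    choose ρ m adm hlt using h1
    refine ⟨fun x => ⨆ n, 2 ^ n * ρ n x, Measurable.iSup fun n => (m n).const_mul _, ?_, ?_⟩
    · refine ne_top_of_le_ne_top ?_ (lintegral_iSup_rpow_le hp fun n => (m n).const_mul _)
      refine ne_top_of_le_ne_top (b := ∑' n : ℕ, (2⁻¹ : ℝ≥0∞) ^ n) ?_
        (ENNReal.tsum_le_tsum fun n => ?_)
      · rw [ENNReal.tsum_geometric]; simp
      · rw [lintegral_const_mul_rpow hp (m n)]
        refine (mul_le_mul_right (hlt n).le _).trans ?_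
        rw [← mul_assoc, ENNReal.rpow_neg, ENNReal.mul_inv_cancel, one_mul]
        · exact (ENNReal.rpow_pos (by positivity) (by finiteness)).ne'
        · finiteness
    · intro γ hγ
      by_contra hP
      apply hγ
      refine ENNReal.eq_top_of_forall_nnreal_le fun r => ?_
      obtain ⟨n, hn⟩ := pow_unbounded_of_one_lt r (one_lt_two : (1 : ℝ≥0) < 2)
      calc (r : ℝ≥0∞) ≤ ((2 ^ n : ℝ≥0) : ℝ≥0∞) := by exact_mod_cast hn.le
        _ = 2 ^ n * 1 := by push_cast; ring
        _ ≤ 2 ^ n * γ.lineIntegral (ρ n) := by gcongr; exact adm n γ hP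
        _ = γ.lineIntegral (fun x => 2 ^ n * ρ n x) := (γ.lineIntegral_const_mul (m n) _).symm
        _ ≤ _ := γ.lineIntegral_mono fun x => le_iSup (fun n => 2 ^ n * ρ n x) n
  · rintro ⟨ρ, h1, h2, h3⟩
    have key : ∀ n : ℕ, modulus p μ {γ | ¬ P γ} ≤ ((n : ℝ≥0∞)⁻¹) ^ p * ∫⁻ x, ρ x ^ p ∂μ := by
      intro n
      rcases Nat.eq_zero_or_pos n with rfl | hn
      · rw [← lintegral_const_mul_rpow hp h1]
        refine iInf_le_of_le (fun x => ((0 : ℕ) : ℝ≥0∞)⁻¹ * ρ x) (iInf_le_of_le (h1.const_mul _)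
          (iInf_le_of_le (fun γ hγ => ?_) le_rfl))
        have : γ.lineIntegral ρ = ∞ := by_contra fun h => hγ (h3 γ h)
        rw [γ.lineIntegral_const_mul h1, this]
        simp
      · rw [← lintegral_const_mul_rpow hp h1]
        refine iInf_le_of_le (fun x => (n : ℝ≥0∞)⁻¹ * ρ x) (iInf_le_of_le (h1.const_mul _)
          (iInf_le_of_le (fun γ hγ => ?_) le_rfl))
        have : γ.lineIntegral ρ = ∞ := by_contra fun h => hγ (h3 γ h)
        rw [γ.lineIntegral_const_mul h1, this, ENNReal.mul_top]
        · exact le_top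
        · simp
    have hlim : Tendsto (fun n : ℕ => ((n : ℝ≥0∞)⁻¹) ^ p * ∫⁻ x, ρ x ^ p ∂μ) atTop (𝓝 0) := by
      have h4 : Tendsto (fun n : ℕ => ((n : ℝ≥0∞)⁻¹) ^ p) atTop (𝓝 0) := by
        have := ((ENNReal.continuous_rpow_const (y := p)).tendsto 0).comp
          ENNReal.tendsto_inv_nat_nhds_zero
        rwa [ENNReal.zero_rpow_of_pos hp] at this
      have := ENNReal.Tendsto.mul_const h4 (b := ∫⁻ x, ρ x ^ p ∂μ) (Or.inr h2)
      rwa [zero_mul] at this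
    exact le_antisymm (ge_of_tendsto' hlim key) zero_le

end Space

section Space

variable {Y : Type*} [MetricSpace Y] [MeasurableSpace Y] [BorelSpace Y] {p : ℝ} {μ : Measure Y}
  {hp : 0 < p} {g g₁ g₂ g' : Y → ℝ≥0∞} {u u' : Y → EReal}

/-! ### Borel weak upper gradients -/

/-- `g` is Borel, and the upper gradient inequality holds on `p`-almost every curve. -/
def WeakGrad (hp : 0 < p) (μ : Measure Y) (g : Y → ℝ≥0∞) (u : Y → EReal) : Prop :=
  Measurable g ∧ ∀ᶠ γ in aeCurve hp μ, γ.osc u ≤ γ.lineIntegral g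

theorem WeakGrad.controlled (h : WeakGrad hp μ g u) : ∀ᶠ γ in aeCurve hp μ,
    ControlledOn (fun t => u (γ.toFun t)) (fun t => g (γ.toFun t)) 0 γ.length := by
  filter_upwards [eventually_sub hp h.2] with γ hγ s t hs hst ht
  have := hγ s t hs hst ht
  rwa [γ.osc_sub, γ.lineIntegral_sub] at this

theorem weakGrad_of_controlled (hg : Measurable g) (h : ∀ᶠ γ in aeCurve hp μ,
    ControlledOn (fun t => u (γ.toFun t)) (fun t => g (γ.toFun t)) 0 γ.length) :
    WeakGrad hp μ g u := by
  refine ⟨hg, ?_⟩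
  filter_upwards [h] with γ hγ
  exact hγ 0 γ.length le_rfl γ.length_pos le_rfl

theorem IsUpperGradient.weakGrad (hp : 0 < p) (μ : Measure Y) (h : IsUpperGradient g u) :
    WeakGrad hp μ g u := ⟨h.1, Eventually.of_forall h.2⟩

/-- Taking the maximum with a small multiple of the witness `ρ` repairs the inequality on the
exceptional curves, where `ρ` has infinite integral. -/
theorem WeakGrad.exists_isUpperGradient (h : WeakGrad hp μ g u) {ε : ℝ≥0∞} (hε : ε ≠ 0) :
    ∃ g', IsUpperGradient g' u ∧ ∫⁻ x, g' x ^ p ∂μ ≤ ∫⁻ x, g x ^ p ∂μ + ε := by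
  obtain ⟨ρ, h1, h2, h3⟩ := h.2
  obtain ⟨c, hc0, hc⟩ : ∃ c : ℝ≥0∞, c ≠ 0 ∧ c ^ p * ∫⁻ x, ρ x ^ p ∂μ ≤ ε := by
    have h0 : Tendsto (fun d : ℝ≥0∞ => d ^ p * ∫⁻ x, ρ x ^ p ∂μ) (𝓝 0) (𝓝 0) := by
      have h1 : Tendsto (fun d : ℝ≥0∞ => d ^ p) (𝓝 0) (𝓝 0) := by
        have := (ENNReal.continuous_rpow_const (y := p)).tendsto 0
        rwa [ENNReal.zero_rpow_of_pos hp] at this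
      have := ENNReal.Tendsto.mul_const h1 (b := ∫⁻ x, ρ x ^ p ∂μ) (Or.inr h2)
      rwa [zero_mul] at this
    have h3 := h0.eventually_lt_const (pos_iff_ne_zero.2 hε)
    rw [ENNReal.nhds_zero_basis_Iic.eventually_iff] at h3
    obtain ⟨d, hd0, hd⟩ := h3
    exact ⟨d, hd0.ne', (hd (le_refl d)).le⟩
  refine ⟨fun x => max (g x) (c * ρ x), ⟨h.1.max (h1.const_mul _), fun γ => ?_⟩, ?_⟩
  · by_cases hγ : γ.lineIntegral ρ = ∞
    · refine le_top.trans (le_trans ?_ (γ.lineIntegral_mono fun x => le_max_right _ _))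
      rw [γ.lineIntegral_const_mul h1, hγ, ENNReal.mul_top hc0]
    · exact (h3 γ hγ).trans (γ.lineIntegral_mono fun x => le_max_left _ _)
  · refine (lintegral_sup_rpow_le h.1).trans (add_le_add le_rfl ?_)
    rw [lintegral_const_mul_rpow hp h1]
    exact hc

theorem memDirichlet_iff (hp : 0 < p) : MemDirichlet p μ u ↔
    AEMeasurable u μ ∧ ∃ g, WeakGrad hp μ g u ∧ ∫⁻ x, g x ^ p ∂μ ≠ ∞ := by
  refine and_congr_right fun _ => ⟨?_, ?_⟩
  · rintro ⟨g, h1, h2⟩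
    exact ⟨g, h1.weakGrad hp μ, h2.ne⟩
  · rintro ⟨g, h1, h2⟩
    obtain ⟨g', h3, h4⟩ := h1.exists_isUpperGradient one_ne_zero
    exact ⟨g', h3, h4.trans_lt (by finiteness)⟩

theorem WeakGrad.congr (h : WeakGrad hp μ g u)
    (huu' : ∀ᶠ γ in aeCurve hp μ, ∀ t ∈ Icc 0 γ.length, u (γ.toFun t) = u' (γ.toFun t)) :
    WeakGrad hp μ g u' := by
  refine ⟨h.1, ?_⟩
  filter_upwards [h.2, huu'] with γ h1 h2
  rwa [Curve.osc, ← h2 0 ⟨le_rfl, γ.length_pos.le⟩, ← h2 γ.length ⟨γ.length_pos.le, le_rfl⟩]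

theorem WeakGrad.mono_ae (h : WeakGrad hp μ g u) (hg' : Measurable g')
    (hgg' : ∀ᵐ x ∂μ, g x ≤ g' x) : WeakGrad hp μ g' u := by
  refine ⟨hg', ?_⟩
  filter_upwards [h.2, eventually_ae_of_ae hp hgg'] with γ h1 h2
  exact h1.trans (lintegral_mono_ae h2)

/-- Almost every curve spends zero length where a function differs from its Borel version, so only
Borel gradients need to be considered. -/
theorem isWeakUpperGradient_iff (hp : 0 < p) : IsWeakUpperGradient p μ g u ↔
    ∃ g', g =ᵐ[μ] g' ∧ WeakGrad hp μ g' u := by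
  unfold IsWeakUpperGradient
  rw [aeCurve_iff hp]
  constructor
  · rintro ⟨h1, h2⟩
    refine ⟨h1.mk g, h1.ae_eq_mk, h1.measurable_mk, ?_⟩
    filter_upwards [h2, eventually_ae_of_ae hp h1.ae_eq_mk] with γ h3 h4
    exact h3.2.trans (lintegral_mono_ae (h4.mono fun t ht => ht.le))
  · rintro ⟨g', h1, h2, h3⟩
    refine ⟨⟨g', h2, h1⟩, ?_⟩
    filter_upwards [h3, eventually_ae_of_ae hp h1] with γ h4 h5
    exact ⟨(γ.aemeasurable_comp h2).congr (h5.mono fun t ht => ht.symm),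
      h4.trans (lintegral_mono_ae (h5.mono fun t ht => ht.ge))⟩

theorem WeakGrad.eventually_real (h : WeakGrad hp μ g u) (hg : ∫⁻ x, g x ^ p ∂μ ≠ ∞) :
    ∀ᶠ γ in aeCurve hp μ, ∃ k : ℝ → ℝ, (∀ t ∈ Icc 0 γ.length, u (γ.toFun t) = k t) ∧
      ContinuousOn k (Icc 0 γ.length) := by
  filter_upwards [h.controlled, eventually_lineIntegral_ne_top hp h.1 hg] with γ h1 h2
  exact h1.exists_real γ.length_pos h2

theorem WeakGrad.inf (h₁ : WeakGrad hp μ g₁ u) (h₂ : WeakGrad hp μ g₂ u)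
    (f₁ : ∀ᶠ γ in aeCurve hp μ, γ.lineIntegral g₁ ≠ ∞)
    (f₂ : ∀ᶠ γ in aeCurve hp μ, γ.lineIntegral g₂ ≠ ∞) :
    WeakGrad hp μ (fun x => min (g₁ x) (g₂ x)) u := by
  refine weakGrad_of_controlled (h₁.1.min h₂.1) ?_
  filter_upwards [h₁.controlled, h₂.controlled, f₁, f₂] with γ c1 c2 f1 f2
  exact ControlledOn.inf (γ.aemeasurable_comp h₁.1) (γ.aemeasurable_comp h₂.1) f1 f2 c1 c2

/-- On a level set of `u` a weak upper gradient may be replaced by zero. -/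
theorem WeakGrad.of_ne (h : WeakGrad hp μ g u) (f : ∀ᶠ γ in aeCurve hp μ, γ.lineIntegral g ≠ ∞)
    (c : ℝ) (hg' : Measurable g') (hgg' : ∀ᵐ x ∂μ, u x ≠ c → g x ≤ g' x) :
    WeakGrad hp μ g' u := by
  refine weakGrad_of_controlled hg' ?_
  filter_upwards [h.controlled, f, eventually_ae_of_ae hp hgg'] with γ h1 h2 h3
  exact h1.of_ne γ.length_pos h2 c h3

theorem WeakGrad.iInf {m : ℕ → Y → ℝ≥0∞} (h : ∀ n, WeakGrad hp μ (m n) u) (hm : Antitone m)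
    (hfin : ∫⁻ x, m 0 x ^ p ∂μ ≠ ∞) : WeakGrad hp μ (fun x => ⨅ n, m n x) u := by
  refine ⟨Measurable.iInf fun n => (h n).1, ?_⟩
  filter_upwards [eventually_forall_nat hp fun n => (h n).2,
    eventually_lineIntegral_ne_top hp (h 0).1 hfin] with γ h1 h2
  unfold Curve.lineIntegral
  rw [lintegral_iInf' (fun n => γ.aemeasurable_comp (h n).1)
    (Eventually.of_forall fun t i j hij => hm hij _) h2]
  exact le_iInf h1

/-- Running minima of a minimizing sequence decrease to a gradient `G` of least energy. Replacing
`G` by its minimum with `g'` cannot lower the energy, so the two agree a.e. The competitor `g'` need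
only be integrable along almost every curve, which includes the locally p-integrable ones. -/
theorem WeakGrad.exists_le_forall (h : WeakGrad hp μ g u) (hg : ∫⁻ x, g x ^ p ∂μ ≠ ∞) :
    ∃ G, WeakGrad hp μ G u ∧ ∫⁻ x, G x ^ p ∂μ ≠ ∞ ∧ ∀ g', WeakGrad hp μ g' u →
      (∀ᶠ γ in aeCurve hp μ, γ.lineIntegral g' ≠ ∞) → G ≤ᵐ[μ] g' := by
  set I : ℝ≥0∞ := ⨅ (g' : Y → ℝ≥0∞) (_ : WeakGrad hp μ g' u), ∫⁻ x, g' x ^ p ∂μ with hI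
  have hIle : ∀ g', WeakGrad hp μ g' u → I ≤ ∫⁻ x, g' x ^ p ∂μ := fun g' h' => iInf₂_le g' h'
  have hIfin : I ≠ ∞ := ne_top_of_le_ne_top hg (hIle g h)
  have hseq : ∀ n : ℕ, ∃ g', WeakGrad hp μ g' u ∧ ∫⁻ x, g' x ^ p ∂μ < I + (n + 1 : ℝ≥0∞)⁻¹ := by
    intro n
    have : I < I + (n + 1 : ℝ≥0∞)⁻¹ := ENNReal.lt_add_right hIfin (by simp)
    rw [hI] at this
    simp only [iInf_lt_iff] at this
    obtain ⟨g', h1, h2⟩ := this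
    exact ⟨g', h1, h2⟩
  choose e he hlt using hseq
  have hefin : ∀ n, ∫⁻ x, e n x ^ p ∂μ ≠ ∞ := fun n => by
    refine ((hlt n).trans_le le_top).ne
  let m : ℕ → Y → ℝ≥0∞ := fun n => Nat.rec (e 0) (fun n f x => min (f x) (e (n + 1) x)) n
  have hms : ∀ n, m (n + 1) = fun x => min (m n x) (e (n + 1) x) := fun n => rfl
  have hmle : ∀ n x, m n x ≤ e n x := by
    intro n x
    cases n with
    | zero => exact le_rfl
    | succ n => rw [hms]; exact min_le_right _ _
  have hmfin : ∀ n, ∫⁻ x, m n x ^ p ∂μ ≠ ∞ := fun n => ne_top_of_le_ne_top (hefin n)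
    (lintegral_mono fun x => ENNReal.rpow_le_rpow (hmle n x) hp.le)
  have hmW : ∀ n, WeakGrad hp μ (m n) u := by
    intro n
    induction n with
    | zero => exact he 0
    | succ n ih =>
      rw [hms]
      exact ih.inf (he _) (eventually_lineIntegral_ne_top hp ih.1 (hmfin n))
        (eventually_lineIntegral_ne_top hp (he _).1 (hefin _))
  have hanti : Antitone m := antitone_nat_of_succ_le fun n x => by
    rw [hms]; exact min_le_left _ _
  have hG := WeakGrad.iInf hmW hanti (hmfin 0)
  have hGle : ∫⁻ x, (⨅ n, m n x) ^ p ∂μ ≤ I := by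
    have hlim : Tendsto (fun n : ℕ => I + (n + 1 : ℝ≥0∞)⁻¹) atTop (𝓝 I) := by
      have h1 : Tendsto (fun n : ℕ => (n + 1 : ℝ≥0∞)⁻¹) atTop (𝓝 0) := by
        have := (tendsto_add_atTop_iff_nat 1).2 ENNReal.tendsto_inv_nat_nhds_zero
        simpa using this
      simpa using h1.const_add I
    refine ge_of_tendsto' hlim fun n => le_trans (lintegral_mono fun x => ?_) (hlt n).le
    exact ENNReal.rpow_le_rpow ((iInf_le _ n).trans (hmle n x)) hp.le
  refine ⟨_, hG, ne_top_of_le_ne_top hIfin hGle, fun g' hg' hf => ?_⟩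
  have hmin := hG.inf hg' (eventually_lineIntegral_ne_top hp hG.1
    (ne_top_of_le_ne_top hIfin hGle)) hf
  have h1 := hGle.trans (hIle _ hmin)
  have h2 := ae_eq_of_ae_le_of_lintegral_le (μ := μ) (f := fun x => (min (⨅ n, m n x) (g' x)) ^ p)
    (g := fun x => (⨅ n, m n x) ^ p) (Eventually.of_forall fun x =>
      ENNReal.rpow_le_rpow (min_le_left _ _) hp.le)
    (ne_top_of_le_ne_top hIfin ((lintegral_mono fun x =>
      ENNReal.rpow_le_rpow (min_le_left _ _) hp.le).trans hGle))
    (hG.1.pow_const p).aemeasurable h1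
  filter_upwards [h2] with x hx
  have := ENNReal.rpow_left_injective hp.ne' hx
  exact min_eq_left_iff.1 this

/-! ### Local integrability and the minimal weak upper gradient -/

theorem locLp_of_lintegral_ne_top (h : ∫⁻ x, g x ^ p ∂μ ≠ ∞) : LocLp p μ g := fun x =>
  ⟨x, 1, Metric.mem_ball_self one_pos, (setLIntegral_le_lintegral _ _).trans_lt h.lt_top⟩

theorem LocLp.congr (h : LocLp p μ g) (hgg' : g =ᵐ[μ] g') : LocLp p μ g' := by
  intro x
  obtain ⟨z, r, h1, h2⟩ := h x
  refine ⟨z, r, h1, ?_⟩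
  rwa [← lintegral_congr_ae (ae_restrict_of_ae (hgg'.mono fun x hx => by
    show g x ^ p = g' x ^ p
    rw [hx]))]

/-- By the Lindelöf property countably many balls of finite energy cover the space, and the compact
image of a curve is covered by finitely many of them. -/
theorem LocLp.eventually_lineIntegral_ne_top [SecondCountableTopology Y] (hp : 0 < p)
    (hg : Measurable g) (h : LocLp p μ g) : ∀ᶠ γ in aeCurve hp μ, γ.lineIntegral g ≠ ∞ := by
  choose z r hx hfin using h
  rcases isEmpty_or_nonempty Y with hY | hY
  · exact Eventually.of_forall fun γ => (hY.false (γ.toFun 0)).elim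
  obtain ⟨T, hT, hcov⟩ := TopologicalSpace.countable_cover_nhds
    (f := fun x => Metric.ball (z x) (r x)) (fun x => Metric.isOpen_ball.mem_nhds (hx x))
  have hTne : T.Nonempty := by
    obtain ⟨y⟩ := hY
    have : y ∈ ⋃ x ∈ T, Metric.ball (z x) (r x) := hcov ▸ mem_univ y
    simp only [mem_iUnion] at this
    exact ⟨_, this.choose_spec.choose⟩
  obtain ⟨q, hq⟩ := hT.exists_eq_range hTne
  have hcov' : ∀ y, ∃ n, y ∈ Metric.ball (z (q n)) (r (q n)) := by
    intro y
    have : y ∈ ⋃ x ∈ T, Metric.ball (z x) (r x) := hcov ▸ mem_univ y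
    simp only [mem_iUnion, hq, mem_range] at this
    obtain ⟨_, ⟨n, rfl⟩, h2⟩ := this
    exact ⟨n, h2⟩
  have key : ∀ᶠ γ in aeCurve hp μ, ∀ n,
      γ.lineIntegral ((Metric.ball (z (q n)) (r (q n))).indicator g) ≠ ∞ := by
    refine eventually_forall_nat hp fun n => ObstacleProblem.eventually_lineIntegral_ne_top hp
      (hg.indicator Metric.isOpen_ball.measurableSet) ?_
    have : ∀ x, (Metric.ball (z (q n)) (r (q n))).indicator g x ^ p =
        (Metric.ball (z (q n)) (r (q n))).indicator (fun x => g x ^ p) x := by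
      intro x
      by_cases hx : x ∈ Metric.ball (z (q n)) (r (q n)) <;> simp [hx, hp]
    simp only [this]
    rw [lintegral_indicator Metric.isOpen_ball.measurableSet]
    exact (hfin _).ne
  filter_upwards [key] with γ hγ
  have hK : IsCompact (γ.toFun '' Icc 0 γ.length) := isCompact_Icc.image_of_continuousOn
    γ.continuousOn
  obtain ⟨F, hF⟩ := hK.elim_finite_subcover (fun n => Metric.ball (z (q n)) (r (q n)))
    (fun n => Metric.isOpen_ball) fun y _ => mem_iUnion.2 (hcov' y)
  have : γ.lineIntegral g ≤ ∑ n ∈ F, γ.lineIntegral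
      ((Metric.ball (z (q n)) (r (q n))).indicator g) := by
    unfold Curve.lineIntegral
    rw [← lintegral_finsetSum' _ fun n _ => γ.aemeasurable_comp
      (hg.indicator Metric.isOpen_ball.measurableSet)]
    refine setLIntegral_mono' measurableSet_Icc fun t ht => ?_
    have h1 := hF (mem_image_of_mem _ ht)
    simp only [mem_iUnion] at h1
    obtain ⟨n, hn, h2⟩ := h1
    refine le_trans (le_of_eq ?_) (Finset.single_le_sum
      (f := fun n => (Metric.ball (z (q n)) (r (q n))).indicator g (γ.toFun t))
      (fun _ _ => zero_le) hn)
    simp only [indicator_of_mem h2]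
  exact ne_top_of_le_ne_top (ENNReal.sum_ne_top.2 fun n _ => hγ n) this

theorem minGrad_eq_of_exists (h : ∃ g, IsMinimalWeakUpperGradient p μ g u) :
    IsMinimalWeakUpperGradient p μ (minGrad p μ u) u := by
  rw [minGrad, dif_pos h]
  exact h.choose_spec

theorem exists_weakGrad_ae_eq_minGrad (hp : 0 < p)
    (h : ∃ g, IsMinimalWeakUpperGradient p μ g u) :
    ∃ G, WeakGrad hp μ G u ∧ energy p μ u = ∫⁻ x, G x ^ p ∂μ ∧ LocLp p μ G ∧
      minGrad p μ u =ᵐ[μ] G := by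
  have hm := minGrad_eq_of_exists h
  obtain ⟨G, h1, h2⟩ := (isWeakUpperGradient_iff hp).1 hm.1
  refine ⟨G, h2, lintegral_congr_ae (h1.mono fun x hx => ?_), hm.2.1.congr h1, h1⟩
  show _ ^ p = _ ^ p
  rw [hx]

/-- If no minimal gradient exists, `minGrad` is the constant `∞`, whose energy is infinite because
`μ ≠ 0`. -/
theorem exists_weakGrad_of_energy_ne_top (hp : 0 < p) (hμ : μ ≠ 0) (h : energy p μ u ≠ ∞) :
    ∃ G, WeakGrad hp μ G u ∧ energy p μ u = ∫⁻ x, G x ^ p ∂μ := by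
  by_cases h' : ∃ g, IsMinimalWeakUpperGradient p μ g u
  · obtain ⟨G, h1, h2, -⟩ := exists_weakGrad_ae_eq_minGrad hp h'
    exact ⟨G, h1, h2⟩
  · refine absurd ?_ h
    rw [energy, minGrad, dif_neg h']
    simp [hp, hμ]

/-- The minimal weak upper gradient of a function with a `p`-integrable weak upper gradient. -/
theorem WeakGrad.exists_minimal [SecondCountableTopology Y] (h : WeakGrad hp μ g u)
    (hg : ∫⁻ x, g x ^ p ∂μ ≠ ∞) :
    ∃ G, WeakGrad hp μ G u ∧ energy p μ u = ∫⁻ x, G x ^ p ∂μ ∧ ∫⁻ x, G x ^ p ∂μ ≠ ∞ ∧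
      ∀ g', WeakGrad hp μ g' u → (∀ᶠ γ in aeCurve hp μ, γ.lineIntegral g' ≠ ∞) → G ≤ᵐ[μ] g' := by
  obtain ⟨G, h1, h2, h3⟩ := h.exists_le_forall hg
  have hmin : IsMinimalWeakUpperGradient p μ G u := by
    refine ⟨(isWeakUpperGradient_iff hp).2 ⟨G, EventuallyEq.rfl, h1⟩, locLp_of_lintegral_ne_top h2,
      fun g' hg' hloc => ?_⟩
    obtain ⟨g'', h4, h5⟩ := (isWeakUpperGradient_iff hp).1 hg'
    have := h3 g'' h5 ((hloc.congr h4).eventually_lineIntegral_ne_top hp h5.1)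
    exact this.trans_eq h4.symm
  have hm := minGrad_eq_of_exists ⟨G, hmin⟩
  have hGm : G =ᵐ[μ] minGrad p μ u :=
    (hmin.2.2 _ hm.1 hm.2.1).antisymm (hm.2.2 _ hmin.1 hmin.2.1)
  refine ⟨G, h1, ?_, h2, h3⟩
  exact lintegral_congr_ae (hGm.mono fun x hx => by show _ ^ p = _ ^ p; rw [hx])

theorem WeakGrad.energy_le [SecondCountableTopology Y] (h : WeakGrad hp μ g u) :
    energy p μ u ≤ ∫⁻ x, g x ^ p ∂μ := by
  by_cases hg : ∫⁻ x, g x ^ p ∂μ = ∞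
  · simp [hg]
  obtain ⟨G, h1, h2, h3, h4⟩ := h.exists_minimal hg
  rw [h2]
  exact lintegral_mono_ae ((h4 g h (eventually_lineIntegral_ne_top hp h.1 hg)).mono fun x hx =>
    ENNReal.rpow_le_rpow hx hp.le)

/-! ### Pointwise upper limits -/

/-- The bound `M` keeps both upper limits real. Each of them is then at most the other plus `d`, for
every `d` above `E`. -/
theorem limsup_osc_le {a b : ℕ → EReal} {M : ℝ} {E : ℝ≥0∞}
    (ha : ∀ᶠ n in atTop, (a n).abs ≤ ENNReal.ofReal M)
    (hb : ∀ᶠ n in atTop, (b n).abs ≤ ENNReal.ofReal M) {e : ℕ → ℝ≥0∞}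
    (he : Tendsto e atTop (𝓝 E)) (hab : ∀ n, (a n - b n).abs ≤ e n) :
    (limsup a atTop - limsup b atTop).abs ≤ E := by
  have hreal : ∀ a : ℕ → EReal, (∀ᶠ n in atTop, (a n).abs ≤ ENNReal.ofReal M) →
      ∃ x : ℝ, limsup a atTop = x := by
    intro a ha
    have h1 : ∀ᶠ n in atTop, ((-(max M 0) : ℝ) : EReal) ≤ a n ∧ a n ≤ ((max M 0 : ℝ) : EReal) := by
      filter_upwards [ha] with n hn
      obtain ⟨x, hx⟩ := exists_real_of_abs_ne_top (ne_top_of_le_ne_top ENNReal.ofReal_ne_top hn)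
      rw [hx, EReal.abs_def] at hn
      have h2 : |x| ≤ max M 0 := by
        have h3 := ENNReal.toReal_mono ENNReal.ofReal_ne_top hn
        rwa [ENNReal.toReal_ofReal (abs_nonneg _), ENNReal.toReal_ofReal'] at h3
      rw [hx]
      exact ⟨by exact_mod_cast (abs_le.1 h2).1, by exact_mod_cast (abs_le.1 h2).2⟩
    have h2 : limsup a atTop ≤ ((max M 0 : ℝ) : EReal) :=
      limsup_le_of_le (by isBoundedDefault) (h1.mono fun n hn => hn.2)
    have h3 : ((-(max M 0) : ℝ) : EReal) ≤ limsup a atTop :=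
      le_limsup_of_frequently_le (h1.mono fun n hn => hn.1).frequently (by isBoundedDefault)
    refine ⟨(limsup a atTop).toReal, (EReal.coe_toReal ?_ ?_).symm⟩
    · exact ne_top_of_le_ne_top (EReal.coe_ne_top _) h2
    · exact ne_bot_of_le_ne_bot (EReal.coe_ne_bot _) h3
  have hone : ∀ a b : ℕ → EReal, (∀ n, (a n - b n).abs ≤ e n) → ∀ d : ℝ, E < ENNReal.ofReal d →
      limsup a atTop ≤ limsup b atTop + d := by
    intro a b hab d hd
    have h1 : ∀ᶠ n in atTop, a n ≤ b n + d := by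
      filter_upwards [he.eventually_lt_const hd] with n hn
      have h2 := (hab n).trans_lt hn
      obtain ⟨x, y, hx, hy⟩ := exists_real_of_abs_sub_ne_top (h2.trans ENNReal.ofReal_lt_top).ne
      rw [hx, hy, abs_coe_sub_coe] at h2
      have h3 := (ENNReal.ofReal_lt_ofReal_iff_of_nonneg (abs_nonneg _)).1 h2
      rw [hx, hy]
      have h4 := (abs_lt.1 h3).2
      exact_mod_cast (by linarith : x ≤ y + d)
    refine (limsup_le_limsup h1 (by isBoundedDefault) (by isBoundedDefault)).trans ?_
    refine (EReal.limsup_add_le (u := b) (v := fun _ => (d : EReal)) (Or.inr ?_) (Or.inr ?_)).trans ?_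
    · simp
    · simp
    · simp
  obtain ⟨x, hx⟩ := hreal a ha
  obtain ⟨y, hy⟩ := hreal b hb
  have h1 : ∀ d : ℝ, E < ENNReal.ofReal d → |x - y| ≤ d := by
    intro d hd
    have h2 := hone a b hab d hd
    have h3 := hone b a (fun n => by rw [abs_sub_comm_ereal]; exact hab n) d hd
    rw [hx, hy] at h2 h3
    have h4 : x ≤ y + d := by exact_mod_cast h2
    have h5 : y ≤ x + d := by exact_mod_cast h3
    exact abs_le.2 ⟨by linarith, by linarith⟩
  rw [hx, hy, abs_coe_sub_coe]
  refine le_of_forall_gt_imp_ge_of_dense fun c hc => ?_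
  rcases eq_or_ne c ∞ with rfl | hc'
  · exact le_top
  · rw [← ENNReal.ofReal_toReal hc']
    exact ENNReal.ofReal_le_ofReal (h1 _ (by rwa [ENNReal.ofReal_toReal hc']))

/-- Along almost every curve the line integrals of `e n` exceed those of `G` by at most `c n` times
a finite number, so the oscillation bound passes to the limit. The a.e. bound on the sequence is
needed only to keep the upper limit real along the curve. -/
theorem weakGrad_limsup {v : ℕ → Y → EReal} {e : ℕ → Y → ℝ≥0∞} {G s : Y → ℝ≥0∞} {c : ℕ → ℝ≥0∞}
    (h : ∀ n, WeakGrad hp μ (e n) (v n)) (hG : Measurable G) (hGfin : ∫⁻ x, G x ^ p ∂μ ≠ ∞)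
    (hs : Measurable s) (hsfin : ∫⁻ x, s x ^ p ∂μ ≠ ∞) (hc : Tendsto c atTop (𝓝 0))
    (hle : ∀ n x, e n x ≤ G x + c n * s x)
    (hbdd : ∀ᵐ x ∂μ, ∃ M : ℝ≥0, ∀ n, (v n x).abs ≤ M) :
    WeakGrad hp μ G (fun x => limsup (fun n => v n x) atTop) := by
  refine weakGrad_of_controlled hG ?_
  filter_upwards [eventually_forall_nat hp fun n => (h n).controlled,
    eventually_lineIntegral_ne_top hp hG hGfin, eventually_lineIntegral_ne_top hp hs hsfin,
    eventually_ae_of_ae hp hbdd] with γ h1 h2 h3 h4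
  have hint : ∀ n a b, 0 ≤ a → b ≤ γ.length → ∫⁻ x in Icc a b, e n (γ.toFun x) ≤
      (∫⁻ x in Icc a b, G (γ.toFun x)) + c n * γ.lineIntegral s := by
    intro n a b ha hb
    have hsub : Icc a b ⊆ Icc 0 γ.length := Icc_subset_Icc ha hb
    have hm := fun {g : Y → ℝ≥0∞} (hg : Measurable g) =>
      (γ.aemeasurable_comp hg).mono_measure (Measure.restrict_mono hsub le_rfl)
    refine (lintegral_mono fun x => hle n _).trans ?_
    rw [lintegral_add_left' (hm hG), lintegral_const_mul'' _ (hm hs)]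
    gcongr
    exact lintegral_mono_set hsub
  -- A curve has positive length, so the sequence is bounded at some point of it; the gradient
  -- bounds spread this to every other point for large `n`.
  obtain ⟨t₀, ht₀, M, hM⟩ : ∃ t₀ ∈ Icc 0 γ.length, ∃ M : ℝ≥0, ∀ n, (v n (γ.toFun t₀)).abs ≤ M := by
    have hne : (volume.restrict (Icc 0 γ.length)) ≠ 0 := by
      rw [Ne, Measure.restrict_eq_zero, Real.volume_Icc]
      simpa using γ.length_pos
    have : (ae (volume.restrict (Icc 0 γ.length))).NeBot := ae_neBot.2 hne
    obtain ⟨t, ht1, ht2⟩ := (h4.and (ae_restrict_mem measurableSet_Icc)).exists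
    exact ⟨t, ht2, ht1⟩
  have hc1 : ∀ᶠ n in atTop, c n ≤ 1 := (hc.eventually_lt_const one_pos).mono fun n hn => hn.le
  set K : ℝ≥0∞ := γ.lineIntegral G + γ.lineIntegral s + M with hK
  have hKfin : K ≠ ∞ := by simp [hK, h2, h3]
  have hbound : ∀ t ∈ Icc 0 γ.length, ∀ᶠ n in atTop,
      (v n (γ.toFun t)).abs ≤ ENNReal.ofReal K.toReal := by
    intro t ht
    filter_upwards [hc1] with n hn
    rw [ENNReal.ofReal_toReal hKfin]
    refine (abs_le_abs_sub_add_ereal _ (v n (γ.toFun t₀))).trans (add_le_add ?_ (hM n))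
    have key : ∀ a b, 0 ≤ a → a < b → b ≤ γ.length →
        (v n (γ.toFun a) - v n (γ.toFun b)).abs ≤ γ.lineIntegral G + γ.lineIntegral s := by
      intro a b ha hab hb
      refine (h1 n a b ha hab hb).trans ((hint n a b ha hb).trans (add_le_add ?_ ?_))
      · exact lintegral_mono_set (Icc_subset_Icc ha hb)
      · exact mul_le_of_le_one_left zero_le hn
    rcases lt_trichotomy t t₀ with h5 | h5 | h5
    · exact key t t₀ ht.1 h5 ht₀.2
    · obtain ⟨x, hx⟩ := exists_real_of_abs_ne_top (ne_top_of_le_ne_top ENNReal.coe_ne_top (hM n))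
      rw [h5, hx, abs_coe_sub_coe]
      simp
    · rw [abs_sub_comm_ereal]
      exact key t₀ t ht₀.1 h5 ht.2
  intro a b ha hab hb
  refine limsup_osc_le (M := K.toReal) (e := fun n => (∫⁻ x in Icc a b, G (γ.toFun x)) +
    c n * γ.lineIntegral s) (hbound a ⟨ha, hab.le.trans hb⟩) (hbound b ⟨ha.trans hab.le, hb⟩) ?_
    fun n => (h1 n a b ha hab hb).trans (hint n a b ha hb)
  · have := ENNReal.Tendsto.mul_const hc (b := γ.lineIntegral s) (Or.inr h3)
    simpa using this.const_add (∫⁻ x in Icc a b, G (γ.toFun x))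

end Space

section Restrict

variable {X : Type*} [MetricSpace X]

/-! ### Restriction to subsets -/

/-- A curve in a subset as a curve in the whole space. -/
def Curve.incl {A : Set X} (γ : Curve A) : Curve X where
  length := γ.length
  length_pos := γ.length_pos
  toFun t := γ.toFun t
  unitSpeed := γ.unitSpeed

/-- A part of a curve that stays in a subset, as a curve in the subset. -/
theorem Curve.exists_incl_eq {A : Set X} (γ : Curve X) (hγ : ∀ t ∈ Icc 0 γ.length, γ.toFun t ∈ A) :
    ∃ γ' : Curve A, γ'.length = γ.length ∧ ∀ t ∈ Icc 0 γ.length, (γ'.toFun t : X) = γ.toFun t := by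
  classical
  have h0 : γ.toFun 0 ∈ A := hγ 0 ⟨le_rfl, γ.length_pos.le⟩
  let f : ℝ → A := fun t => if h : γ.toFun t ∈ A then ⟨γ.toFun t, h⟩ else ⟨_, h0⟩
  have hf : ∀ t ∈ Icc 0 γ.length, (f t : X) = γ.toFun t := fun t ht => by simp [f, hγ t ht]
  refine ⟨⟨γ.length, γ.length_pos, f, ?_⟩, rfl, hf⟩
  intro x hx y hy
  rw [← γ.unitSpeed hx hy]
  have : eVariationOn (fun t => (f t : X)) (Icc 0 γ.length ∩ Icc x y) =
      eVariationOn γ.toFun (Icc 0 γ.length ∩ Icc x y) :=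
    eVariationOn.eq_of_eqOn fun t ht => hf t ht.1
  exact this

variable [MeasurableSpace X] [BorelSpace X] {p : ℝ} {μ : Measure X} {hp : 0 < p} {A : Set X}

theorem IsUpperGradient.restrict {g : X → ℝ≥0∞} {u : X → EReal} (h : IsUpperGradient g u)
    (A : Set X) : IsUpperGradient (fun x : A => g x) (fun x : A => u x) :=
  ⟨h.1.comp measurable_subtype_coe, fun γ => h.2 γ.incl⟩

theorem AEMeasurable.restrict_comap {β : Type*} [MeasurableSpace β] (hA : MeasurableSet A)
    {u : X → β} : AEMeasurable (fun x : A => u x) (μ.comap (↑)) ↔ AEMeasurable u (μ.restrict A) := by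
  rw [← map_comap_subtype_coe hA]
  exact (MeasurableEmbedding.subtype_coe hA).aemeasurable_map_iff.symm

theorem MemDirichlet.restrict {u : X → EReal} (h : MemDirichlet p μ u) (hA : MeasurableSet A) :
    MemDirichlet p (μ.comap ((↑) : A → X)) (fun x : A => u x) := by
  obtain ⟨h1, g, h2, h3⟩ := h
  refine ⟨(AEMeasurable.restrict_comap hA).2 h1.restrict, _, h2.restrict A, ?_⟩
  rw [lintegral_subtype_comap hA fun x => g x ^ p]
  exact (setLIntegral_le_lintegral _ _).trans_lt h3

theorem MemDirichletLoc.aemeasurable [SecondCountableTopology X] {u : X → EReal}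
    (h : MemDirichletLoc p μ u) : AEMeasurable u μ := by
  choose z r hx hmem using h
  obtain ⟨T, hT, hcov⟩ := TopologicalSpace.countable_cover_nhds
    (f := fun x => Metric.ball (z x) (r x)) (fun x => Metric.isOpen_ball.mem_nhds (hx x))
  have : Countable T := hT.to_subtype
  rw [← Measure.restrict_univ (μ := μ), ← hcov, biUnion_eq_iUnion, aemeasurable_iUnion_iff]
  exact fun i => (AEMeasurable.restrict_comap Metric.isOpen_ball.measurableSet).1 (hmem i).1

end Restrict

section Capacity

variable {X : Type*} [MetricSpace X] [MeasurableSpace X] [BorelSpace X]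
  [SecondCountableTopology X] {p : ℝ} {μ : Measure X} {hp : 0 < p}

/-! ### Sets of capacity zero -/

theorem capacity_le {g : X → ℝ≥0∞} {u : X → EReal} (hu : AEMeasurable u μ)
    (h : WeakGrad hp μ g u) (hg : ∫⁻ x, g x ^ p ∂μ ≠ ∞) (hufin : ∫⁻ x, (u x).abs ^ p ∂μ ≠ ∞)
    {E : Set X} (hE : ∀ x ∈ E, 1 ≤ u x) :
    capacity p μ E ≤ ∫⁻ x, (u x).abs ^ p ∂μ + ∫⁻ x, g x ^ p ∂μ := by
  have hle : newtonNormPow p μ u ≤ ∫⁻ x, (u x).abs ^ p ∂μ + ∫⁻ x, g x ^ p ∂μ :=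
    add_le_add le_rfl h.energy_le
  have hN : MemNewton p μ u := ⟨fun x => ⟨x, 1, Metric.mem_ball_self one_pos,
    ((memDirichlet_iff hp).2 ⟨hu, g, h, hg⟩).restrict Metric.isOpen_ball.measurableSet⟩,
    hle.trans_lt (by finiteness)⟩
  exact (iInf₂_le_of_le u hN (iInf_le_of_le hE le_rfl)).trans hle

theorem one_le_abs {a : EReal} (h : 1 ≤ a) : 1 ≤ a.abs := by
  induction a with
  | bot => simp
  | top => simp
  | coe x =>
    have h1 : (1 : ℝ) ≤ x := by exact_mod_cast h
    rw [EReal.abs_def, ← ENNReal.ofReal_one]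
    exact ENNReal.ofReal_le_ofReal (h1.trans (le_abs_self x))

theorem tsum_half_ne_top : ∑' n : ℕ, (2⁻¹ : ℝ≥0∞) ^ n ≠ ∞ := by
  rw [ENNReal.tsum_geometric]; simp

theorem lintegral_iSup_two_pow_ne_top {α : Type*} [MeasurableSpace α] {ν : Measure α}
    (hp : 0 < p) {f : ℕ → α → ℝ≥0∞} (hf : ∀ n, Measurable (f n))
    (h : ∀ n, ∫⁻ x, f n x ^ p ∂ν ≤ ((2 : ℝ≥0∞) ^ n) ^ (-p) * 2⁻¹ ^ n) :
    ∫⁻ x, (⨆ n, 2 ^ n * f n x) ^ p ∂ν ≠ ∞ := by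
  refine ne_top_of_le_ne_top ?_ (lintegral_iSup_rpow_le hp fun n => (hf n).const_mul _)
  refine ne_top_of_le_ne_top tsum_half_ne_top (ENNReal.tsum_le_tsum fun n => ?_)
  rw [lintegral_const_mul_rpow hp (hf n)]
  refine (mul_le_mul_right (h n) _).trans ?_
  rw [← mul_assoc, ENNReal.rpow_neg, ENNReal.mul_inv_cancel, one_mul]
  · exact (ENNReal.rpow_pos (by positivity) (by finiteness)).ne'
  · finiteness

theorem two_pow_rpow_mul_pos (p : ℝ) (n : ℕ) :
    0 < ((2 : ℝ≥0∞) ^ n) ^ (-p) * 2⁻¹ ^ n :=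
  ENNReal.mul_pos (ENNReal.rpow_pos (by positivity) (by finiteness)).ne'
    (ENNReal.pow_pos (by simp) n).ne'

/-- A set has capacity zero if and only if it is a null set that almost every curve avoids. -/
theorem capacity_eq_zero_iff (hp : 0 < p) (hμ : μ ≠ 0) {E : Set X} : capacity p μ E = 0 ↔
    μ E = 0 ∧ ∀ᶠ γ in aeCurve hp μ, ∀ t ∈ Icc 0 γ.length, γ.toFun t ∉ E := by
  constructor
  · intro h
    -- The threshold is chosen so that the suprema of `2 ^ n * |u n|` and of `2 ^ n * G n` still
    -- have finite p-energy.
    have h1 : ∀ n : ℕ, ∃ u, MemNewton p μ u ∧ (∀ x ∈ E, 1 ≤ u x) ∧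
        newtonNormPow p μ u < ((2 : ℝ≥0∞) ^ n) ^ (-p) * 2⁻¹ ^ n := by
      intro n
      have h2 := (two_pow_rpow_mul_pos p n)
      rw [← h] at h2
      unfold capacity at h2
      simp only [iInf_lt_iff] at h2
      obtain ⟨u, h3, h4, h5⟩ := h2
      exact ⟨u, h3, h4, h5⟩
    choose u hu hE hlt using h1
    have hen : ∀ n, energy p μ (u n) ≠ ∞ := fun n =>
      (le_add_self.trans_lt (hu n).2).ne
    choose G hG hGe using fun n => exists_weakGrad_of_energy_ne_top hp hμ (hen n)
    have hum : ∀ n, AEMeasurable (fun x => (u n x).abs) μ := fun n =>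
      measurable_abs_ereal.comp_aemeasurable (hu n).1.aemeasurable
    have hG' := lintegral_iSup_two_pow_ne_top (ν := μ) hp (fun n => (hG n).1) fun n => by
      rw [← hGe]
      exact le_add_self.trans (hlt n).le
    have hu' := lintegral_iSup_two_pow_ne_top (ν := μ) hp (fun n => (hum n).measurable_mk) fun n => by
      rw [← lintegral_congr_ae ((hum n).ae_eq_mk.mono fun x hx => congrArg (· ^ p) hx)]
      exact le_self_add.trans (hlt n).le
    have hSm : Measurable fun x => ⨆ n, 2 ^ n * G n x := Measurable.iSup fun n =>
      (hG n).1.const_mul _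
    have hTm : Measurable fun x => ⨆ n, 2 ^ n * (hum n).mk _ x := Measurable.iSup fun n =>
      (hum n).measurable_mk.const_mul _
    have hbdd : ∀ᵐ x ∂μ, ∃ M : ℝ≥0∞, M ≠ ∞ ∧ ∀ n, 2 ^ n * (u n x).abs ≤ M := by
      filter_upwards [ae_lt_top (hTm.pow_const p) hu', ae_all_iff.2 fun n => (hum n).ae_eq_mk]
        with x hx hx'
      refine ⟨_, ((ENNReal.rpow_lt_top_iff_of_pos hp).1 hx).ne, fun n => ?_⟩
      rw [hx' n]
      exact le_iSup (fun n => 2 ^ n * (hum n).mk _ x) n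
    have hlarge : ∀ (M : ℝ≥0∞), M ≠ ∞ → ∃ n : ℕ, M < 2 ^ n := by
      intro M hM
      lift M to ℝ≥0 using hM
      obtain ⟨n, hn⟩ := pow_unbounded_of_one_lt M (one_lt_two : (1 : ℝ≥0) < 2)
      exact ⟨n, by exact_mod_cast hn⟩
    -- On `E` each `|u n|` is at least 1, so `2 ^ n * |u n|` is unbounded there. Almost everywhere
    -- it is bounded, and along almost every curve boundedness at one point spreads to all points.
    have hnot : ∀ x ∈ E, ¬ ∃ M : ℝ≥0∞, M ≠ ∞ ∧ ∀ n, 2 ^ n * (u n x).abs ≤ M := by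
      rintro x hx ⟨M, hM, h2⟩
      obtain ⟨n, hn⟩ := hlarge M hM
      refine absurd hn (not_lt.2 (le_trans ?_ (h2 n)))
      exact le_mul_of_one_le_right zero_le (one_le_abs (hE n x hx))
    refine ⟨measure_mono_null hnot hbdd, ?_⟩
    filter_upwards [eventually_lineIntegral_ne_top hp hSm hG', eventually_ae_of_ae hp hbdd,
      eventually_forall_nat hp fun n => (hG n).controlled] with γ h2 h3 h4 t ht htE
    have hne : (volume.restrict (Icc 0 γ.length)) ≠ 0 := by
      rw [Ne, Measure.restrict_eq_zero, Real.volume_Icc]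
      simpa using γ.length_pos
    have : (ae (volume.restrict (Icc 0 γ.length))).NeBot := ae_neBot.2 hne
    obtain ⟨s, ⟨M, hM, hsM⟩, hsI⟩ := (h3.and (ae_restrict_mem measurableSet_Icc)).exists
    refine hnot _ htE ⟨γ.lineIntegral (fun x => ⨆ n, 2 ^ n * G n x) + M, by finiteness, fun n => ?_⟩
    have key : ∀ a b, 0 ≤ a → a < b → b ≤ γ.length →
        2 ^ n * (u n (γ.toFun a) - u n (γ.toFun b)).abs ≤
          γ.lineIntegral (fun x => ⨆ n, 2 ^ n * G n x) := by
      intro a b ha hab hb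
      refine (mul_le_mul_right (h4 n a b ha hab hb) _).trans ?_
      refine (mul_le_mul_right (lintegral_mono_set (Icc_subset_Icc ha hb)) _).trans ?_
      refine (γ.lineIntegral_const_mul (hG n).1 (2 ^ n)).symm.le.trans (γ.lineIntegral_mono fun x => ?_)
      exact le_iSup (fun n => 2 ^ n * G n x) n
    rcases lt_trichotomy s t with h5 | h5 | h5
    · refine (mul_le_mul_right (abs_le_abs_sub_add_ereal _ (u n (γ.toFun s))) _).trans ?_
      rw [mul_add, abs_sub_comm_ereal]
      exact add_le_add (key s t hsI.1 h5 ht.2) (hsM n)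
    · rw [← h5]
      exact (hsM n).trans le_add_self
    · refine (mul_le_mul_right (abs_le_abs_sub_add_ereal _ (u n (γ.toFun s))) _).trans ?_
      rw [mul_add]
      exact add_le_add (key t s ht.1 h5 hsI.2) (hsM n)
  · rintro ⟨h1, h2⟩
    classical
    -- Conversely, the indicator of `E` is zero a.e. and along almost every curve, so its Newtonian
    -- norm is zero.
    let u : X → EReal := fun x => if x ∈ E then 1 else 0
    have hu0 : u =ᵐ[μ] fun _ => 0 := by
      filter_upwards [measure_eq_zero_iff_ae_notMem.1 h1] with x hx
      simp [u, hx]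
    have hW : WeakGrad hp μ (fun _ => 0) u := by
      refine ⟨measurable_const, ?_⟩
      filter_upwards [h2] with γ hγ
      simp [Curve.osc, u, hγ 0 ⟨le_rfl, γ.length_pos.le⟩, hγ γ.length ⟨γ.length_pos.le, le_rfl⟩]
    have hint : ∫⁻ x, (u x).abs ^ p ∂μ = 0 := by
      rw [lintegral_congr_ae (g := fun _ => 0) (hu0.mono fun x hx => by
        show (u x).abs ^ p = 0
        rw [hx]; simp [hp])]
      simp
    have := capacity_le (E := E) (aemeasurable_const.congr hu0.symm) hW (by simp [hp])
      (by simp [hint]) (fun x hx => by simp [u, hx])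
    rw [hint] at this
    simpa [hp] using this

theorem capacity_iUnion_eq_zero (hp : 0 < p) (hμ : μ ≠ 0) {E : ℕ → Set X}
    (h : ∀ n, capacity p μ (E n) = 0) : capacity p μ (⋃ n, E n) = 0 := by
  simp only [capacity_eq_zero_iff hp hμ] at h ⊢
  refine ⟨measure_iUnion_null fun n => (h n).1, ?_⟩
  filter_upwards [eventually_forall_nat hp fun n => (h n).2] with γ hγ t ht hE
  obtain ⟨n, hn⟩ := mem_iUnion.1 hE
  exact hγ n t ht hn

theorem capacity_mono {E F : Set X} (h : E ⊆ F) : capacity p μ E ≤ capacity p μ F :=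
  iInf_mono fun _ => iInf_mono fun _ => iInf_mono' fun hF => ⟨fun x hx => hF x (h hx), le_rfl⟩

end Capacity

section Poincare

variable {X : Type*} [MetricSpace X] [MeasurableSpace X] [BorelSpace X]
  {p : ℝ} {μ : Measure X}

/-! ### Poincaré inequalities for locally defined functions -/

/-- The Poincaré inequality for bounded, not necessarily integrable functions. -/
theorem SupportsPoincare.exists_const (hp : 0 < p) (hPI : SupportsPoincare p p μ)
    (hμ : ∀ (x : X) (r : ℝ), 0 < r → 0 < μ (Metric.ball x r) ∧ μ (Metric.ball x r) < ∞)
    (z : X) {r : ℝ} (hr : 0 < r) :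
    ∃ C : ℝ≥0∞, C ≠ ∞ ∧ ∀ (u : X → ℝ) (g : X → ℝ≥0∞) (M : ℝ), AEMeasurable u μ →
      (∀ x, |u x| ≤ M) → IsUpperGradient g (fun x => (u x : EReal)) →
      ∫⁻ x in Metric.ball z r, ‖u x - ⨍ y in Metric.ball z r, u y ∂μ‖ₑ ^ p ∂μ ≤
        C * ∫⁻ x, g x ^ p ∂μ := by
  obtain ⟨c, dil, hc, hdil, H⟩ := hPI
  have hdil0 : (0 : ℝ) < dil := lt_of_lt_of_le one_pos (by exact_mod_cast hdil)
  set d : ℝ≥0∞ := Metric.ediam (Metric.ball z r)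
  set lam : ℝ≥0∞ := μ (Metric.ball z (dil * r))
  have hdfin : d ≠ ∞ := Metric.isBounded_ball.ediam_ne_top
  have hlam := hμ z (dil * r) (mul_pos hdil0 hr)
  refine ⟨μ (Metric.ball z r) * ((c * d) ^ p / lam), ENNReal.mul_ne_top (hμ z r hr).2.ne
    (ENNReal.div_ne_top (ENNReal.rpow_ne_top_of_nonneg hp.le (by finiteness)) hlam.1.ne'),
    fun u g M hu hM hg => ?_⟩
  -- Cutting `u` off outside `A` makes it integrable and changes nothing on `ball z r`.
  set A := Metric.ball z (dil * r + 1)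
  have hAm : MeasurableSet A := Metric.isOpen_ball.measurableSet
  have hrA : Metric.ball z r ⊆ A := Metric.ball_subset_ball (by
    have : (1 : ℝ) ≤ dil := by exact_mod_cast hdil
    nlinarith)
  have hint : Integrable (A.indicator u) μ := by
    rw [integrable_indicator_iff hAm]
    exact IntegrableOn.of_bound (hμ z _ (by positivity)).2 hu.aestronglyMeasurable.restrict M
      (Eventually.of_forall hM)
  -- A curve that meets the complement of `A` stays outside `ball z (dil * r)` for parameters within
  -- distance 1, hence has infinite integral. Inside that ball `g' = g`.
  let g' : X → ℝ≥0∞ := fun x => g x + (Metric.ball z (dil * r))ᶜ.indicator (fun _ => ∞) x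
  have hg' : IsUpperGradient g' (fun x => ((A.indicator u x : ℝ) : EReal)) := by
    refine ⟨hg.1.add (measurable_const.indicator Metric.isOpen_ball.measurableSet.compl),
      fun γ => ?_⟩
    by_cases hγ : ∀ t ∈ Icc 0 γ.length, γ.toFun t ∈ A
    · have h1 := hg.2 γ
      unfold Curve.osc at h1 ⊢
      simp only
      rw [indicator_of_mem (hγ 0 ⟨le_rfl, γ.length_pos.le⟩),
        indicator_of_mem (hγ γ.length ⟨γ.length_pos.le, le_rfl⟩)]
      exact h1.trans (γ.lineIntegral_mono fun x => le_self_add)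
    · push Not at hγ
      obtain ⟨t, ht, htA⟩ := hγ
      refine le_top.trans (le_of_eq ?_)
      symm
      rw [eq_top_iff]
      have hlt : max 0 (t - 1) < min γ.length (t + 1) := by
        have := γ.length_pos
        rcases ht with ⟨h1, h2⟩
        exact max_lt (lt_min this (by linarith)) (lt_min (by linarith) (by linarith))
      calc ∞ = ∫⁻ _ in Icc (max 0 (t - 1)) (min γ.length (t + 1)), ∞ := by
            rw [setLIntegral_const, Real.volume_Icc, ENNReal.top_mul]
            simpa only [ne_eq, ENNReal.ofReal_eq_zero, sub_nonpos, not_le] using hlt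
        _ ≤ ∫⁻ s in Icc (max 0 (t - 1)) (min γ.length (t + 1)), g' (γ.toFun s) := by
            refine setLIntegral_mono' measurableSet_Icc fun s hs => ?_
            have hs1 : s ∈ Icc 0 γ.length := ⟨(le_max_left _ _).trans hs.1,
              hs.2.trans (min_le_left _ _)⟩
            have hs2 : t - 1 ≤ s := (le_max_right _ _).trans hs.1
            have hs3 : s ≤ t + 1 := hs.2.trans (min_le_right _ _)
            have hd := γ.dist_le ht hs1
            have hd1 : |t - s| ≤ 1 := abs_le.2 ⟨by linarith, by linarith⟩
            have htz : dil * r + 1 ≤ dist (γ.toFun t) z := not_lt.1 htA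
            have htri := dist_triangle (γ.toFun t) (γ.toFun s) z
            have : γ.toFun s ∈ (Metric.ball z (dil * r))ᶜ := by
              rw [mem_compl_iff, Metric.mem_ball, not_lt]
              linarith
            simp only [g', indicator_of_mem this]
            exact le_add_self
        _ ≤ γ.lineIntegral g' := lintegral_mono_set (Icc_subset_Icc (le_max_left _ _)
            (min_le_left _ _))
  have h1 := H z r hr _ g' hint hg'
  have hav : ⨍ y in Metric.ball z r, A.indicator u y ∂μ = ⨍ y in Metric.ball z r, u y ∂μ := by
    refine setAverage_congr_fun Metric.isOpen_ball.measurableSet (Eventually.of_forall fun x hx => ?_)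
    rw [indicator_of_mem (hrA hx)]
  rw [hav] at h1
  have h2 := ENNReal.rpow_le_rpow h1 hp.le
  rw [ENNReal.mul_rpow_of_nonneg _ _ hp.le, ← ENNReal.rpow_mul, ← ENNReal.rpow_mul,
    one_div_mul_cancel hp.ne', ENNReal.rpow_one, ENNReal.rpow_one, setLAverage_eq, setLAverage_eq,
    ENNReal.div_le_iff (hμ z r hr).1.ne' (hμ z r hr).2.ne] at h2
  have e1 : ∫⁻ x in Metric.ball z r, ‖u x - ⨍ y in Metric.ball z r, u y ∂μ‖ₑ ^ p ∂μ =
      ∫⁻ x in Metric.ball z r, ‖A.indicator u x - ⨍ y in Metric.ball z r, u y ∂μ‖ₑ ^ p ∂μ :=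
    setLIntegral_congr_fun Metric.isOpen_ball.measurableSet fun x hx => by
      simp only [indicator_of_mem (hrA hx)]
  have e2 : ∫⁻ x in Metric.ball z (dil * r), g' x ^ p ∂μ ≤ ∫⁻ x, g x ^ p ∂μ := by
    refine le_trans (le_of_eq ?_) (setLIntegral_le_lintegral (Metric.ball z (dil * r)) _)
    refine setLIntegral_congr_fun Metric.isOpen_ball.measurableSet fun x hx => ?_
    have : x ∉ (Metric.ball z (dil * r))ᶜ := fun h => h hx
    simp only [g', indicator_of_notMem this, add_zero]
  rw [e1]
  refine h2.trans ?_
  calc (c * d) ^ p * ((∫⁻ x in Metric.ball z (dil * r), g' x ^ p ∂μ) / lam) * μ (Metric.ball z r)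
      ≤ (c * d) ^ p * ((∫⁻ x, g x ^ p ∂μ) / lam) * μ (Metric.ball z r) := by gcongr
    _ = _ := by simp only [div_eq_mul_inv]; ring

/-! ### Maz'ya's inequality -/

variable [SecondCountableTopology X]

/-- The test function is 1 - 2u/a, cut off by the distance to `z`. It equals 1 on `S ∩ ball z r` and
is supported where `u < a / 2`, that is, where |u - a| exceeds a/2. Hence `D` controls the measure
of its support. -/
theorem average_le_of_capacity (hp : 0 < p) {z : X} {r : ℝ} {S : Set X}
    {u : X → ℝ} {g : X → ℝ≥0∞} (hu : AEMeasurable u μ) (hu0 : ∀ x, 0 ≤ u x)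
    (huS : ∀ x ∈ S, u x = 0) (hg : IsUpperGradient g (fun x => (u x : EReal)))
    (hgfin : ∫⁻ x, g x ^ p ∂μ ≠ ∞) {a : ℝ} (ha : 0 < a)
    {D : ℝ≥0∞} (hD : ∫⁻ x in Metric.ball z (r + 1), ‖u x - a‖ₑ ^ p ∂μ ≤ D) (hDfin : D ≠ ∞) :
    capacity p μ (S ∩ Metric.ball z r) ≤
      ENNReal.ofReal (2 / a) ^ p * (2 * D + ∫⁻ x, g x ^ p ∂μ) := by
  set c : ℝ≥0∞ := ENNReal.ofReal (2 / a) with hc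
  set B := Metric.ball z (r + 1) with hBdef
  have hBm : MeasurableSet B := Metric.isOpen_ball.measurableSet
  let v : X → ℝ := fun x => max 0 (min (r + 1 - dist x z) (1 - 2 / a * u x))
  have hvm : AEMeasurable v μ := by
    refine aemeasurable_const.max (AEMeasurable.min ?_ ?_)
    · exact (measurable_const.sub (measurable_id.dist measurable_const)).aemeasurable
    · exact aemeasurable_const.sub (hu.const_mul _)
  have h2a : 0 < 2 / a := by positivity
  have hv0 : ∀ x, 0 ≤ v x := fun x => le_max_left _ _
  have hv1 : ∀ x, v x ≤ 1 := fun x => max_le zero_le_one ((min_le_right _ _).trans (by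
    have := mul_nonneg h2a.le (hu0 x); linarith))
  have hvne : ∀ x, v x ≠ 0 → x ∈ B ∧ 1 ≤ c * ‖u x - a‖ₑ := by
    intro x hx
    have hpos : 0 < min (r + 1 - dist x z) (1 - 2 / a * u x) := by
      by_contra h
      exact hx (max_eq_left (not_lt.1 h))
    have h1 := hpos.trans_le (min_le_left _ _)
    have h2 := hpos.trans_le (min_le_right _ _)
    refine ⟨by rw [hBdef, Metric.mem_ball]; linarith, ?_⟩
    rw [hc, Real.enorm_eq_ofReal_abs, ← ENNReal.ofReal_mul h2a.le, ← ENNReal.ofReal_one]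
    refine ENNReal.ofReal_le_ofReal ?_
    have h3 : u x < a / 2 := by
      have : 2 / a * u x < 2 / a * (a / 2) := by
        have e : 2 / a * (a / 2) = 1 := by field_simp
        rw [e]; linarith
      exact lt_of_mul_lt_mul_left this h2a.le
    have h4 : a / 2 ≤ |u x - a| := by
      rw [abs_sub_comm]
      exact le_trans (by linarith) (le_abs_self _)
    calc (1 : ℝ) = 2 / a * (a / 2) := by field_simp
      _ ≤ _ := by gcongr
  have hosc : ∀ x y, |v x - v y| ≤ max (dist x y) (2 / a * |u x - u y|) := by
    intro x y
    refine (abs_max_sub_max_le_max _ _ _ _).trans ?_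
    rw [sub_self, abs_zero]
    refine max_le (le_max_of_le_left dist_nonneg) ((abs_min_sub_min_le_max _ _ _ _).trans
      (max_le_max ?_ ?_))
    · rw [show r + 1 - dist x z - (r + 1 - dist y z) = dist y z - dist x z by ring, abs_sub_comm]
      exact abs_dist_sub_le _ _ _
    · rw [show 1 - 2 / a * u x - (1 - 2 / a * u y) = -(2 / a * (u x - u y)) by ring, abs_neg,
        abs_mul, abs_of_pos h2a]
  let g₁ : X → ℝ≥0∞ := fun x => max 1 (c * g x)
  have hg₁m : Measurable g₁ := measurable_const.max (hg.1.const_mul _)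
  have hg₁ : IsUpperGradient g₁ (fun x => (v x : EReal)) := by
    refine ⟨hg₁m, fun γ => ?_⟩
    have h0 : (0 : ℝ) ∈ Icc 0 γ.length := ⟨le_rfl, γ.length_pos.le⟩
    have hl : γ.length ∈ Icc 0 γ.length := ⟨γ.length_pos.le, le_rfl⟩
    unfold Curve.osc
    rw [abs_coe_sub_coe]
    refine (ENNReal.ofReal_le_ofReal (hosc _ _)).trans ?_
    rw [ENNReal.ofReal_max]
    refine max_le ?_ ?_
    · refine le_trans ?_ (γ.lineIntegral_mono (g := fun _ => 1) fun x => le_max_left _ _)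
      unfold Curve.lineIntegral
      rw [setLIntegral_const, Real.volume_Icc, one_mul]
      refine ENNReal.ofReal_le_ofReal ((γ.dist_le h0 hl).trans ?_)
      rw [zero_sub, abs_neg, abs_of_pos γ.length_pos, sub_zero]
    · refine le_trans ?_ (γ.lineIntegral_mono (g := fun x => c * g x) fun x => le_max_right _ _)
      rw [γ.lineIntegral_const_mul hg.1, ENNReal.ofReal_mul h2a.le]
      refine mul_le_mul_right ?_ _
      have := hg.2 γ
      unfold Curve.osc at this
      rwa [abs_coe_sub_coe] at this
  set V : Set X := {x | hvm.mk v x ≠ 0} with hV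
  have hVm : MeasurableSet V := (hvm.measurable_mk (measurableSet_singleton 0)).compl
  have hg₁fin : ∀ᶠ γ in aeCurve hp μ, γ.lineIntegral g₁ ≠ ∞ := by
    filter_upwards [eventually_lineIntegral_ne_top hp hg.1 hgfin] with γ hγ
    refine ne_top_of_le_ne_top ?_ (γ.lineIntegral_mono (g' := fun x => 1 + c * g x)
      fun x => max_le le_self_add le_add_self)
    rw [γ.lineIntegral_add measurable_const, γ.lineIntegral_const_mul hg.1]
    refine ENNReal.add_ne_top.2 ⟨?_, by finiteness⟩
    unfold Curve.lineIntegral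
    rw [setLIntegral_const, Real.volume_Icc]
    finiteness
  -- The cut-off contributes gradient 1 everywhere; discarding the level set `v = 0` confines it to
  -- `V`, whose measure is controlled.
  have hW : WeakGrad hp μ (V.indicator g₁) (fun x => (v x : EReal)) := by
    refine (hg₁.weakGrad hp μ).of_ne hg₁fin 0 (hg₁m.indicator hVm) ?_
    filter_upwards [hvm.ae_eq_mk] with x hx hx0
    have : x ∈ V := by
      show hvm.mk v x ≠ 0
      rw [← hx]
      intro h
      exact hx0 (by rw [h])
    rw [indicator_of_mem this]
  have hVle : ∀ᵐ x ∂μ, V.indicator (fun _ => (1 : ℝ≥0∞)) x ≤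
      B.indicator (fun x => c ^ p * ‖u x - a‖ₑ ^ p) x := by
    filter_upwards [hvm.ae_eq_mk] with x hx
    by_cases hxV : x ∈ V
    · have h1 : v x ≠ 0 := by rw [hx]; exact hxV
      obtain ⟨h2, h3⟩ := hvne x h1
      rw [indicator_of_mem hxV, indicator_of_mem h2, ← ENNReal.mul_rpow_of_nonneg _ _ hp.le]
      exact ENNReal.one_le_rpow h3 hp
    · simp [hxV]
  have hVD : μ V ≤ c ^ p * D := by
    rw [← lintegral_indicator_one hVm]
    refine (lintegral_mono_ae hVle).trans ?_
    rw [lintegral_indicator hBm, lintegral_const_mul'' _ (by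
      exact ((hu.sub aemeasurable_const).enorm.pow_const p).restrict)]
    exact mul_le_mul_right hD _
  have hcfin : c ^ p ≠ ∞ := ENNReal.rpow_ne_top_of_nonneg hp.le ENNReal.ofReal_ne_top
  have hg₁int : ∫⁻ x, V.indicator g₁ x ^ p ∂μ ≤ μ V + c ^ p * ∫⁻ x, g x ^ p ∂μ := by
    rw [← lintegral_indicator_one hVm, ← lintegral_const_mul _ (hg.1.pow_const p),
      ← lintegral_add_left (measurable_one.indicator hVm)]
    refine lintegral_mono fun x => ?_
    by_cases hxV : x ∈ V
    · rw [indicator_of_mem hxV, indicator_of_mem hxV, ← ENNReal.mul_rpow_of_nonneg _ _ hp.le]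
      rcases le_total 1 (c * g x) with h | h
      · simp only [g₁, max_eq_right h]
        exact le_add_self
      · simp only [g₁, max_eq_left h, ENNReal.one_rpow, Pi.one_apply]
        exact le_self_add
    · simp [hxV, hp]
  have hvint : ∫⁻ x, (v x : EReal).abs ^ p ∂μ ≤ μ V := by
    rw [← lintegral_indicator_one hVm]
    refine lintegral_mono_ae ?_
    filter_upwards [hvm.ae_eq_mk] with x hx
    by_cases hxV : x ∈ V
    · rw [indicator_of_mem hxV, EReal.abs_def, abs_of_nonneg (hv0 x)]
      refine ENNReal.rpow_le_one ?_ hp.le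
      rw [← ENNReal.ofReal_one]
      exact ENNReal.ofReal_le_ofReal (hv1 x)
    · have : v x = 0 := by rw [hx]; exact not_not.1 hxV
      simp [this, hp]
  have hVfin : μ V ≠ ∞ := ne_top_of_le_ne_top (ENNReal.mul_ne_top hcfin hDfin) hVD
  have hcap := capacity_le (E := S ∩ Metric.ball z r) (measurable_coe_real_ereal.comp_aemeasurable
    hvm) hW (ne_top_of_le_ne_top (by finiteness) hg₁int) (ne_top_of_le_ne_top hVfin hvint) (by
      rintro x ⟨hxS, hxB⟩
      have h1 : (1 : ℝ) ≤ v x := by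
        refine le_max_of_le_right (le_min ?_ ?_)
        · rw [Metric.mem_ball] at hxB; linarith
        · rw [huS x hxS]; simp
      show ((1 : ℝ) : EReal) ≤ (v x : EReal)
      exact EReal.coe_le_coe_iff.2 h1)
  refine hcap.trans ((add_le_add hvint hg₁int).trans ?_)
  calc μ V + (μ V + c ^ p * ∫⁻ x, g x ^ p ∂μ)
      ≤ c ^ p * D + (c ^ p * D + c ^ p * ∫⁻ x, g x ^ p ∂μ) := by gcongr
    _ = _ := by ring

/-- Split `u` into u - a and its average `a` over a larger ball. The Poincaré inequality bounds the
first part; `average_le_of_capacity`, divided by the positive capacity, bounds the second. -/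
theorem exists_mazya_of_bounded (hp : 1 < p) (hPI : SupportsPoincare p p μ)
    (hμ : ∀ (x : X) (r : ℝ), 0 < r → 0 < μ (Metric.ball x r) ∧ μ (Metric.ball x r) < ∞)
    (z : X) {r : ℝ} (hr : 0 < r) {S : Set X} (hS : capacity p μ (S ∩ Metric.ball z r) ≠ 0) :
    ∃ C : ℝ≥0∞, C ≠ ∞ ∧ ∀ (u : X → ℝ) (g : X → ℝ≥0∞) (M : ℝ), AEMeasurable u μ →
      (∀ x, 0 ≤ u x) → (∀ x, u x ≤ M) → (∀ x ∈ S, u x = 0) →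
      IsUpperGradient g (fun x => (u x : EReal)) → ∫⁻ x, g x ^ p ∂μ ≠ ∞ →
      ∫⁻ x in Metric.ball z r, ‖u x‖ₑ ^ p ∂μ ≤ C * ∫⁻ x, g x ^ p ∂μ := by
  have hp0 : 0 < p := one_pos.trans hp
  have hr1 : 0 < r + 1 := by linarith
  obtain ⟨C, hC, H⟩ := SupportsPoincare.exists_const hp0 hPI hμ z hr1
  set B := Metric.ball z (r + 1)
  set κ := capacity p μ (S ∩ Metric.ball z r)
  have hBfin : μ B ≠ ∞ := (hμ z _ hr1).2.ne
  set C' : ℝ≥0∞ := 2 ^ p * (κ⁻¹ * (2 * C + 1)) with hC'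
  have hC'fin : C' ≠ ∞ := by
    have : κ⁻¹ ≠ ∞ := ENNReal.inv_ne_top.2 hS
    exact ENNReal.mul_ne_top (ENNReal.rpow_ne_top_of_nonneg hp0.le (by simp)) (by finiteness)
  refine ⟨2 ^ (p - 1) * (C + C' * μ B), ENNReal.mul_ne_top
    (ENNReal.rpow_ne_top_of_nonneg (by linarith) (by simp)) (by finiteness),
    fun u g M hu hu0 huM huS hg hgfin => ?_⟩
  set J := ∫⁻ x, g x ^ p ∂μ
  have h1 := H u g M hu (fun x => by rw [abs_of_nonneg (hu0 x)]; exact huM x) hg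
  set a := ⨍ y in B, u y ∂μ with ha
  have ha0 : 0 ≤ a := by
    rw [ha, setAverage_eq]
    exact smul_nonneg (by positivity) (integral_nonneg hu0)
  have hbound : ‖a‖ₑ ^ p ≤ C' * J := by
    rcases eq_or_lt_of_le ha0 with h0 | h0
    · rw [← h0]; simp [hp0]
    · have h2 := average_le_of_capacity hp0 hu hu0 huS hg hgfin h0 h1 (by finiteness)
      have h3 : κ * (ENNReal.ofReal a ^ p) ≤ 2 ^ p * (2 * C + 1) * J := by
        calc κ * (ENNReal.ofReal a ^ p)
            ≤ ENNReal.ofReal (2 / a) ^ p * (2 * (C * J) + J) * ENNReal.ofReal a ^ p := by gcongr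
          _ = (ENNReal.ofReal (2 / a) * ENNReal.ofReal a) ^ p * ((2 * C + 1) * J) := by
              rw [ENNReal.mul_rpow_of_nonneg _ _ hp0.le]; ring
          _ = 2 ^ p * (2 * C + 1) * J := by
              rw [← ENNReal.ofReal_mul (by positivity), div_mul_cancel₀ _ h0.ne',
                ENNReal.ofReal_ofNat, mul_assoc]
      rw [Real.enorm_eq_ofReal_abs, abs_of_pos h0, hC']
      have hκ : κ ≠ ∞ := by
        refine ne_top_of_le_ne_top ?_ h2
        exact ENNReal.mul_ne_top (ENNReal.rpow_ne_top_of_nonneg hp0.le ENNReal.ofReal_ne_top)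
          (by finiteness)
      calc ENNReal.ofReal a ^ p = κ⁻¹ * (κ * ENNReal.ofReal a ^ p) := by
            rw [← mul_assoc, ENNReal.inv_mul_cancel hS hκ, one_mul]
        _ ≤ κ⁻¹ * (2 ^ p * (2 * C + 1) * J) := by gcongr
        _ = _ := by ring
  have hrB : Metric.ball z r ⊆ B := Metric.ball_subset_ball (by linarith)
  calc ∫⁻ x in Metric.ball z r, ‖u x‖ₑ ^ p ∂μ
      ≤ ∫⁻ x in B, ‖u x‖ₑ ^ p ∂μ := lintegral_mono_set hrB
    _ ≤ ∫⁻ x in B, 2 ^ (p - 1) * (‖u x - a‖ₑ ^ p + ‖a‖ₑ ^ p) ∂μ := by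
        refine lintegral_mono fun x => ?_
        refine le_trans ?_ (ENNReal.rpow_add_le_mul_rpow_add_rpow _ _ hp.le)
        refine ENNReal.rpow_le_rpow ?_ hp0.le
        have := enorm_add_le (u x - a) a
        rwa [sub_add_cancel] at this
    _ = 2 ^ (p - 1) * (∫⁻ x in B, ‖u x - a‖ₑ ^ p ∂μ + ‖a‖ₑ ^ p * μ B) := by
        have hm : AEMeasurable (fun x => ‖u x - a‖ₑ ^ p) (μ.restrict B) :=
          ((hu.sub aemeasurable_const).enorm.pow_const p).restrict
        have hm' : AEMeasurable (fun x => ‖u x - a‖ₑ ^ p + ‖a‖ₑ ^ p) (μ.restrict B) :=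
          hm.add aemeasurable_const
        rw [lintegral_const_mul'' _ hm', lintegral_add_left' hm, setLIntegral_const]
    _ ≤ 2 ^ (p - 1) * (C * J + C' * J * μ B) := by gcongr
    _ = _ := by ring

theorem abs_sub_min_toReal_le (a b : EReal) (n : ℕ) :
    (((min a.abs n).toReal : EReal) - ((min b.abs n).toReal : EReal)).abs ≤ (a - b).abs := by
  by_cases h : (a - b).abs = ∞
  · simp [h]
  obtain ⟨x, y, rfl, rfl⟩ := exists_real_of_abs_sub_ne_top h
  have e : ∀ x : ℝ, (min (x : EReal).abs (n : ℝ≥0∞)).toReal = min |x| n := by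
    intro x
    rw [EReal.abs_def, ← ENNReal.ofReal_natCast, ← ENNReal.ofReal_min, ENNReal.toReal_ofReal]
    exact le_min (abs_nonneg _) (Nat.cast_nonneg _)
  rw [e, e, abs_coe_sub_coe, abs_coe_sub_coe]
  refine ENNReal.ofReal_le_ofReal ((abs_min_sub_min_le_max _ _ _ _).trans ?_)
  simp only [sub_self, abs_zero]
  exact max_le (abs_abs_sub_abs_le _ _) (abs_nonneg _)

/-- Maz'ya's inequality: a function vanishing on a set of positive capacity is controlled by its
weak upper gradient. -/
theorem exists_mazya (hp : 1 < p) (hp0 : 0 < p) (hPI : SupportsPoincare p p μ)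
    (hμ : ∀ (x : X) (r : ℝ), 0 < r → 0 < μ (Metric.ball x r) ∧ μ (Metric.ball x r) < ∞)
    (z : X) {r : ℝ} (hr : 0 < r) {S : Set X} (hS : capacity p μ (S ∩ Metric.ball z r) ≠ 0) :
    ∃ C : ℝ≥0∞, C ≠ ∞ ∧ ∀ (F : X → EReal) (g : X → ℝ≥0∞), AEMeasurable F μ →
      (∀ x ∈ S, F x = 0) → WeakGrad hp0 μ g F → ∫⁻ x, g x ^ p ∂μ ≠ ∞ →
      ∫⁻ x in Metric.ball z r, (F x).abs ^ p ∂μ ≤ C * ∫⁻ x, g x ^ p ∂μ := by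
  obtain ⟨C, hC, H⟩ := exists_mazya_of_bounded hp hPI hμ z hr hS
  refine ⟨C, hC, fun F g hF hFS hg hgfin => ?_⟩
  have hFm : AEMeasurable (fun x => (F x).abs) μ := measurable_abs_ereal.comp_aemeasurable hF
  -- The truncations of `|F|` at height `n` are bounded and real with no larger oscillation, and the
  -- weak upper gradient is replaced by a genuine one at an energy cost `ε`.
  have htr : ∀ n : ℕ, ∫⁻ x in Metric.ball z r, (min (F x).abs n) ^ p ∂μ ≤
      C * ∫⁻ x, g x ^ p ∂μ := by
    intro n
    have hε : ∀ ε : ℝ≥0∞, ε ≠ 0 → ε ≠ ∞ → ∫⁻ x in Metric.ball z r, (min (F x).abs n) ^ p ∂μ ≤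
        C * (∫⁻ x, g x ^ p ∂μ + ε) := by
      intro ε hε hε'
      obtain ⟨g', hg', hle⟩ := hg.exists_isUpperGradient hε
      have h1 := H (fun x => (min (F x).abs n).toReal) g' n (hFm.min aemeasurable_const).ennreal_toReal
        (fun x => ENNReal.toReal_nonneg) (fun x => ?_) (fun x hx => by simp [hFS x hx])
        ⟨hg'.1, fun γ => (abs_sub_min_toReal_le _ _ n).trans (hg'.2 γ)⟩
        (ne_top_of_le_ne_top (by finiteness) hle)
      · refine le_trans (le_of_eq (lintegral_congr fun x => ?_)) (h1.trans (mul_le_mul_right hle _))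
        rw [Real.enorm_eq_ofReal ENNReal.toReal_nonneg, ENNReal.ofReal_toReal]
        exact ne_top_of_le_ne_top (ENNReal.natCast_ne_top n) (min_le_right _ _)
      · have := ENNReal.toReal_mono (ENNReal.natCast_ne_top n) (min_le_right (F x).abs n)
        simpa using this
    have hlim : Tendsto (fun ε : ℝ≥0∞ => C * (∫⁻ x, g x ^ p ∂μ + ε)) (𝓝[>] 0)
        (𝓝 (C * (∫⁻ x, g x ^ p ∂μ + 0))) := by
      refine ENNReal.Tendsto.const_mul ?_ (Or.inr hC)
      exact (tendsto_id.mono_left nhdsWithin_le_nhds).const_add _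
    rw [add_zero] at hlim
    refine ge_of_tendsto hlim ?_
    filter_upwards [Ioo_mem_nhdsGT (zero_lt_one' ℝ≥0∞)] with ε hε'
    exact hε ε hε'.1.ne' (hε'.2.trans ENNReal.one_lt_top).ne
  have hmono := lintegral_tendsto_of_tendsto_of_monotone (μ := μ.restrict (Metric.ball z r))
    (f := fun (n : ℕ) x => (min (F x).abs n) ^ p) (F := fun x => (F x).abs ^ p)
    (fun n => ((hFm.min aemeasurable_const).pow_const p).restrict)
    (Eventually.of_forall fun x i j hij => ENNReal.rpow_le_rpow
      (min_le_min le_rfl (by exact_mod_cast hij)) hp0.le)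
    (Eventually.of_forall fun x => by
      refine (ENNReal.continuous_rpow_const.tendsto _).comp ?_
      have := (tendsto_const_nhds (x := (F x).abs)).min ENNReal.tendsto_nat_nhds_top
      rwa [min_top_right] at this)
  exact le_of_tendsto' hmono htr

end Poincare

/-! ### Extension by zero -/

section Extension

variable {X : Type*} [MetricSpace X] [MeasurableSpace X] [BorelSpace X]
  {p : ℝ} {μ : Measure X} {hp : 0 < p} {V : Set X}

open Classical in
/-- The extension of a function by zero. -/
def extZero {α : Type*} [Zero α] (V : Set X) (h : V → α) : X → α :=
  fun x => if hx : x ∈ V then h ⟨x, hx⟩ else 0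

theorem extZero_of_mem {α : Type*} [Zero α] (h : V → α) {x : X} (hx : x ∈ V) :
    extZero V h x = h ⟨x, hx⟩ := dif_pos hx

theorem extZero_of_notMem {α : Type*} [Zero α] (h : V → α) {x : X} (hx : x ∉ V) :
    extZero V h x = 0 := dif_neg hx

@[simp] theorem extZero_coe {α : Type*} [Zero α] (h : V → α) (x : V) : extZero V h x = h x :=
  extZero_of_mem h x.2

theorem measurable_extZero {α : Type*} [Zero α] [MeasurableSpace α] (hV : MeasurableSet V)
    {h : V → α} (hh : Measurable h) : Measurable (extZero V h) := by
  classical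
  unfold extZero
  exact Measurable.dite hh measurable_const hV

theorem ae_comap_iff (hV : MeasurableSet V) {P : X → Prop} :
    (∀ᵐ x : V ∂μ.comap (↑), P x) ↔ ∀ᵐ x ∂μ.restrict V, P x := by
  rw [← map_comap_subtype_coe hV]
  exact ((MeasurableEmbedding.subtype_coe hV).ae_map_iff).symm

theorem aemeasurable_extZero {α : Type*} [Zero α] [MeasurableSpace α] (hV : MeasurableSet V)
    {h : V → α} (hh : AEMeasurable h (μ.comap (↑))) : AEMeasurable (extZero V h) μ := by
  refine ⟨extZero V (hh.mk h), measurable_extZero hV hh.measurable_mk, ?_⟩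
  have h1 : ∀ᵐ x : V ∂μ.comap (↑), extZero V h x = extZero V (hh.mk h) x := by
    filter_upwards [hh.ae_eq_mk] with x hx
    simpa using hx
  rw [ae_comap_iff hV (P := fun x => extZero V h x = extZero V (hh.mk h) x),
    ae_restrict_iff' hV] at h1
  filter_upwards [h1] with x hx
  by_cases hxV : x ∈ V
  · exact hx hxV
  · simp [extZero_of_notMem, hxV]

theorem lintegral_extZero (hp : 0 < p) (hV : MeasurableSet V) (G : V → ℝ≥0∞) :
    ∫⁻ x, extZero V G x ^ p ∂μ = ∫⁻ x, G x ^ p ∂μ.comap (↑) := by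
  have h1 := lintegral_subtype_comap hV (μ := μ) fun x => extZero V G x ^ p
  simp only [extZero_coe] at h1
  rw [h1, ← lintegral_indicator hV]
  refine lintegral_congr fun x => ?_
  by_cases hx : x ∈ V
  · simp [hx]
  · simp [hx, extZero_of_notMem, hp]

/-- The witness on `V` is extended by zero; pieces of a curve lying in `V` are curves of `V`. -/
theorem WeakGrad.eventually_zeroExtension (hV : MeasurableSet V) {G : V → ℝ≥0∞} {U : V → EReal}
    (h : WeakGrad hp (μ.comap (↑)) G U) : ∀ᶠ γ in aeCurve hp μ, ∀ s t, 0 ≤ s → s < t →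
      t ≤ γ.length → (∀ x ∈ Icc s t, γ.toFun x ∈ V) →
      (extZero V U (γ.toFun s) - extZero V U (γ.toFun t)).abs ≤
        ∫⁻ x in Icc s t, extZero V G (γ.toFun x) := by
  obtain ⟨ρ, h1, h2, h3⟩ := h.2
  refine ⟨extZero V ρ, measurable_extZero hV h1, by rwa [lintegral_extZero hp hV], ?_⟩
  intro γ hγ s t hs hst ht hst'
  obtain ⟨γ', hl, he⟩ := (γ.sub s t hs hst ht).exists_incl_eq (A := V) (fun x hx => by
    rw [γ.sub_toFun]
    exact hst' _ ⟨by linarith [hx.1], by linarith [hx.2, γ.sub_length hs hst ht]⟩)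
  have hint : ∀ g : V → ℝ≥0∞, γ'.lineIntegral g = ∫⁻ x in Icc s t, extZero V g (γ.toFun x) := by
    intro g
    rw [← γ.lineIntegral_sub hs hst ht]
    unfold Curve.lineIntegral
    rw [hl]
    refine setLIntegral_congr_fun measurableSet_Icc fun x hx => ?_
    rw [← he x hx, extZero_coe]
  have h4 : γ'.osc U ≤ γ'.lineIntegral G := h3 γ' (by
    rw [hint]
    exact ne_top_of_le_ne_top hγ (lintegral_mono_set (Icc_subset_Icc hs ht)))
  rw [hint] at h4
  refine le_trans (le_of_eq ?_) h4
  have e0 := he 0 ⟨le_rfl, (γ.sub s t hs hst ht).length_pos.le⟩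
  have e1 := he (γ.sub s t hs hst ht).length ⟨(γ.sub s t hs hst ht).length_pos.le, le_rfl⟩
  unfold Curve.osc
  rw [hl, ← extZero_coe U, ← extZero_coe U, e0, e1]
  simp

/-- The zero extension of a function that is dominated by a Dirichlet function vanishing outside
`V`. -/
theorem WeakGrad.zeroExtension (hV : MeasurableSet V) {G : V → ℝ≥0∞} {U : V → EReal}
    (h : WeakGrad hp (μ.comap (↑)) G U) {H : X → EReal} {e : X → ℝ≥0∞} (hH : WeakGrad hp μ e H)
    (he : ∫⁻ x, e x ^ p ∂μ ≠ ∞) (hH0 : ∀ x, x ∉ V → H x = 0)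
    (hUH : ∀ x : V, (U x).abs ≤ (H x).abs) :
    WeakGrad hp μ (extZero V G) (extZero V U) := by
  refine weakGrad_of_controlled (measurable_extZero hV h.1) ?_
  filter_upwards [h.eventually_zeroExtension hV, hH.eventually_real he] with γ h1 ⟨k, hk, hkc⟩
  -- Along the curve `H` is real and continuous. Where it is nonzero the curve lies in `V`, so the
  -- control inside `V` is enough.
  refine ControlledOn.of_pointwise hkc (fun t ht => ?_) fun s t hs hst ht hne => ?_
  · rw [← EReal.abs_def, ← hk t ht]
    by_cases hx : γ.toFun t ∈ V
    · rw [extZero_of_mem _ hx]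
      exact hUH ⟨_, hx⟩
    · simp [extZero_of_notMem _ hx]
  · refine h1 s t hs hst ht fun x hx => ?_
    by_contra hxV
    have h2 := hk x ⟨hs.trans hx.1, hx.2.trans ht⟩
    rw [hH0 _ hxV] at h2
    exact hne x hx (by exact_mod_cast h2.symm)

end Extension

/-! ### Functions of two Dirichlet functions -/

section Combination

variable {Y : Type*} [MetricSpace Y] [MeasurableSpace Y] [BorelSpace Y] {p : ℝ} {μ : Measure Y}
  {hp : 0 < p} {g g₁ g₂ : Y → ℝ≥0∞} {u₁ u₂ : Y → EReal}

/-- The Lipschitz condition is asked only of real arguments, because along almost every curve both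
functions are real. -/
theorem WeakGrad.comp₂_add (h₁ : WeakGrad hp μ g₁ u₁) (h₂ : WeakGrad hp μ g₂ u₂)
    (f₁ : ∫⁻ x, g₁ x ^ p ∂μ ≠ ∞) (f₂ : ∫⁻ x, g₂ x ^ p ∂μ ≠ ∞) {Φ : EReal → EReal → EReal}
    {c : ℝ≥0∞} (hΦ : ∀ a b a' b' : ℝ, (Φ a b - Φ a' b').abs ≤
      c * (ENNReal.ofReal |a - a'| + ENNReal.ofReal |b - b'|)) :
    WeakGrad hp μ (fun x => c * (g₁ x + g₂ x)) (fun x => Φ (u₁ x) (u₂ x)) := by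
  refine ⟨(h₁.1.add h₂.1).const_mul _, ?_⟩
  filter_upwards [h₁.2, h₂.2, h₁.eventually_real f₁, h₂.eventually_real f₂]
    with γ i₁ i₂ ⟨k₁, e₁, _⟩ ⟨k₂, e₂, _⟩
  have h0 : (0 : ℝ) ∈ Icc 0 γ.length := ⟨le_rfl, γ.length_pos.le⟩
  have hl : γ.length ∈ Icc 0 γ.length := ⟨γ.length_pos.le, le_rfl⟩
  have hm : Measurable fun x => g₁ x + g₂ x := h₁.1.add h₂.1
  rw [γ.lineIntegral_const_mul hm, γ.lineIntegral_add h₁.1]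
  unfold Curve.osc at i₁ i₂ ⊢
  simp only [e₁ _ h0, e₁ _ hl, e₂ _ h0, e₂ _ hl, abs_coe_sub_coe] at i₁ i₂ ⊢
  exact (hΦ _ _ _ _).trans (mul_le_mul_right (add_le_add i₁ i₂) _)

/-- Lattice operations keep a common gradient without enlarging it; the comparison argument for
uniqueness depends on this sharpness. -/
theorem WeakGrad.comp₂_max (h₁ : WeakGrad hp μ g u₁) (h₂ : WeakGrad hp μ g u₂)
    (f : ∫⁻ x, g x ^ p ∂μ ≠ ∞) {Φ : EReal → EReal → EReal}
    (hΦ : ∀ a b a' b' : ℝ, (Φ a b - Φ a' b').abs ≤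
      max (ENNReal.ofReal |a - a'|) (ENNReal.ofReal |b - b'|)) :
    WeakGrad hp μ g (fun x => Φ (u₁ x) (u₂ x)) := by
  refine ⟨h₁.1, ?_⟩
  filter_upwards [h₁.2, h₂.2, h₁.eventually_real f, h₂.eventually_real f]
    with γ i₁ i₂ ⟨k₁, e₁, _⟩ ⟨k₂, e₂, _⟩
  have h0 : (0 : ℝ) ∈ Icc 0 γ.length := ⟨le_rfl, γ.length_pos.le⟩
  have hl : γ.length ∈ Icc 0 γ.length := ⟨γ.length_pos.le, le_rfl⟩
  unfold Curve.osc at i₁ i₂ ⊢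
  simp only [e₁ _ h0, e₁ _ hl, e₂ _ h0, e₂ _ hl, abs_coe_sub_coe] at i₁ i₂ ⊢
  exact (hΦ _ _ _ _).trans (max_le i₁ i₂)

theorem lintegral_add_rpow_ne_top {α : Type*} [MeasurableSpace α] {ν : Measure α} (hp : 1 ≤ p)
    {f g : α → ℝ≥0∞} (hf : Measurable f) (h₁ : ∫⁻ x, f x ^ p ∂ν ≠ ∞) (h₂ : ∫⁻ x, g x ^ p ∂ν ≠ ∞) :
    ∫⁻ x, (f x + g x) ^ p ∂ν ≤ 2 ^ (p - 1) * (∫⁻ x, f x ^ p ∂ν + ∫⁻ x, g x ^ p ∂ν) ∧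
      ∫⁻ x, (f x + g x) ^ p ∂ν ≠ ∞ := by
  have h2 : (2 : ℝ≥0∞) ^ (p - 1) ≠ ∞ := ENNReal.rpow_ne_top_of_nonneg (by linarith) (by simp)
  have h3 : ∫⁻ x, (f x + g x) ^ p ∂ν ≤
      2 ^ (p - 1) * (∫⁻ x, f x ^ p ∂ν + ∫⁻ x, g x ^ p ∂ν) := by
    rw [← lintegral_add_left (hf.pow_const p), ← lintegral_const_mul' _ _ h2]
    exact lintegral_mono fun x => ENNReal.rpow_add_le_mul_rpow_add_rpow _ _ hp
  exact ⟨h3, ne_top_of_le_ne_top (by finiteness) h3⟩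

end Combination

/-! ### Uniform convexity -/

theorem abs_rpow_midpoint_lt {p : ℝ} (hp : 1 < p) {a b : ℝ} (hab : a ≠ b) :
    |(a + b) / 2| ^ p < (|a| ^ p + |b| ^ p) / 2 := by
  have hp0 : 0 < p := one_pos.trans hp
  by_cases h : |a| = |b|
  · rcases abs_eq_abs.1 h with h1 | h1
    · exact absurd h1 hab
    · have hb : b ≠ 0 := fun h0 => hab (by rw [h1, h0, neg_zero])
      have : 0 < |b| ^ p := Real.rpow_pos_of_pos (abs_pos.2 hb) p
      rw [h, h1, neg_add_cancel, zero_div, abs_zero, Real.zero_rpow hp0.ne']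
      linarith
  · have h1 := (strictConvexOn_rpow hp).2 (abs_nonneg a) (abs_nonneg b) h
      (show (0 : ℝ) < 1 / 2 by norm_num) (show (0 : ℝ) < 1 / 2 by norm_num) (by norm_num)
    simp only [smul_eq_mul] at h1
    have h2 : |(a + b) / 2| ≤ 1 / 2 * |a| + 1 / 2 * |b| := by
      rw [abs_div, abs_two]
      linarith [abs_add_le a b]
    calc |(a + b) / 2| ^ p ≤ (1 / 2 * |a| + 1 / 2 * |b|) ^ p :=
          Real.rpow_le_rpow (abs_nonneg _) h2 hp0.le
      _ < 1 / 2 * |a| ^ p + 1 / 2 * |b| ^ p := h1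
      _ = _ := by ring

theorem abs_rpow_midpoint_le {p : ℝ} (hp : 1 < p) (a b : ℝ) :
    |(a + b) / 2| ^ p ≤ (|a| ^ p + |b| ^ p) / 2 := by
  rcases eq_or_ne a b with rfl | h
  · rw [add_self_div_two, add_self_div_two]
  · exact (abs_rpow_midpoint_lt hp h).le

/-- By homogeneity one may assume |a|^p + |b|^p = 1. If |a - b|^p ≤ ε, convexity suffices. The
remaining pairs lie in a compact set, on which strict convexity keeps the p-th power of the midpoint
a fixed amount below 1/2, and a large multiple of that gap absorbs |a - b|^p. -/
theorem exists_uniform_convexity_const {p : ℝ} (hp : 1 < p) {ε : ℝ} (hε : 0 < ε) :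
    ∃ C : ℝ, 0 ≤ C ∧ ∀ a b : ℝ, |a - b| ^ p + C * |(a + b) / 2| ^ p ≤
      ε * (|a| ^ p + |b| ^ p) + C * ((|a| ^ p + |b| ^ p) / 2) := by
  have hp0 : 0 < p := one_pos.trans hp
  have hcont : Continuous fun x : ℝ × ℝ => |x.1| ^ p + |x.2| ^ p :=
    (continuous_fst.abs.rpow_const fun _ => Or.inr hp0.le).add
      (continuous_snd.abs.rpow_const fun _ => Or.inr hp0.le)
  have hcontd : Continuous fun x : ℝ × ℝ => |x.1 - x.2| ^ p :=
    (continuous_fst.sub continuous_snd).abs.rpow_const fun _ => Or.inr hp0.le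
  have hcontm : Continuous fun x : ℝ × ℝ => |(x.1 + x.2) / 2| ^ p :=
    ((continuous_fst.add continuous_snd).div_const 2).abs.rpow_const fun _ => Or.inr hp0.le
  have hle1 : ∀ a b : ℝ, |a| ^ p + |b| ^ p = 1 → |a| ≤ 1 ∧ |b| ≤ 1 := by
    intro a b h
    have ha := Real.rpow_nonneg (abs_nonneg a) p
    have hb := Real.rpow_nonneg (abs_nonneg b) p
    refine ⟨not_lt.1 fun h1 => ?_, not_lt.1 fun h1 => ?_⟩
    · linarith [Real.one_lt_rpow h1 hp0]
    · linarith [Real.one_lt_rpow h1 hp0]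
  set K : Set (ℝ × ℝ) := {x | |x.1| ^ p + |x.2| ^ p = 1} ∩ {x | ε ≤ |x.1 - x.2| ^ p} with hK
  have hKc : IsCompact K := by
    refine Metric.isCompact_of_isClosed_isBounded ((isClosed_eq hcont continuous_const).inter
      (isClosed_le continuous_const hcontd)) ?_
    refine Metric.isBounded_closedBall.subset (s := K) (t := Metric.closedBall 0 1) ?_
    rintro ⟨a, b⟩ ⟨h1, -⟩
    have := hle1 a b h1
    rw [mem_closedBall_zero_iff, Prod.norm_def, Real.norm_eq_abs, Real.norm_eq_abs]
    exact max_le this.1 this.2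
  obtain ⟨C, hC0, hC⟩ : ∃ C : ℝ, 0 ≤ C ∧ ∀ a b : ℝ, |a| ^ p + |b| ^ p = 1 →
      |a - b| ^ p + C * |(a + b) / 2| ^ p ≤ ε + C * (1 / 2) := by
    have hsmall : ∀ C : ℝ, 0 ≤ C → ∀ a b : ℝ, |a| ^ p + |b| ^ p = 1 → |a - b| ^ p ≤ ε →
        |a - b| ^ p + C * |(a + b) / 2| ^ p ≤ ε + C * (1 / 2) := by
      intro C hC a b h1 h2
      have := abs_rpow_midpoint_le hp a b
      rw [h1] at this
      gcongr
    rcases K.eq_empty_or_nonempty with hKe | hKne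
    · refine ⟨0, le_rfl, fun a b h1 => hsmall 0 le_rfl a b h1 ?_⟩
      by_contra h2
      have : (a, b) ∈ K := ⟨h1, (not_le.1 h2).le⟩
      rw [hKe] at this
      exact this
    · obtain ⟨⟨a₀, b₀⟩, h0, hmax⟩ := hKc.exists_isMaxOn hKne hcontm.continuousOn
      set m := |(a₀ + b₀) / 2| ^ p with hm
      have hm1 : m < 1 / 2 := by
        have hne : a₀ ≠ b₀ := by
          rintro rfl
          have h2 : ε ≤ |a₀ - a₀| ^ p := h0.2
          rw [sub_self, abs_zero, Real.zero_rpow hp0.ne'] at h2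
          linarith
        have h3 := abs_rpow_midpoint_lt hp hne
        rwa [show |a₀| ^ p + |b₀| ^ p = 1 from h0.1] at h3
      have hpos : 0 < 1 / 2 - m := by linarith
      have hC0 : 0 ≤ 2 ^ p / (1 / 2 - m) := by positivity
      refine ⟨2 ^ p / (1 / 2 - m), hC0, fun a b h1 => ?_⟩
      rcases le_total (|a - b| ^ p) ε with h2 | h2
      · exact hsmall _ hC0 a b h1 h2
      · have h3 : |(a + b) / 2| ^ p ≤ m := hmax (show (a, b) ∈ K from ⟨h1, h2⟩)
        have h4 : |a - b| ^ p ≤ 2 ^ p := by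
          refine Real.rpow_le_rpow (abs_nonneg _) ?_ hp0.le
          have := hle1 a b h1
          linarith [abs_sub a b]
        have h5 : 2 ^ p / (1 / 2 - m) * (1 / 2 - m) = 2 ^ p := div_mul_cancel₀ _ hpos.ne'
        nlinarith [mul_le_mul_of_nonneg_left h3 hC0]
  refine ⟨C, hC0, fun a b => ?_⟩
  set T := |a| ^ p + |b| ^ p with hT
  have hT0 : 0 ≤ T := add_nonneg (Real.rpow_nonneg (abs_nonneg _) _)
    (Real.rpow_nonneg (abs_nonneg _) _)
  rcases eq_or_lt_of_le hT0 with h0 | h0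
  · have ha : |a| ^ p = 0 := by
      linarith [Real.rpow_nonneg (abs_nonneg a) p, Real.rpow_nonneg (abs_nonneg b) p]
    have hb : |b| ^ p = 0 := by
      linarith [Real.rpow_nonneg (abs_nonneg a) p, Real.rpow_nonneg (abs_nonneg b) p]
    rw [Real.rpow_eq_zero (abs_nonneg _) hp0.ne', abs_eq_zero] at ha hb
    rw [← h0, ha, hb]
    simp [hp0.ne']
  · set l := T ^ (-(1 / p)) with hl
    have hl0 : 0 < l := Real.rpow_pos_of_pos h0 _
    have hlp : l ^ p = T⁻¹ := by
      rw [hl, ← Real.rpow_mul hT0, neg_mul, one_div_mul_cancel hp0.ne', Real.rpow_neg_one]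
    have hs : ∀ x : ℝ, |l * x| ^ p = T⁻¹ * |x| ^ p := by
      intro x
      rw [abs_mul, Real.mul_rpow (abs_nonneg _) (abs_nonneg _), abs_of_pos hl0, hlp]
    have h1 := hC (l * a) (l * b) (by
      rw [hs, hs, ← mul_add, ← hT, inv_mul_cancel₀ h0.ne'])
    rw [← mul_sub, ← mul_add, mul_div_assoc, hs, hs] at h1
    have h2 := mul_le_mul_of_nonneg_left h1 hT0
    have e1 : T * (T⁻¹ * |a - b| ^ p + C * (T⁻¹ * |(a + b) / 2| ^ p)) =
        |a - b| ^ p + C * |(a + b) / 2| ^ p := by field_simp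
    rw [e1] at h2
    linarith

theorem uniform_convexity_ennreal {p : ℝ} (hp : 1 < p) {ε : ℝ} (hε : 0 < ε) {C : ℝ} (hC0 : 0 ≤ C)
    (hC : ∀ a b : ℝ, |a - b| ^ p + C * |(a + b) / 2| ^ p ≤
      ε * (|a| ^ p + |b| ^ p) + C * ((|a| ^ p + |b| ^ p) / 2)) {A B D M : ℝ≥0∞}
    (h : A ≠ ∞ → B ≠ ∞ → ∃ a b : ℝ, A = ENNReal.ofReal |a| ∧ B = ENNReal.ofReal |b| ∧
      D ≤ ENNReal.ofReal |a - b| ∧ M ≤ ENNReal.ofReal |(a + b) / 2|) :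
    D ^ p + ENNReal.ofReal C * M ^ p ≤
      (ENNReal.ofReal ε + ENNReal.ofReal C / 2) * (A ^ p + B ^ p) := by
  have hp0 : 0 < p := one_pos.trans hp
  have hε' : ENNReal.ofReal ε + ENNReal.ofReal C / 2 ≠ 0 := by
    have : ENNReal.ofReal ε ≠ 0 := by simpa using hε
    simp [this]
  by_cases hA : A = ∞
  · rw [hA, ENNReal.top_rpow_of_pos hp0, top_add, ENNReal.mul_top hε']; exact le_top
  by_cases hB : B = ∞
  · rw [hB, ENNReal.top_rpow_of_pos hp0, add_top, ENNReal.mul_top hε']; exact le_top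
  obtain ⟨a, b, rfl, rfl, h1, h2⟩ := h hA hB
  have e : ∀ x : ℝ, ENNReal.ofReal |x| ^ p = ENNReal.ofReal (|x| ^ p) := fun x =>
    ENNReal.ofReal_rpow_of_nonneg (abs_nonneg x) hp0.le
  have hn : ∀ x : ℝ, 0 ≤ |x| ^ p := fun x => Real.rpow_nonneg (abs_nonneg _) _
  calc D ^ p + ENNReal.ofReal C * M ^ p
      ≤ ENNReal.ofReal |a - b| ^ p + ENNReal.ofReal C * ENNReal.ofReal |(a + b) / 2| ^ p := by
        gcongr
    _ = ENNReal.ofReal (|a - b| ^ p + C * |(a + b) / 2| ^ p) := by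
        rw [e, e, ENNReal.ofReal_add (hn _) (mul_nonneg hC0 (hn _)), ENNReal.ofReal_mul hC0]
    _ ≤ ENNReal.ofReal ((ε + C / 2) * (|a| ^ p + |b| ^ p)) := by
        refine ENNReal.ofReal_le_ofReal ((hC a b).trans (le_of_eq (by ring)))
    _ = _ := by
        rw [ENNReal.ofReal_mul (by positivity), ENNReal.ofReal_add (hn _) (hn _),
          ENNReal.ofReal_add hε.le (by positivity), e, e, ENNReal.ofReal_div_of_pos two_pos,
          ENNReal.ofReal_ofNat]

/-- Two functions whose `p`-th powers have integral almost `m`, and whose midpoint does not have a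
smaller one, are close to each other. -/
theorem exists_uniform_convexity_integral {α : Type*} [MeasurableSpace α] (ν : Measure α) {p : ℝ}
    (hp : 1 < p) {m η : ℝ≥0∞} (hm : m ≠ ∞) (hη : η ≠ 0) : ∃ δ : ℝ≥0∞, δ ≠ 0 ∧
      ∀ A B D M : α → ℝ≥0∞, AEMeasurable A ν → AEMeasurable M ν →
        (∀ x, A x ≠ ∞ → B x ≠ ∞ → ∃ a b : ℝ, A x = ENNReal.ofReal |a| ∧ B x = ENNReal.ofReal |b| ∧
          D x ≤ ENNReal.ofReal |a - b| ∧ M x ≤ ENNReal.ofReal |(a + b) / 2|) →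
        ∫⁻ x, A x ^ p ∂ν ≤ m + δ → ∫⁻ x, B x ^ p ∂ν ≤ m + δ → m ≤ ∫⁻ x, M x ^ p ∂ν + δ →
        ∫⁻ x, D x ^ p ∂ν ≤ η := by
  have hp0 : 0 < p := one_pos.trans hp
  obtain ⟨η', hη0, hη', hηt⟩ : ∃ η' : ℝ≥0∞, η' ≠ 0 ∧ η' ≤ η ∧ η' ≠ ∞ :=
    ⟨min η 1, (lt_min (pos_iff_ne_zero.2 hη) one_pos).ne', min_le_left _ _,
      ne_top_of_le_ne_top ENNReal.one_ne_top (min_le_right _ _)⟩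
  -- The integrals of `A ^ p` and `B ^ p` total at most 2(m + 1), so the `ε` term costs at most half
  -- of `η'`. The constant `δ` makes the remaining error 2cδ at most the other half.
  set e : ℝ≥0∞ := η' / 2 / (2 * (m + 1)) with he
  have hden0 : 2 * (m + 1) ≠ 0 := by simp
  have hdent : 2 * (m + 1) ≠ ∞ := by finiteness
  have he0 : e ≠ 0 := ENNReal.div_ne_zero.2 ⟨(ENNReal.half_pos hη0).ne', hdent⟩
  have het : e ≠ ∞ := ENNReal.div_ne_top (ENNReal.div_ne_top hηt (by simp)) hden0
  have hε : 0 < e.toReal := ENNReal.toReal_pos he0 het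
  obtain ⟨C, hC0, hC⟩ := exists_uniform_convexity_const hp hε
  set c := ENNReal.ofReal C with hc
  have hct : c ≠ ∞ := ENNReal.ofReal_ne_top
  set δ : ℝ≥0∞ := min 1 (η' / 2 / (2 * (c + 1))) with hδ
  have hδ1 : δ ≤ 1 := min_le_left _ _
  have hδt : δ ≠ ∞ := ne_top_of_le_ne_top ENNReal.one_ne_top hδ1
  have hδc : 2 * c * δ ≤ η' / 2 := by
    calc 2 * c * δ ≤ 2 * (c + 1) * (η' / 2 / (2 * (c + 1))) := by
          gcongr
          · exact le_self_add
          · exact min_le_right _ _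
      _ = η' / 2 := ENNReal.mul_div_cancel (by simp) (by finiteness)
  refine ⟨δ, (lt_min one_pos (ENNReal.div_pos (ENNReal.half_pos hη0).ne' (by finiteness))).ne',
    fun A B D M hA hM h hAm hBm hMm => ?_⟩
  have h1 : ∫⁻ x, D x ^ p ∂ν + c * ∫⁻ x, M x ^ p ∂ν ≤
      (e + c / 2) * (∫⁻ x, A x ^ p ∂ν + ∫⁻ x, B x ^ p ∂ν) := by
    rw [← lintegral_add_left' (hA.pow_const p), ← lintegral_const_mul'' _ (hM.pow_const p),
      ← lintegral_add_right' _ ((hM.pow_const p).const_mul _), ← lintegral_const_mul' _ _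
        (by finiteness)]
    refine lintegral_mono fun x => ?_
    have := uniform_convexity_ennreal hp hε hC0 hC (h x)
    rwa [ENNReal.ofReal_toReal het] at this
  have h2 : ∫⁻ x, D x ^ p ∂ν + c * m ≤ (η' / 2 + 2 * c * δ) + c * m := by
    calc ∫⁻ x, D x ^ p ∂ν + c * m ≤ ∫⁻ x, D x ^ p ∂ν + c * (∫⁻ x, M x ^ p ∂ν + δ) := by gcongr
      _ = (∫⁻ x, D x ^ p ∂ν + c * ∫⁻ x, M x ^ p ∂ν) + c * δ := by ring
      _ ≤ (e + c / 2) * ((m + δ) + (m + δ)) + c * δ := by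
          gcongr
          exact h1.trans (by gcongr)
      _ = e * (2 * (m + δ)) + (c / 2 * 2) * (m + δ) + c * δ := by ring
      _ ≤ η' / 2 + c * (m + δ) + c * δ := by
          gcongr
          · calc e * (2 * (m + δ)) ≤ e * (2 * (m + 1)) := by gcongr
              _ = η' / 2 := ENNReal.div_mul_cancel hden0 hdent
          · rw [ENNReal.div_mul_cancel (by simp) (by simp)]
      _ = _ := by ring
  have h3 := ENNReal.le_of_add_le_add_right (ENNReal.mul_ne_top hct hm) h2
  calc ∫⁻ x, D x ^ p ∂ν ≤ η' / 2 + η' / 2 := h3.trans (by gcongr)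
    _ = η' := ENNReal.add_halves _
    _ ≤ η := hη'

/-! ### Rapidly converging sequences -/

theorem sum_two_inv_pow_le (n k : ℕ) :
    ∑ i ∈ Finset.range k, (2⁻¹ : ℝ≥0∞) ^ (n + i) ≤ 2 * 2⁻¹ ^ n := by
  simp_rw [pow_add]
  rw [← Finset.mul_sum, mul_comm]
  gcongr
  refine (ENNReal.sum_le_tsum _).trans (le_of_eq ?_)
  rw [ENNReal.tsum_geometric, ENNReal.one_sub_inv_two, inv_inv]

theorem le_two_inv_pow_mul_iSup (f : ℕ → ℝ≥0∞) (n : ℕ) : f n ≤ 2⁻¹ ^ n * ⨆ k, 2 ^ k * f k := by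
  calc f n = 2⁻¹ ^ n * (2 ^ n * f n) := by
        rw [← mul_assoc, ← mul_pow, ENNReal.inv_mul_cancel (by simp) (by simp), one_pow, one_mul]
    _ ≤ _ := by
        gcongr
        exact le_iSup (fun k => 2 ^ k * f k) n

/-- Telescoping with geometric weights. Only decreases of the sequence matter, so truncated
subtraction suffices. -/
theorem le_liminf_add_of_iSup (f : ℕ → ℝ≥0∞) (n : ℕ) :
    f n ≤ liminf f atTop + 2 * 2⁻¹ ^ n * ⨆ k, 2 ^ k * (f k - f (k + 1)) := by
  set s := ⨆ k, 2 ^ k * (f k - f (k + 1))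
  have h1 : ∀ k, f n ≤ f (n + k) + (∑ i ∈ Finset.range k, (2⁻¹ : ℝ≥0∞) ^ (n + i)) * s := by
    intro k
    induction k with
    | zero => simp
    | succ k ih =>
      refine ih.trans ?_
      rw [Finset.sum_range_succ, add_mul]
      have h2 : f (n + k) ≤ f (n + (k + 1)) + 2⁻¹ ^ (n + k) * s := by
        have := le_two_inv_pow_mul_iSup (fun k => f k - f (k + 1)) (n + k)
        exact tsub_le_iff_left.1 this
      calc f (n + k) + (∑ i ∈ Finset.range k, (2⁻¹ : ℝ≥0∞) ^ (n + i)) * s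
          ≤ (f (n + (k + 1)) + 2⁻¹ ^ (n + k) * s) +
            (∑ i ∈ Finset.range k, (2⁻¹ : ℝ≥0∞) ^ (n + i)) * s := by gcongr
        _ = _ := by ring
  have h2 : ∀ m, n ≤ m → f n ≤ f m + 2 * 2⁻¹ ^ n * s := by
    intro m hm
    obtain ⟨k, rfl⟩ := Nat.exists_eq_add_of_le hm
    refine (h1 k).trans ?_
    gcongr
    exact sum_two_inv_pow_le n k
  rw [← tsub_le_iff_right]
  refine le_liminf_of_le (by isBoundedDefault) ?_
  filter_upwards [eventually_ge_atTop n] with m hm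
  exact tsub_le_iff_right.2 (h2 m hm)

theorem abs_le_of_iSup (f : ℕ → EReal) (n : ℕ) :
    (f n).abs ≤ (f 0).abs + 2 * ⨆ k, 2 ^ k * (f (k + 1) - f k).abs := by
  set s := ⨆ k, 2 ^ k * (f (k + 1) - f k).abs
  have h1 : (f n).abs ≤ (f 0).abs + (∑ i ∈ Finset.range n, (2⁻¹ : ℝ≥0∞) ^ (0 + i)) * s := by
    induction n with
    | zero => simp
    | succ k ih =>
      rw [Finset.sum_range_succ, add_mul]
      calc (f (k + 1)).abs ≤ (f (k + 1) - f k).abs + (f k).abs := abs_le_abs_sub_add_ereal _ _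
        _ ≤ 2⁻¹ ^ (0 + k) * s +
            ((f 0).abs + (∑ i ∈ Finset.range k, (2⁻¹ : ℝ≥0∞) ^ (0 + i)) * s) := by
            gcongr
            rw [zero_add]
            exact le_two_inv_pow_mul_iSup (fun k => (f (k + 1) - f k).abs) k
        _ = _ := by ring
  refine h1.trans ?_
  gcongr
  simpa using sum_two_inv_pow_le 0 n

/-! ### Coercions, measurability and upper limits in the extended reals -/

theorem coe_min_ereal (a b : ℝ) : ((min a b : ℝ) : EReal) = min (a : EReal) b :=
  EReal.coe_strictMono.monotone.map_min

theorem coe_max_ereal (a b : ℝ) : ((max a b : ℝ) : EReal) = max (a : EReal) b :=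
  EReal.coe_strictMono.monotone.map_max

theorem abs_coe_ennreal (c : ℝ≥0∞) : (c : EReal).abs = c := by
  induction c with
  | top => simp
  | coe x =>
    change ((x : ℝ) : EReal).abs = _
    rw [EReal.abs_def]
    rw [abs_of_nonneg (NNReal.coe_nonneg x), ENNReal.ofReal_coe_nnreal]

theorem aemeasurable_sub_ereal {α : Type*} [MeasurableSpace α] {ν : Measure α} {u v : α → EReal}
    (hu : AEMeasurable u ν) (hv : AEMeasurable v ν) : AEMeasurable (fun x => u x - v x) ν := by
  simp_rw [sub_eq_add_neg]
  exact hu.add (measurable_neg.comp_aemeasurable hv)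

theorem aemeasurable_limsup_ereal {α : Type*} [MeasurableSpace α] {ν : Measure α}
    {v : ℕ → α → EReal} (h : ∀ n, AEMeasurable (v n) ν) :
    AEMeasurable (fun x => limsup (fun n => v n x) atTop) ν := by
  refine ⟨fun x => limsup (fun n => (h n).mk _ x) atTop, Measurable.limsup fun n =>
    (h n).measurable_mk, ?_⟩
  filter_upwards [ae_all_iff.2 fun n => (h n).ae_eq_mk] with x hx
  simp only [hx]

theorem limsup_sub_coe (v : ℕ → EReal) (c : ℝ) :
    limsup (fun n => v n - c) atTop = limsup v atTop - c := by
  have hmono : Monotone fun x : EReal => x - c := fun a b hab => EReal.sub_le_sub hab le_rfl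
  have hcont : ContinuousAt (fun x : EReal => x - c) (limsup v atTop) := by
    have h1 : ContinuousAt (fun x : EReal × EReal => x.1 + x.2) (limsup v atTop, ((-c : ℝ) : EReal)) :=
      EReal.continuousAt_add (Or.inr (EReal.coe_ne_bot _)) (Or.inr (EReal.coe_ne_top _))
    have h2 : ContinuousAt (fun x : EReal => (x, ((-c : ℝ) : EReal))) (limsup v atTop) := by
      fun_prop
    have := ContinuousAt.comp (f := fun x : EReal => (x, ((-c : ℝ) : EReal))) h1 h2
    simpa [Function.comp_def, sub_eq_add_neg] using this
  exact (hmono.map_limsup_of_continuousAt v hcont).symm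

/-! ### Maz'ya's inequality on the whole space -/

section Mazya

variable {X : Type*} [MetricSpace X] [MeasurableSpace X] [BorelSpace X]
  [SecondCountableTopology X] {p : ℝ} {μ : Measure X}

/-- Maz'ya's inequality on the whole space, for a suitable weighted measure. -/
theorem exists_weighted_mazya (hp : 1 < p) (hp0 : 0 < p) (hPI : SupportsPoincare p p μ)
    (hμ : ∀ (x : X) (r : ℝ), 0 < r → 0 < μ (Metric.ball x r) ∧ μ (Metric.ball x r) < ∞)
    (hμ0 : μ ≠ 0) (z : X) {S : Set X} (hS : capacity p μ S ≠ 0) :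
    ∃ (ω : Measure X) (C : ℝ≥0∞), ω ≪ μ ∧ μ ≪ ω ∧ C ≠ ∞ ∧
      ∀ (F : X → EReal) (g : X → ℝ≥0∞), AEMeasurable F μ →
      (∀ x ∈ S, F x = 0) → WeakGrad hp0 μ g F → ∫⁻ x, g x ^ p ∂μ ≠ ∞ →
      ∫⁻ x, (F x).abs ^ p ∂ω ≤ C * ∫⁻ x, g x ^ p ∂μ := by
  -- Some ball already meets `S` in positive capacity, since countable unions of sets of capacity
  -- zero have capacity zero; all larger balls inherit this.
  obtain ⟨k₀, hk₀⟩ : ∃ k : ℕ, capacity p μ (S ∩ Metric.ball z k) ≠ 0 := by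
    by_contra! h
    have h1 := capacity_iUnion_eq_zero hp0 hμ0 h
    rw [← inter_iUnion, Metric.iUnion_ball_nat, inter_univ] at h1
    exact hS h1
  have hpos : ∀ k : ℕ, (0 : ℝ) < k₀ + 1 + k := fun k => by positivity
  have hcap : ∀ k : ℕ, capacity p μ (S ∩ Metric.ball z (k₀ + 1 + k)) ≠ 0 := fun k h =>
    hk₀ (le_antisymm ((capacity_mono (inter_subset_inter_right _ (Metric.ball_subset_ball (by
      have : (0 : ℝ) ≤ k := Nat.cast_nonneg k
      linarith)))).trans h.le) zero_le)
  choose C hC hmaz using fun k => exists_mazya hp hp0 hPI hμ z (hpos k) (hcap k)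
  -- These weights make the local constants sum to at most 2, and their positivity makes the
  -- weighted measure equivalent to `μ`.
  let w : ℕ → ℝ≥0∞ := fun k => 2⁻¹ ^ k / (C k + 1)
  have hw0 : ∀ k, w k ≠ 0 := fun k =>
    ENNReal.div_ne_zero.2 ⟨(ENNReal.pow_pos (by simp) k).ne', by simp [hC k]⟩
  have hwC : ∀ k, w k * C k ≤ 2⁻¹ ^ k := fun k => by
    calc w k * C k ≤ 2⁻¹ ^ k / (C k + 1) * (C k + 1) := by gcongr; exact le_self_add
      _ = 2⁻¹ ^ k := ENNReal.div_mul_cancel (by simp) (by simp [hC k])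
  have hiff : ∀ P : X → Prop, (∀ᵐ x ∂Measure.sum (fun k : ℕ => w k •
      μ.restrict (Metric.ball z (k₀ + 1 + k))), P x) ↔ ∀ᵐ x ∂μ, P x := by
    intro P
    have hcov : ⋃ k : ℕ, Metric.ball z ((k₀ : ℝ) + 1 + k) = univ := by
      rw [eq_univ_iff_forall]
      intro x
      obtain ⟨n, hn⟩ := exists_nat_gt (dist x z)
      refine mem_iUnion.2 ⟨n, ?_⟩
      rw [Metric.mem_ball]
      have : (0 : ℝ) ≤ k₀ := Nat.cast_nonneg k₀
      linarith
    have hres := ae_restrict_iUnion_iff (μ := μ) (fun k : ℕ => Metric.ball z ((k₀ : ℝ) + 1 + k)) P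
    rw [hcov, Measure.restrict_univ] at hres
    rw [Measure.ae_sum_iff, hres]
    exact forall_congr' fun k => Measure.ae_ennreal_smul_measure_iff (hw0 k)
  refine ⟨Measure.sum (fun k : ℕ => w k • μ.restrict (Metric.ball z (k₀ + 1 + k))), 2,
    fun s hs => ?_, fun s hs => ?_, by simp, fun F g hF hFS hg hgfin => ?_⟩
  · rw [measure_eq_zero_iff_ae_notMem] at hs ⊢
    exact (hiff _).2 hs
  · rw [measure_eq_zero_iff_ae_notMem] at hs ⊢
    exact (hiff _).1 hs
  · rw [lintegral_sum_measure]
    calc ∑' k, ∫⁻ x, (F x).abs ^ p ∂(w k • μ.restrict (Metric.ball z (k₀ + 1 + k)))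
        ≤ ∑' k : ℕ, 2⁻¹ ^ k * ∫⁻ x, g x ^ p ∂μ := by
          refine ENNReal.tsum_le_tsum fun k => ?_
          rw [lintegral_smul_measure, smul_eq_mul]
          refine (mul_le_mul_right (hmaz k F g hF hFS hg hgfin) _).trans ?_
          rw [← mul_assoc]
          exact mul_le_mul_left (hwC k) _
      _ = 2 * ∫⁻ x, g x ^ p ∂μ := by
          rw [ENNReal.tsum_mul_right, ENNReal.tsum_geometric, ENNReal.one_sub_inv_two, inv_inv]

end Mazya

/-! ### The admissible class -/

section Admissible

variable {X : Type*} [MetricSpace X] [MeasurableSpace X] [BorelSpace X]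
  [SecondCountableTopology X] {p : ℝ} {μ : Measure X} {hp : 0 < p} {V : Set X}

theorem QEOn.of_forall_nat (hp : 0 < p) (hμ : μ ≠ 0) {P : ℕ → V → Prop} {Q : V → Prop}
    (h : ∀ n, QEOn p μ V (P n)) (hPQ : ∀ x, (∀ n, P n x) → Q x) : QEOn p μ V Q := by
  have h1 := capacity_iUnion_eq_zero hp hμ h
  refine le_antisymm ((capacity_mono ?_).trans h1.le) zero_le
  rintro _ ⟨x, hx, rfl⟩
  by_contra hx'
  refine hx (hPQ x fun n => ?_)
  by_contra hn
  exact hx' (mem_iUnion.2 ⟨n, x, hn, rfl⟩)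

theorem QEOn.and_imp (hp : 0 < p) (hμ : μ ≠ 0) {P₁ P₂ Q : V → Prop} (h₁ : QEOn p μ V P₁)
    (h₂ : QEOn p μ V P₂) (hPQ : ∀ x, P₁ x → P₂ x → Q x) : QEOn p μ V Q :=
  QEOn.of_forall_nat (P := fun n => if n = 0 then P₁ else P₂) hp hμ
    (fun n => by by_cases hn : n = 0 <;> simp [hn, h₁, h₂])
    fun x hx => hPQ x (by simpa using hx 0) (by simpa using hx 1)

theorem memDirichletZero_iff {h : V → EReal} :
    MemDirichletZero p μ V h ↔ MemDirichlet p μ (extZero V h) := by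
  constructor
  · rintro ⟨F, h1, h2, h3⟩
    convert h1 using 1
    funext x
    by_cases hx : x ∈ V
    · rw [extZero_of_mem _ hx, ← h3]
    · rw [extZero_of_notMem _ hx, h2 x hx]
  · exact fun h1 => ⟨_, h1, fun x hx => extZero_of_notMem _ hx, fun x => extZero_coe _ x⟩

theorem abs_sub_sub_sub_le (a b a' b' : ℝ) :
    (((a : EReal) - b) - ((a' : EReal) - b')).abs ≤
      1 * (ENNReal.ofReal |a - a'| + ENNReal.ofReal |b - b'|) := by
  rw [← EReal.coe_sub, ← EReal.coe_sub, abs_coe_sub_coe, one_mul, ← ENNReal.ofReal_add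
    (abs_nonneg _) (abs_nonneg _)]
  refine ENNReal.ofReal_le_ofReal ?_
  rw [show a - b - (a' - b') = (a - a') - (b - b') by ring]
  exact abs_sub _ _

/-- A Dirichlet function dominated by the sum of two functions with zero boundary values. -/
theorem WeakGrad.zeroExtension_of_le (hV : MeasurableSet V) (hp1 : 1 ≤ p) {h₁ h₂ U : V → EReal}
    (H₁ : MemDirichletZero p μ V h₁) (H₂ : MemDirichletZero p μ V h₂) {G : V → ℝ≥0∞}
    (hU : WeakGrad hp (μ.comap (↑)) G U) (hle : ∀ x, (U x).abs ≤ (h₁ x).abs + (h₂ x).abs) :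
    WeakGrad hp μ (extZero V G) (extZero V U) := by
  rw [memDirichletZero_iff, memDirichlet_iff hp] at H₁ H₂
  obtain ⟨-, g₁, w₁, f₁⟩ := H₁
  obtain ⟨-, g₂, w₂, f₂⟩ := H₂
  have hW := w₁.comp₂_add w₂ f₁ f₂ (Φ := fun a b => ((a.abs + b.abs : ℝ≥0∞) : EReal)) (c := 1) (by
    intro a b a' b'
    simp only [EReal.coe_ennreal_add, EReal.coe_abs]
    rw [← EReal.coe_add, ← EReal.coe_add, abs_coe_sub_coe, one_mul, ← ENNReal.ofReal_add
      (abs_nonneg _) (abs_nonneg _)]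
    refine ENNReal.ofReal_le_ofReal ?_
    rw [show |a| + |b| - (|a'| + |b'|) = (|a| - |a'|) + (|b| - |b'|) by ring]
    exact (abs_add_le _ _).trans (add_le_add (abs_abs_sub_abs_le _ _) (abs_abs_sub_abs_le _ _)))
  refine hU.zeroExtension hV hW ?_ (fun x hx => ?_) fun x => ?_
  · simp only [one_mul]
    exact (lintegral_add_rpow_ne_top hp1 w₁.1 f₁ f₂).2
  · simp [extZero_of_notMem _ hx]
  · rw [abs_coe_ennreal]
    simpa using hle x

theorem WeakGrad.sub (hp1 : 1 ≤ p) {v f : V → EReal} {G e : V → ℝ≥0∞} {ν : Measure V}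
    (hv : WeakGrad hp ν G v) (hG : ∫⁻ x, G x ^ p ∂ν ≠ ∞)
    (hf : WeakGrad hp ν e f) (he : ∫⁻ x, e x ^ p ∂ν ≠ ∞) :
    WeakGrad hp ν (fun x => G x + e x) (fun x => v x - f x) ∧
      ∫⁻ x, (G x + e x) ^ p ∂ν ≠ ∞ := by
  have h := hv.comp₂_add hf hG he (Φ := fun a b => a - b) abs_sub_sub_sub_le
  simp only [one_mul] at h
  exact ⟨h, (lintegral_add_rpow_ne_top hp1 hv.1 hG he).2⟩

theorem lintegral_extZero_ne_top (hp : 0 < p) (hV : MeasurableSet V) {G : V → ℝ≥0∞}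
    (h : ∫⁻ x, G x ^ p ∂μ.comap ((↑) : V → X) ≠ ∞) : ∫⁻ x, extZero V G x ^ p ∂μ ≠ ∞ := by
  rwa [lintegral_extZero hp hV]

variable {ψ f : V → EReal}

/-- Only the zero boundary values need an argument: `v - f` is dominated by two functions whose zero
extensions are Dirichlet functions. -/
theorem mem_admissible_of_le (hp : 0 < p) (hp1 : 1 ≤ p) (hμ : μ ≠ 0) (hV : MeasurableSet V)
    (hf : MemDirichlet p (μ.comap ((↑) : V → X)) f) {v₁ v₂ v : V → EReal}
    (h₁ : v₁ ∈ admissible p μ V ψ f) (h₂ : v₂ ∈ admissible p μ V ψ f)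
    (hv : MemDirichlet p (μ.comap ((↑) : V → X)) v)
    (hle : ∀ x, (v x - f x).abs ≤ (v₁ x - f x).abs + (v₂ x - f x).abs)
    (hψ : ∀ x, ψ x ≤ v₁ x → ψ x ≤ v₂ x → ψ x ≤ v x) : v ∈ admissible p μ V ψ f := by
  obtain ⟨mv, G, wv, fv⟩ := (memDirichlet_iff hp).1 hv
  obtain ⟨mf, e, wf, ff⟩ := (memDirichlet_iff hp).1 hf
  refine ⟨hv, memDirichletZero_iff.2 ((memDirichlet_iff hp).2 ⟨aemeasurable_extZero hV
    (aemeasurable_sub_ereal mv mf), extZero V fun x => G x + e x, ?_, ?_⟩),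
    h₁.2.2.and_imp hp hμ h₂.2.2 hψ⟩
  · exact (wv.sub hp1 fv wf ff).1.zeroExtension_of_le hV hp1 h₁.2.1 h₂.2.1 hle
  · exact lintegral_extZero_ne_top hp hV (wv.sub hp1 fv wf ff).2

/-- The midpoint of two extended reals. -/
def mid (a b : EReal) : EReal := ((1 / 2 : ℝ) : EReal) * (a + b)

theorem mid_coe (a b : ℝ) : mid a b = ((a + b) / 2 : ℝ) := by
  rw [mid, ← EReal.coe_add, ← EReal.coe_mul]
  congr 1
  ring

theorem mid_self (a : EReal) : mid a a = a := by
  induction a with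
  | bot => simp [mid, EReal.coe_mul_bot_of_pos]
  | top => simp [mid, EReal.coe_mul_top_of_pos]
  | coe x => rw [mid_coe, add_self_div_two]

theorem le_mid {c a b : EReal} (ha : c ≤ a) (hb : c ≤ b) : c ≤ mid a b := by
  rw [← mid_self c]
  refine mul_le_mul_of_nonneg_left (add_le_add ha hb) ?_
  exact_mod_cast (by norm_num : (0 : ℝ) ≤ 1 / 2)

theorem exists_real_mid_sub {v₁ v₂ f : EReal} (h₁ : (v₁ - f).abs ≠ ∞) (h₂ : (v₂ - f).abs ≠ ∞) :
    ∃ a b : ℝ, v₁ - f = a ∧ v₂ - f = b ∧ (v₁ - f) - (v₂ - f) = (a - b : ℝ) ∧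
      mid v₁ v₂ - f = ((a + b) / 2 : ℝ) := by
  obtain ⟨x, z, rfl, rfl⟩ := exists_real_of_abs_sub_ne_top h₁
  obtain ⟨y, z', rfl, hz⟩ := exists_real_of_abs_sub_ne_top h₂
  refine ⟨x - z, y - z, (EReal.coe_sub _ _).symm, (EReal.coe_sub _ _).symm, ?_, ?_⟩
  · simp only [EReal.coe_sub]
  · rw [mid_coe, ← EReal.coe_sub]
    congr 1
    ring

theorem abs_mid_sub_le (v₁ v₂ f : EReal) :
    (mid v₁ v₂ - f).abs ≤ (v₁ - f).abs + (v₂ - f).abs := by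
  by_cases h₁ : (v₁ - f).abs = ∞
  · simp [h₁]
  by_cases h₂ : (v₂ - f).abs = ∞
  · simp [h₂]
  obtain ⟨a, b, e₁, e₂, -, e₃⟩ := exists_real_mid_sub h₁ h₂
  rw [e₁, e₂, e₃, EReal.abs_def, EReal.abs_def, EReal.abs_def, ← ENNReal.ofReal_add (abs_nonneg _)
    (abs_nonneg _)]
  refine ENNReal.ofReal_le_ofReal ?_
  rw [abs_div, abs_two]
  linarith [abs_add_le a b, abs_nonneg a, abs_nonneg b]

theorem WeakGrad.mid {Y : Type*} [MetricSpace Y] [MeasurableSpace Y] [BorelSpace Y]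
    {ν : Measure Y} {v₁ v₂ : Y → EReal} {G₁ G₂ : Y → ℝ≥0∞}
    (w₁ : WeakGrad hp ν G₁ v₁) (w₂ : WeakGrad hp ν G₂ v₂)
    (f₁ : ∫⁻ x, G₁ x ^ p ∂ν ≠ ∞) (f₂ : ∫⁻ x, G₂ x ^ p ∂ν ≠ ∞) :
    WeakGrad hp ν (fun x => 2⁻¹ * (G₁ x + G₂ x)) (fun x => ObstacleProblem.mid (v₁ x) (v₂ x)) := by
  refine w₁.comp₂_add w₂ f₁ f₂ (Φ := ObstacleProblem.mid) (c := 2⁻¹) fun a b a' b' => ?_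
  rw [mid_coe, mid_coe, abs_coe_sub_coe, ← ENNReal.ofReal_add (abs_nonneg _) (abs_nonneg _),
    show (2⁻¹ : ℝ≥0∞) = ENNReal.ofReal (1 / 2) by
      rw [one_div, ENNReal.ofReal_inv_of_pos two_pos, ENNReal.ofReal_ofNat],
    ← ENNReal.ofReal_mul (by norm_num)]
  refine ENNReal.ofReal_le_ofReal ?_
  rw [show (a + b) / 2 - (a' + b') / 2 = 1 / 2 * ((a - a') + (b - b')) by ring, abs_mul,
    abs_of_pos (by norm_num : (0 : ℝ) < 1 / 2)]
  gcongr
  exact abs_add_le _ _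

theorem lintegral_mid_rpow_le {α : Type*} [MeasurableSpace α] {ν : Measure α} (hp1 : 1 ≤ p)
    {G₁ : α → ℝ≥0∞} (G₂ : α → ℝ≥0∞) (m₁ : Measurable G₁) {T : ℝ≥0∞}
    (h₁ : ∫⁻ x, G₁ x ^ p ∂ν ≤ T) (h₂ : ∫⁻ x, G₂ x ^ p ∂ν ≤ T) :
    ∫⁻ x, (2⁻¹ * (G₁ x + G₂ x)) ^ p ∂ν ≤ T := by
  calc ∫⁻ x, (2⁻¹ * (G₁ x + G₂ x)) ^ p ∂ν
      ≤ ∫⁻ x, 2⁻¹ * (G₁ x ^ p + G₂ x ^ p) ∂ν := by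
        refine lintegral_mono fun x => ?_
        have := ENNReal.rpow_arith_mean_le_arith_mean2_rpow 2⁻¹ 2⁻¹ (G₁ x) (G₂ x)
          (ENNReal.inv_two_add_inv_two) hp1
        rwa [← mul_add, ← mul_add] at this
    _ = 2⁻¹ * (∫⁻ x, G₁ x ^ p ∂ν + ∫⁻ x, G₂ x ^ p ∂ν) := by
        rw [lintegral_const_mul' _ _ (by simp), lintegral_add_left (m₁.pow_const p)]
    _ ≤ 2⁻¹ * (T + T) := by gcongr
    _ = T := by
        rw [mul_add, ← add_mul, ENNReal.inv_two_add_inv_two, one_mul]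

theorem mid_mem_admissible (hp : 0 < p) (hp1 : 1 ≤ p) (hμ : μ ≠ 0) (hV : MeasurableSet V)
    (hf : MemDirichlet p (μ.comap ((↑) : V → X)) f) {v₁ v₂ : V → EReal}
    (h₁ : v₁ ∈ admissible p μ V ψ f) (h₂ : v₂ ∈ admissible p μ V ψ f) :
    (fun x => mid (v₁ x) (v₂ x)) ∈ admissible p μ V ψ f := by
  obtain ⟨m₁, G₁, w₁, f₁⟩ := (memDirichlet_iff hp).1 h₁.1
  obtain ⟨m₂, G₂, w₂, f₂⟩ := (memDirichlet_iff hp).1 h₂.1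
  refine mem_admissible_of_le hp hp1 hμ hV hf h₁ h₂ ((memDirichlet_iff hp).2
    ⟨(m₁.add m₂).const_mul _, _, w₁.mid w₂ f₁ f₂, ?_⟩) (fun _ => abs_mid_sub_le _ _ _)
    fun _ => le_mid
  exact ne_top_of_le_ne_top (ENNReal.add_ne_top.2 ⟨f₁, f₂⟩)
    (lintegral_mid_rpow_le hp1 G₂ w₁.1 le_self_add le_add_self)

theorem abs_max_min_sub_le (c : ℝ) (a b f : EReal) :
    (max a (min b c) - f).abs ≤ (a - f).abs + (b - f).abs := by
  by_cases h₁ : (a - f).abs = ∞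
  · simp [h₁]
  by_cases h₂ : (b - f).abs = ∞
  · simp [h₂]
  obtain ⟨x, z, rfl, rfl⟩ := exists_real_of_abs_sub_ne_top h₁
  obtain ⟨y, z', rfl, hz⟩ := exists_real_of_abs_sub_ne_top h₂
  rw [← coe_min_ereal, ← coe_max_ereal, abs_coe_sub_coe, abs_coe_sub_coe, abs_coe_sub_coe,
    ← ENNReal.ofReal_add (abs_nonneg _) (abs_nonneg _)]
  refine ENNReal.ofReal_le_ofReal (abs_le.2 ⟨?_, ?_⟩)
  · have h1 : x ≤ max x (min y c) := le_max_left _ _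
    linarith [neg_abs_le (x - z), abs_nonneg (y - z)]
  · have h1 : max x (min y c) ≤ z + (|x - z| + |y - z|) :=
      max_le (by linarith [le_abs_self (x - z), abs_nonneg (y - z)])
        ((min_le_left _ _).trans (by linarith [le_abs_self (y - z), abs_nonneg (x - z)]))
    linarith

theorem WeakGrad.max_min {Y : Type*} [MetricSpace Y] [MeasurableSpace Y] [BorelSpace Y]
    {ν : Measure Y} {v₁ v₂ : Y → EReal} {G : Y → ℝ≥0∞} (w₁ : WeakGrad hp ν G v₁)
    (w₂ : WeakGrad hp ν G v₂) (f : ∫⁻ x, G x ^ p ∂ν ≠ ∞) (c : ℝ) :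
    WeakGrad hp ν G (fun x => max (v₁ x) (min (v₂ x) c)) := by
  refine w₁.comp₂_max w₂ f (Φ := fun a b => max a (min b c)) fun a b a' b' => ?_
  rw [← coe_min_ereal, ← coe_max_ereal, ← coe_min_ereal, ← coe_max_ereal, abs_coe_sub_coe,
    ← ENNReal.ofReal_max]
  refine ENNReal.ofReal_le_ofReal ((abs_max_sub_max_le_max _ _ _ _).trans (max_le_max le_rfl ?_))
  refine (abs_min_sub_min_le_max _ _ _ _).trans ?_
  simp

/-- The competitor for uniqueness. It lies between `v₁` and max(v₁, v₂), so it respects the obstacle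
and is no farther from `f` than the two given functions. -/
theorem max_min_mem_admissible (hp : 0 < p) (hp1 : 1 ≤ p) (hμ : μ ≠ 0) (hV : MeasurableSet V)
    (hf : MemDirichlet p (μ.comap ((↑) : V → X)) f) {v₁ v₂ : V → EReal}
    (h₁ : v₁ ∈ admissible p μ V ψ f) (h₂ : v₂ ∈ admissible p μ V ψ f) {G : V → ℝ≥0∞}
    (w₁ : WeakGrad hp (μ.comap (↑)) G v₁) (w₂ : WeakGrad hp (μ.comap (↑)) G v₂)
    (hG : ∫⁻ x, G x ^ p ∂μ.comap ((↑) : V → X) ≠ ∞) (c : ℝ) :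
    (fun x => max (v₁ x) (min (v₂ x) c)) ∈ admissible p μ V ψ f :=
  mem_admissible_of_le hp hp1 hμ hV hf h₁ h₂ ((memDirichlet_iff hp).2
    ⟨h₁.1.1.max (h₂.1.1.min aemeasurable_const), G, w₁.max_min w₂ hG c, hG⟩)
    (fun _ => abs_max_min_sub_le c _ _ _) fun _ h _ => le_max_of_le_left h

end Admissible

theorem tendsto_nat_add_one_inv : Tendsto (fun n : ℕ => (n + 1 : ℝ≥0∞)⁻¹) atTop (𝓝 0) := by
  have := (tendsto_add_atTop_iff_nat 1).2 ENNReal.tendsto_inv_nat_nhds_zero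
  simpa using this

theorem exists_real_ennreal_mid {A B : ℝ≥0∞} (hA : A ≠ ∞) (hB : B ≠ ∞) :
    ∃ a b : ℝ, A = ENNReal.ofReal |a| ∧ B = ENNReal.ofReal |b| ∧
      A - B ≤ ENNReal.ofReal |a - b| ∧ 2⁻¹ * (A + B) ≤ ENNReal.ofReal |(a + b) / 2| := by
  have ha : 0 ≤ A.toReal := ENNReal.toReal_nonneg
  have hb : 0 ≤ B.toReal := ENNReal.toReal_nonneg
  refine ⟨A.toReal, B.toReal, ?_, ?_, ?_, ?_⟩
  · rw [abs_of_nonneg ha, ENNReal.ofReal_toReal hA]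
  · rw [abs_of_nonneg hb, ENNReal.ofReal_toReal hB]
  · calc A - B = ENNReal.ofReal (A.toReal - B.toReal) := by
          rw [ENNReal.ofReal_sub _ hb, ENNReal.ofReal_toReal hA, ENNReal.ofReal_toReal hB]
      _ ≤ _ := ENNReal.ofReal_le_ofReal (le_abs_self _)
  · rw [abs_of_nonneg (by positivity), ENNReal.ofReal_div_of_pos two_pos, ENNReal.ofReal_add ha hb,
      ENNReal.ofReal_toReal hA, ENNReal.ofReal_toReal hB, ENNReal.ofReal_ofNat, mul_comm,
      ← div_eq_mul_inv]

theorem lintegral_liminf_rpow_le {α : Type*} [MeasurableSpace α] {ν : Measure α} {p : ℝ}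
    (hp : 0 < p) {H : ℕ → α → ℝ≥0∞} (hH : ∀ n, Measurable (H n)) {I : ℝ≥0∞} {e : ℕ → ℝ≥0∞}
    (he : Tendsto e atTop (𝓝 0)) (hle : ∀ n, ∫⁻ x, H n x ^ p ∂ν ≤ I + e n) :
    ∫⁻ x, (liminf (fun n => H n x) atTop) ^ p ∂ν ≤ I := by
  have h1 : ∀ x, (liminf (fun n => H n x) atTop) ^ p = liminf (fun n => H n x ^ p) atTop :=
    fun x => (ENNReal.orderIsoRpow p hp).liminf_apply
  simp only [h1]
  refine (lintegral_liminf_le fun n => (hH n).pow_const p).trans ?_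
  have h2 : Tendsto (fun n => I + e n) atTop (𝓝 I) := by simpa using he.const_add I
  rw [← h2.liminf_eq]
  exact liminf_le_liminf (Eventually.of_forall hle)

/-! ### Existence of solutions -/

section Obstacle

variable {X : Type*} [MetricSpace X] [MeasurableSpace X] [BorelSpace X]
  [SecondCountableTopology X] {p : ℝ} {μ : Measure X} {V : Set X} {ψ f : V → EReal}

theorem weakGrad_extZero_sub {hp : 0 < p} (hp1 : 1 ≤ p) (hV : MeasurableSet V) {v : V → EReal}
    (h : MemDirichletZero p μ V fun x => v x - f x) {G e : V → ℝ≥0∞}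
    (hv : WeakGrad hp (μ.comap (↑)) G v) (hG : ∫⁻ x, G x ^ p ∂μ.comap ((↑) : V → X) ≠ ∞)
    (hf : WeakGrad hp (μ.comap (↑)) e f) (he : ∫⁻ x, e x ^ p ∂μ.comap ((↑) : V → X) ≠ ∞) :
    WeakGrad hp μ (extZero V fun x => G x + e x) (extZero V fun x => v x - f x) :=
  (hv.sub hp1 hG hf he).1.zeroExtension_of_le hV hp1 h h fun _ => le_self_add

/-- The pointwise upper limit of admissible functions that are bounded almost everywhere relative to
`f` and whose gradients converge rapidly is admissible. -/
theorem limsup_mem_admissible (hp : 0 < p) (hp1 : 1 ≤ p) (hμ : μ ≠ 0) (hV : MeasurableSet V)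
    (hf : MemDirichlet p (μ.comap ((↑) : V → X)) f) {w : ℕ → V → EReal}
    (hw : ∀ n, w n ∈ admissible p μ V ψ f) {H : ℕ → V → ℝ≥0∞} {G s : V → ℝ≥0∞} {c : ℕ → ℝ≥0∞}
    (hH : ∀ n, WeakGrad hp (μ.comap (↑)) (H n) (w n))
    (hHfin : ∀ n, ∫⁻ x, H n x ^ p ∂μ.comap ((↑) : V → X) ≠ ∞)
    (hG : Measurable G) (hGfin : ∫⁻ x, G x ^ p ∂μ.comap ((↑) : V → X) ≠ ∞)
    (hs : Measurable s) (hsfin : ∫⁻ x, s x ^ p ∂μ.comap ((↑) : V → X) ≠ ∞)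
    (hc : Tendsto c atTop (𝓝 0)) (hle : ∀ n x, H n x ≤ G x + c n * s x)
    (hbdd : ∀ᵐ x ∂μ, ∃ M : ℝ≥0, ∀ n, (extZero V (fun x => w n x - f x) x).abs ≤ M) :
    (fun x => limsup (fun n => w n x) atTop) ∈ admissible p μ V ψ f ∧
      WeakGrad hp (μ.comap (↑)) G (fun x => limsup (fun n => w n x) atTop) := by
  obtain ⟨mf, e, wf, ff⟩ := (memDirichlet_iff hp).1 hf
  have hwW := fun n => weakGrad_extZero_sub hp1 hV (hw n).2.1 (hH n) (hHfin n) wf ff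
  have hGe := (lintegral_add_rpow_ne_top hp1 hG hGfin ff).2
  have hbddV : ∀ᵐ x ∂μ.comap ((↑) : V → X), ∃ M : ℝ≥0, ∀ n, (w n x).abs ≤ M := by
    have h1 : ∀ᵐ x : V ∂μ.comap (↑), ∃ M : ℝ≥0, ∀ n,
        (extZero V (fun x => w n x - f x) x).abs ≤ M :=
      (ae_comap_iff hV (P := fun x => ∃ M : ℝ≥0, ∀ n,
        (extZero V (fun x => w n x - f x) x).abs ≤ M)).2 (ae_restrict_of_ae hbdd)
    filter_upwards [h1] with x ⟨M, hM⟩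
    simp only [extZero_coe] at hM
    have h2 : (f x).abs ≠ ∞ := by
      obtain ⟨a, b, -, hb⟩ := exists_real_of_abs_sub_ne_top
        (ne_top_of_le_ne_top ENNReal.coe_ne_top (hM 0))
      rw [hb]
      exact (EReal.abs_coe_lt_top b).ne
    refine ⟨M + (f x).abs.toNNReal, fun n => ?_⟩
    rw [ENNReal.coe_add, ENNReal.coe_toNNReal h2]
    exact (abs_le_abs_sub_add_ereal _ (f x)).trans (add_le_add (hM n) le_rfl)
  have hlimV := weakGrad_limsup hH hG hGfin hs hsfin hc hle hbddV
  -- Zero boundary values are a statement on `X`, so the upper limit is taken again for the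
  -- differences extended by zero.
  have hlimX := weakGrad_limsup hwW (G := extZero V fun x => G x + e x) (s := extZero V s) (c := c)
    (measurable_extZero hV (hG.add wf.1)) (lintegral_extZero_ne_top hp hV hGe)
    (measurable_extZero hV hs) (lintegral_extZero_ne_top hp hV hsfin) hc (fun n x => by
      by_cases hx : x ∈ V
      · simp only [extZero_of_mem _ hx]
        calc H n ⟨x, hx⟩ + e ⟨x, hx⟩ ≤ (G ⟨x, hx⟩ + c n * s ⟨x, hx⟩) + e ⟨x, hx⟩ := by
              gcongr
              exact hle n _
          _ = _ := by ring
      · simp [extZero_of_notMem _ hx]) hbdd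
  have hmv : AEMeasurable (fun x => limsup (fun n => w n x) atTop) (μ.comap ((↑) : V → X)) :=
    aemeasurable_limsup_ereal fun n => (hw n).1.1
  -- Subtracting `f` commutes with the upper limit only where `f` is real. That holds along almost
  -- every curve, because `w 0 - f` extended by zero is real there.
  have hlimF : WeakGrad hp μ (extZero V fun x => G x + e x)
      (extZero V fun x => limsup (fun n => w n x) atTop - f x) := by
    refine hlimX.congr ?_
    filter_upwards [(hwW 0).eventually_real (lintegral_extZero_ne_top hp hV
      (lintegral_add_rpow_ne_top hp1 (hH 0).1 (hHfin 0) ff).2)] with γ ⟨k, hk, _⟩ t ht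
    by_cases hx : γ.toFun t ∈ V
    · have h1 := hk t ht
      simp only [extZero_of_mem _ hx] at h1 ⊢
      obtain ⟨a, b, -, hb⟩ := exists_real_of_abs_sub_ne_top (a := w 0 ⟨_, hx⟩) (b := f ⟨_, hx⟩)
        (by rw [h1]; exact (EReal.abs_coe_lt_top _).ne)
      rw [hb]
      exact limsup_sub_coe _ b
    · simp [extZero_of_notMem _ hx]
  refine ⟨⟨(memDirichlet_iff hp).2 ⟨hmv, G, hlimV, hGfin⟩, memDirichletZero_iff.2
    ((memDirichlet_iff hp).2 ⟨aemeasurable_extZero hV (aemeasurable_sub_ereal hmv mf), _, hlimF,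
      lintegral_extZero_ne_top hp hV hGe⟩),
    QEOn.of_forall_nat hp hμ (fun n => (hw n).2.2) fun x hx => ?_⟩, hlimV⟩
  exact le_limsup_of_frequently_le (Eventually.of_forall hx).frequently (by isBoundedDefault)

theorem exists_obstacleSolution (hp : 1 < p) (hPI : SupportsPoincare p p μ)
    (hμ : ∀ (x : X) (r : ℝ), 0 < r → 0 < μ (Metric.ball x r) ∧ μ (Metric.ball x r) < ∞)
    (hμ0 : μ ≠ 0) (z : X) (hV : MeasurableSet V) (hcap : capacity p μ Vᶜ ≠ 0)
    (hf : MemDirichlet p (μ.comap ((↑) : V → X)) f) (hK : (admissible p μ V ψ f).Nonempty) :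
    ∃ u, IsObstacleSolution p μ V ψ f u := by
  have hp0 : 0 < p := one_pos.trans hp
  set ν : Measure V := μ.comap (↑) with hν
  obtain ⟨ω, C, hωμ, hμω, hC, hmaz⟩ := exists_weighted_mazya hp hp0 hPI hμ hμ0 z hcap
  obtain ⟨mf, e, wf, ff⟩ := (memDirichlet_iff hp0).1 hf
  have hmin : ∀ v ∈ admissible p μ V ψ f, ∃ G, WeakGrad hp0 ν G v ∧
      energy p ν v = ∫⁻ x, G x ^ p ∂ν ∧ ∫⁻ x, G x ^ p ∂ν ≠ ∞ := by
    intro v hv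
    obtain ⟨-, g, w, fin⟩ := (memDirichlet_iff hp0).1 hv.1
    obtain ⟨G, h1, h2, h3, -⟩ := w.exists_minimal fin
    exact ⟨G, h1, h2, h3⟩
  let F : (V → EReal) → X → EReal := fun v => extZero V fun x => v x - f x
  have hFm : ∀ v ∈ admissible p μ V ψ f, AEMeasurable (F v) μ := fun v hv =>
    aemeasurable_extZero hV (aemeasurable_sub_ereal hv.1.1 mf)
  have hFabs : ∀ v ∈ admissible p μ V ψ f, AEMeasurable (fun x => (F v x).abs) ω := fun v hv =>
    (measurable_abs_ereal.comp_aemeasurable (hFm v hv)).mono_ac hωμ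
  let Φ : (V → EReal) → ℝ≥0∞ := fun v => ∫⁻ x, (F v x).abs ^ p ∂ω
  have h2p : (2 : ℝ≥0∞) ^ (p - 1) ≠ ∞ := ENNReal.rpow_ne_top_of_nonneg (by linarith) (by simp)
  have hΦ : ∀ v ∈ admissible p μ V ψ f,
      Φ v ≤ C * (2 ^ (p - 1) * (energy p ν v + ∫⁻ x, e x ^ p ∂ν)) := by
    intro v hv
    obtain ⟨G, w, h1, h2⟩ := hmin v hv
    have h3 := lintegral_add_rpow_ne_top hp.le w.1 h2 ff
    refine (hmaz _ _ (hFm v hv) (fun x hx => extZero_of_notMem _ hx)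
      (weakGrad_extZero_sub hp.le hV hv.2.1 w h2 wf ff)
      (lintegral_extZero_ne_top hp0 hV h3.2)).trans (mul_le_mul_right ?_ _)
    rw [lintegral_extZero hp0 hV, h1]
    exact h3.1
  set I : ℝ≥0∞ := ⨅ v ∈ admissible p μ V ψ f, energy p ν v with hI
  have hIle : ∀ v ∈ admissible p μ V ψ f, I ≤ energy p ν v := fun v hv => iInf₂_le v hv
  have hIfin : I ≠ ∞ := by
    obtain ⟨v, hv⟩ := hK
    obtain ⟨G, -, h1, h2⟩ := hmin v hv
    exact ne_top_of_le_ne_top (h1 ▸ h2) (hIle v hv)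
  let K : ℕ → Set (V → EReal) := fun n =>
    {v | v ∈ admissible p μ V ψ f ∧ energy p ν v ≤ I + (n + 1 : ℝ≥0∞)⁻¹}
  have hinv_mono : ∀ i j : ℕ, i ≤ j → (j + 1 : ℝ≥0∞)⁻¹ ≤ (i + 1 : ℝ≥0∞)⁻¹ := fun i j hij =>
    ENNReal.inv_le_inv.2 (by gcongr)
  have hKanti : ∀ i j : ℕ, i ≤ j → K j ⊆ K i := fun i j hij v hv =>
    ⟨hv.1, hv.2.trans (add_le_add le_rfl (hinv_mono i j hij))⟩
  have hKne : ∀ n, (K n).Nonempty := by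
    intro n
    have : I < I + (n + 1 : ℝ≥0∞)⁻¹ := ENNReal.lt_add_right hIfin (by simp)
    conv_lhs at this => rw [hI]
    simp only [iInf_lt_iff] at this
    obtain ⟨v, hv, h1⟩ := this
    exact ⟨v, hv, h1.le⟩
  -- The second minimization: `m n` increases to a finite limit, so midpoints of late
  -- almost-minimizers, which again lie in a sublevel class, cannot have a much smaller `Φ`.
  let m : ℕ → ℝ≥0∞ := fun n => ⨅ v ∈ K n, Φ v
  have hm_mono : Monotone m := fun i j hij => iInf_mono fun v => iInf_mono' fun hv =>
    ⟨hKanti i j hij hv, le_rfl⟩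
  set B : ℝ≥0∞ := C * (2 ^ (p - 1) * ((I + 1) + ∫⁻ x, e x ^ p ∂ν)) with hB
  have hBfin : B ≠ ∞ := by finiteness
  have hm_le : ∀ n, m n ≤ B := by
    intro n
    obtain ⟨v, hv⟩ := hKne n
    refine (iInf₂_le v hv).trans ((hΦ v hv.1).trans ?_)
    rw [hB]
    gcongr
    refine hv.2.trans (add_le_add le_rfl ?_)
    simp
  set mI : ℝ≥0∞ := ⨆ n, m n with hmI
  have hmIfin : mI ≠ ∞ := ne_top_of_le_ne_top hBfin (iSup_le hm_le)
  have hseq : ∀ n, ∃ v ∈ K n, Φ v ≤ m n + (n + 1 : ℝ≥0∞)⁻¹ := by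
    intro n
    have : m n < m n + (n + 1 : ℝ≥0∞)⁻¹ :=
      ENNReal.lt_add_right (ne_top_of_le_ne_top hBfin (hm_le n)) (by simp)
    have h1 : (⨅ v ∈ K n, Φ v) < m n + (n + 1 : ℝ≥0∞)⁻¹ := this
    simp only [iInf_lt_iff] at h1
    obtain ⟨v, hv, h1⟩ := h1
    exact ⟨v, hv, h1.le⟩
  choose v hvK hvΦ using hseq
  choose G wG eG fG using fun n => hmin (v n) (hvK n).1
  have hmid : ∀ N i j, N ≤ i → N ≤ j → (fun x => mid (v i x) (v j x)) ∈ K N := by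
    intro N i j hi hj
    refine ⟨mid_mem_admissible hp0 hp.le hμ0 hV hf (hvK i).1 (hvK j).1, ?_⟩
    refine ((wG i).mid (wG j) (fG i) (fG j)).energy_le.trans
      (lintegral_mid_rpow_le hp.le (G j) (wG i).1 ?_ ?_)
    · rw [← eG]; exact (hKanti N i hi (hvK i)).2
    · rw [← eG]; exact (hKanti N j hj (hvK j)).2
  have hcauchy : ∀ η : ℝ≥0∞, η ≠ 0 → ∃ N, ∀ i j, N ≤ i → N ≤ j →
      ∫⁻ x, (F (v i) x - F (v j) x).abs ^ p ∂ω ≤ η ∧ ∫⁻ x, (G i x - G j x) ^ p ∂ν ≤ η := by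
    intro η hη
    obtain ⟨δ₁, hδ₁, H₁⟩ := exists_uniform_convexity_integral ω hp hmIfin hη
    obtain ⟨δ₂, hδ₂, H₂⟩ := exists_uniform_convexity_integral ν hp hIfin hη
    have e1 : ∀ᶠ n : ℕ in atTop, (n + 1 : ℝ≥0∞)⁻¹ < δ₁ :=
      tendsto_nat_add_one_inv.eventually_lt_const (pos_iff_ne_zero.2 hδ₁)
    have e2 : ∀ᶠ n : ℕ in atTop, (n + 1 : ℝ≥0∞)⁻¹ < δ₂ :=
      tendsto_nat_add_one_inv.eventually_lt_const (pos_iff_ne_zero.2 hδ₂)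
    have e3 : ∀ᶠ n : ℕ in atTop, mI < m n + δ₁ :=
      ((tendsto_atTop_iSup hm_mono).add_const δ₁).eventually_const_lt
        (ENNReal.lt_add_right hmIfin hδ₁)
    obtain ⟨N, hN1, hN2, hN3⟩ := (e1.and (e2.and e3)).exists
    refine ⟨N, fun i j hi hj => ⟨?_, ?_⟩⟩
    · have hΦle : ∀ i, N ≤ i → Φ (v i) ≤ mI + δ₁ := fun i hi => (hvΦ i).trans
        (add_le_add (le_iSup m i) ((hinv_mono N i hi).trans hN1.le))
      refine H₁ (fun x => (F (v i) x).abs) (fun x => (F (v j) x).abs) _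
        (fun x => (F (fun x => mid (v i x) (v j x)) x).abs) (hFabs _ (hvK i).1)
        (hFabs _ (hmid N i j hi hj).1) (fun x hA hB => ?_) (hΦle i hi) (hΦle j hj) ?_
      · by_cases hx : x ∈ V
        · simp only [F, extZero_of_mem _ hx] at hA hB ⊢
          obtain ⟨a, b, e₁, e₂, e₃, e₄⟩ := exists_real_mid_sub hA hB
          refine ⟨a, b, by rw [e₁, EReal.abs_def], by rw [e₂, EReal.abs_def], ?_, ?_⟩
          · rw [e₃, EReal.abs_def]
          · rw [e₄, EReal.abs_def]
        · exact ⟨0, 0, by simp [F, extZero_of_notMem _ hx]⟩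
      · exact hN3.le.trans (add_le_add (iInf₂_le _ (hmid N i j hi hj)) le_rfl)
    · have hEle : ∀ i, N ≤ i → ∫⁻ x, G i x ^ p ∂ν ≤ I + δ₂ := fun i hi => by
        rw [← eG]
        exact (hKanti N i hi (hvK i)).2.trans (add_le_add le_rfl hN2.le)
      refine H₂ (G i) (G j) _ (fun x => 2⁻¹ * (G i x + G j x)) (wG i).1.aemeasurable
        (((wG i).1.add (wG j).1).const_mul _).aemeasurable
        (fun x hA hB => exists_real_ennreal_mid hA hB) (hEle i hi) (hEle j hj) ?_
      refine le_trans ?_ le_self_add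
      exact (hIle _ (hmid N i j hi hj).1).trans
        ((wG i).mid (wG j) (fG i) (fG j)).energy_le
  obtain ⟨φ, hφ, hφd⟩ := extraction_forall_of_eventually' (P := fun n k => ∀ i j, k ≤ i → k ≤ j →
      ∫⁻ x, (F (v i) x - F (v j) x).abs ^ p ∂ω ≤ ((2 : ℝ≥0∞) ^ n) ^ (-p) * 2⁻¹ ^ n ∧
      ∫⁻ x, (G i x - G j x) ^ p ∂ν ≤ ((2 : ℝ≥0∞) ^ n) ^ (-p) * 2⁻¹ ^ n) (fun n => by
    obtain ⟨N, hN⟩ := hcauchy _ (two_pow_rpow_mul_pos p n).ne'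
    exact ⟨N, fun k hk i j hi hj => hN i j (hk.trans hi) (hk.trans hj)⟩)
  have hφs : ∀ n, φ n ≤ φ (n + 1) := fun n => hφ.monotone n.le_succ
  have hwK : ∀ n, v (φ n) ∈ admissible p μ V ψ f := fun n => (hvK _).1
  -- The increments are so small that `2 ^ n` times the n-th one stays bounded a.e. for the weighted
  -- measure, hence for `μ`.
  have hbdd : ∀ᵐ x ∂μ, ∃ M : ℝ≥0, ∀ n, (F (v (φ n)) x).abs ≤ M := by
    refine hμω.ae_le ?_
    have hDm : ∀ n, AEMeasurable (fun x => (F (v (φ (n + 1))) x - F (v (φ n)) x).abs) ω := fun n =>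
      measurable_abs_ereal.comp_aemeasurable (aemeasurable_sub_ereal
        ((hFm _ (hwK (n + 1))).mono_ac hωμ) ((hFm _ (hwK n)).mono_ac hωμ))
    have hT := lintegral_iSup_two_pow_ne_top (ν := ω) hp0 (fun n => (hDm n).measurable_mk)
      fun n => by
        rw [← lintegral_congr_ae ((hDm n).ae_eq_mk.mono fun x hx => congrArg (· ^ p) hx)]
        exact (hφd n _ _ (hφs n) le_rfl).1
    have hTm : Measurable fun x => ⨆ n, 2 ^ n * (hDm n).mk _ x := Measurable.iSup fun n =>
      (hDm n).measurable_mk.const_mul _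
    have h0 : ∫⁻ x, (F (v (φ 0)) x).abs ^ p ∂ω ≠ ∞ :=
      ne_top_of_le_ne_top (by
        rw [eG]
        have := fG (φ 0)
        finiteness) (hΦ _ (hwK 0))
    filter_upwards [ae_lt_top (hTm.pow_const p) hT, ae_all_iff.2 fun n => (hDm n).ae_eq_mk,
      ae_lt_top' ((hFabs _ (hwK 0)).pow_const p) h0] with x h1 h2 h3
    have h4 := (ENNReal.rpow_lt_top_iff_of_pos hp0).1 h1
    have h5 := (ENNReal.rpow_lt_top_iff_of_pos hp0).1 h3
    have h6 : (F (v (φ 0)) x).abs + 2 * ⨆ n, 2 ^ n * (hDm n).mk _ x ≠ ∞ := by finiteness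
    refine ⟨((F (v (φ 0)) x).abs + 2 * ⨆ n, 2 ^ n * (hDm n).mk _ x).toNNReal, fun n => ?_⟩
    rw [ENNReal.coe_toNNReal h6]
    have h7 := abs_le_of_iSup (fun n => F (v (φ n)) x) n
    simp only [h2] at h7
    exact h7
  have hs := lintegral_iSup_two_pow_ne_top (ν := ν) hp0
    (fun n => (wG (φ n)).1.sub (wG (φ (n + 1))).1) fun n => (hφd n _ _ le_rfl (hφs n)).2
  have hGI := lintegral_liminf_rpow_le (ν := ν) hp0 (fun n => (wG (φ n)).1)
    (e := fun n => (φ n + 1 : ℝ≥0∞)⁻¹) (tendsto_nat_add_one_inv.comp hφ.tendsto_atTop)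
    (I := I) fun n => by rw [← eG]; exact (hvK (φ n)).2
  have hc : Tendsto (fun n : ℕ => 2 * (2⁻¹ : ℝ≥0∞) ^ n) atTop (𝓝 0) := by
    have := ENNReal.Tendsto.const_mul (a := 2) (ENNReal.tendsto_pow_atTop_nhds_zero_of_lt_one
      (show (2⁻¹ : ℝ≥0∞) < 1 by simp)) (Or.inr (by simp))
    simpa using this
  have hlim := limsup_mem_admissible hp0 hp.le hμ0 hV hf hwK (fun n => wG (φ n))
    (fun n => fG (φ n)) (Measurable.liminf fun n => (wG (φ n)).1) (ne_top_of_le_ne_top hIfin hGI)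
    (Measurable.iSup fun n => ((wG (φ n)).1.sub (wG (φ (n + 1))).1).const_mul _) hs hc
    (fun n x => le_liminf_add_of_iSup (fun n => G (φ n) x) n) hbdd
  exact ⟨_, hlim.1, fun u hu => (hlim.2.energy_le.trans hGI).trans (hIle u hu)⟩

/-! ### Uniqueness -/

/-- Uniform convexity applies with every tolerance, so the truncated difference has zero p-energy.
-/
theorem ae_eq_of_forall_mid_ge {α : Type*} [MeasurableSpace α] {ν : Measure α} (hp : 1 < p)
    {G₁ G₂ : α → ℝ≥0∞} (m₁ : Measurable G₁) (m₂ : Measurable G₂) {I : ℝ≥0∞} (hI : I ≠ ∞)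
    (h₁ : ∫⁻ x, G₁ x ^ p ∂ν = I) (h₂ : ∫⁻ x, G₂ x ^ p ∂ν = I)
    (hmid : I ≤ ∫⁻ x, (2⁻¹ * (G₁ x + G₂ x)) ^ p ∂ν) : G₁ ≤ᵐ[ν] G₂ := by
  have hp0 : 0 < p := one_pos.trans hp
  have h0 : ∫⁻ x, (G₁ x - G₂ x) ^ p ∂ν = 0 := by
    by_contra h
    obtain ⟨η, hη0, hη⟩ := exists_between (pos_iff_ne_zero.2 h)
    obtain ⟨δ, -, H⟩ := exists_uniform_convexity_integral ν hp hI hη0.ne'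
    refine absurd hη (not_lt.2 (H G₁ G₂ _ (fun x => 2⁻¹ * (G₁ x + G₂ x)) m₁.aemeasurable
      ((m₁.add m₂).const_mul _).aemeasurable (fun x hA hB => exists_real_ennreal_mid hA hB)
      ?_ ?_ ?_))
    · exact h₁.le.trans le_self_add
    · exact h₂.le.trans le_self_add
    · exact hmid.trans le_self_add
  replace h0 := (lintegral_eq_zero_iff (f := fun x => (G₁ x - G₂ x) ^ p)
    ((m₁.sub m₂).pow_const p)).1 h0
  filter_upwards [h0] with x hx
  exact tsub_eq_zero_iff_le.1 ((ENNReal.rpow_eq_zero_iff_of_pos hp0).1 hx)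

/-- The midpoint of two solutions is admissible, so half the sum of their minimal gradients has at
least the minimal energy. Strict convexity then compares the gradients, and the second one serves
both functions. -/
theorem IsObstacleSolution.exists_common_weakGrad (hp : 1 < p) (hp0 : 0 < p) (hμ0 : μ ≠ 0)
    (hV : MeasurableSet V) (hf : MemDirichlet p (μ.comap ((↑) : V → X)) f) {u₁ u₂ : V → EReal}
    (h₁ : IsObstacleSolution p μ V ψ f u₁) (h₂ : IsObstacleSolution p μ V ψ f u₂) :
    ∃ G, WeakGrad hp0 (μ.comap ((↑) : V → X)) G u₁ ∧ WeakGrad hp0 (μ.comap ((↑) : V → X)) G u₂ ∧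
      ∫⁻ x, G x ^ p ∂(μ.comap ((↑) : V → X)) ≠ ∞ ∧
      ∀ v ∈ admissible p μ V ψ f, ∫⁻ x, G x ^ p ∂(μ.comap ((↑) : V → X)) ≤
        energy p (μ.comap ((↑) : V → X)) v := by
  obtain ⟨-, g₁, w₁, f₁⟩ := (memDirichlet_iff hp0).1 h₁.1.1
  obtain ⟨-, g₂, w₂, f₂⟩ := (memDirichlet_iff hp0).1 h₂.1.1
  obtain ⟨G₁, wG₁, e₁, fin₁, -⟩ := w₁.exists_minimal f₁
  obtain ⟨G₂, wG₂, e₂, fin₂, -⟩ := w₂.exists_minimal f₂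
  have hmid := (h₂.2 _ (mid_mem_admissible hp0 hp.le hμ0 hV hf h₁.1 h₂.1)).trans
    (wG₁.mid wG₂ fin₁ fin₂).energy_le
  have hEq := le_antisymm (h₂.2 _ h₁.1) (h₁.2 _ h₂.1)
  rw [e₂] at hmid
  rw [e₁, e₂] at hEq
  have hle := ae_eq_of_forall_mid_ge hp wG₁.1 wG₂.1 fin₂ hEq.symm rfl hmid
  refine ⟨G₂, wG₁.mono_ae wG₂.1 hle, wG₂, fin₂, fun v hv => ?_⟩
  rw [← e₂]
  exact h₂.2 v hv

/-- The competitor max(u₁, min(u₂, q)) is constant on the set u₁ ≤ q ≤ u₂, where its gradient may be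
replaced by zero. As `G` already has the least energy, it must vanish a.e. on that set, and rational
`q` exhaust u₁ < u₂. -/
theorem ae_eq_zero_of_le_of_le (hp : 1 < p) {hp0 : 0 < p} (hμ0 : μ ≠ 0)
    (hV : MeasurableSet V) (hf : MemDirichlet p (μ.comap ((↑) : V → X)) f) {u₁ u₂ : V → EReal}
    (h₁ : u₁ ∈ admissible p μ V ψ f) (h₂ : u₂ ∈ admissible p μ V ψ f) {G : V → ℝ≥0∞}
    (w₁ : WeakGrad hp0 (μ.comap ((↑) : V → X)) G u₁)
    (w₂ : WeakGrad hp0 (μ.comap ((↑) : V → X)) G u₂)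
    (fG : ∫⁻ x, G x ^ p ∂(μ.comap ((↑) : V → X)) ≠ ∞)
    (hmin : ∀ v ∈ admissible p μ V ψ f, ∫⁻ x, G x ^ p ∂(μ.comap ((↑) : V → X)) ≤
      energy p (μ.comap ((↑) : V → X)) v) :
    ∀ᵐ x ∂(μ.comap ((↑) : V → X)), u₁ x < u₂ x → G x = 0 := by
  have key : ∀ q : ℚ, ∀ᵐ x ∂(μ.comap ((↑) : V → X)),
      u₁ x ≤ ((q : ℝ) : EReal) → ((q : ℝ) : EReal) ≤ u₂ x → G x = 0 := by
    intro q
    have hv := max_min_mem_admissible hp0 hp.le hμ0 hV hf h₁ h₂ w₁ w₂ fG (q : ℝ)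
    have wv := w₁.max_min w₂ fG (q : ℝ)
    set v : V → EReal := fun x => max (u₁ x) (min (u₂ x) ((q : ℝ) : EReal)) with hvdef
    have mv : AEMeasurable v (μ.comap ((↑) : V → X)) := hv.1.1
    set D : Set V := {x | mv.mk v x ≠ ((q : ℝ) : EReal)} with hD
    have hDm : MeasurableSet D := (mv.measurable_mk (measurableSet_singleton _)).compl
    have wD : WeakGrad hp0 (μ.comap ((↑) : V → X)) (D.indicator G) v := by
      refine wv.of_ne (eventually_lineIntegral_ne_top hp0 w₁.1 fG) q (w₁.1.indicator hDm) ?_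
      filter_upwards [mv.ae_eq_mk] with x hx hx'
      have : x ∈ D := by
        show mv.mk v x ≠ ((q : ℝ) : EReal)
        rwa [← hx]
      rw [indicator_of_mem this]
    have hle := (hmin v hv).trans wD.energy_le
    have hind : ∀ x, D.indicator G x ^ p ≤ G x ^ p := fun x =>
      ENNReal.rpow_le_rpow (indicator_le_self _ _ _) hp0.le
    have heq := ae_eq_of_ae_le_of_lintegral_le (Eventually.of_forall hind)
      (ne_top_of_le_ne_top fG (lintegral_mono hind)) (w₁.1.pow_const p).aemeasurable hle
    filter_upwards [heq, mv.ae_eq_mk] with x hx hxm h3 h4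
    have hvx : v x = ((q : ℝ) : EReal) := by
      rw [hvdef]
      simp only [min_eq_right h4, max_eq_right h3]
    have : x ∉ D := fun h => h (by rw [← hxm, hvx])
    rw [indicator_of_notMem this, ENNReal.zero_rpow_of_pos hp0] at hx
    exact (ENNReal.rpow_eq_zero_iff_of_pos hp0).1 hx.symm
  filter_upwards [ae_all_iff.2 key] with x hx hlt
  obtain ⟨q, hq1, hq2⟩ := EReal.lt_iff_exists_rat_btwn.1 hlt
  exact hx q hq1.le hq2.le

open Classical in
/-- The difference of two extended reals, with the convention that equal values have difference
zero. -/
def diff (a b : EReal) : EReal := if a = b then 0 else a - b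

theorem diff_coe (a b : ℝ) : diff a b = ((a - b : ℝ) : EReal) := by
  by_cases h : a = b
  · simp [diff, h]
  · have : (a : EReal) ≠ b := by exact_mod_cast h
    simp [diff, this]

theorem diff_eq_zero_iff {a b : EReal} : diff a b = 0 ↔ a = b := by
  by_cases h : a = b
  · simp [diff, h]
  · simp only [diff, h, if_false, iff_false]
    intro h0
    obtain ⟨x, y, rfl, rfl⟩ := exists_real_of_abs_sub_ne_top (a := a) (b := b) (by simp [h0])
    rw [← EReal.coe_sub] at h0
    have : x - y = 0 := by exact_mod_cast h0
    exact h (by rw [sub_eq_zero.1 this])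

theorem abs_diff_le (a b f : EReal) : (diff a b).abs ≤ (a - f).abs + (b - f).abs := by
  by_cases h : a = b
  · simp [diff, h]
  · simp only [diff, h, if_false]
    rw [abs_sub_comm_ereal b f]
    exact abs_sub_le_ereal _ _ _

/-- Along almost every curve `W` has no oscillation, and it vanishes at some parameter because the
curve has positive length. -/
theorem WeakGrad.eventually_forall_eq_zero {Y : Type*} [MetricSpace Y] [MeasurableSpace Y]
    [BorelSpace Y] {ν : Measure Y} {hp : 0 < p} {W : Y → EReal}
    (h : WeakGrad hp ν (fun _ => 0) W) (h0 : ∀ᵐ x ∂ν, W x = 0) :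
    ∀ᶠ γ in aeCurve hp ν, ∀ t ∈ Icc 0 γ.length, W (γ.toFun t) = 0 := by
  filter_upwards [h.controlled, eventually_ae_of_ae hp h0] with γ h1 h2 t ht
  have hne : (volume.restrict (Icc 0 γ.length)) ≠ 0 := by
    rw [Ne, Measure.restrict_eq_zero, Real.volume_Icc]
    simpa using γ.length_pos
  have : (ae (volume.restrict (Icc 0 γ.length))).NeBot := ae_neBot.2 hne
  obtain ⟨s, hs, hsI⟩ := (h2.and (ae_restrict_mem measurableSet_Icc)).exists
  rcases lt_trichotomy s t with h3 | h3 | h3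
  · have := h1 s t hsI.1 h3 ht.2
    simpa [hs] using this
  · rw [← h3]; exact hs
  · have := h1 t s ht.1 h3 hsI.2
    simpa [hs] using this

theorem IsObstacleSolution.qeOn_eq (hp : 1 < p) (hPI : SupportsPoincare p p μ)
    (hμ : ∀ (x : X) (r : ℝ), 0 < r → 0 < μ (Metric.ball x r) ∧ μ (Metric.ball x r) < ∞)
    (hμ0 : μ ≠ 0) (z : X) (hV : MeasurableSet V) (hcap : capacity p μ Vᶜ ≠ 0)
    (hf : MemDirichlet p (μ.comap ((↑) : V → X)) f) {u₁ u₂ : V → EReal}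
    (h₁ : IsObstacleSolution p μ V ψ f u₁) (h₂ : IsObstacleSolution p μ V ψ f u₂) :
    QEOn p μ V fun x => u₁ x = u₂ x := by
  have hp0 : 0 < p := one_pos.trans hp
  obtain ⟨ω, C, hωμ, hμω, hC, hmaz⟩ := exists_weighted_mazya hp hp0 hPI hμ hμ0 z hcap
  obtain ⟨G, w₁, w₂, fG, hmin⟩ := h₁.exists_common_weakGrad hp hp0 hμ0 hV hf h₂
  have hlt := ae_eq_zero_of_le_of_le hp hμ0 hV hf h₁.1 h₂.1 w₁ w₂ fG hmin
  have hgt := ae_eq_zero_of_le_of_le hp hμ0 hV hf h₂.1 h₁.1 w₂ w₁ fG hmin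
  set U : V → EReal := fun x => diff (u₁ x) (u₂ x) with hU
  have wU : WeakGrad hp0 (μ.comap ((↑) : V → X)) (fun x => G x + G x) U := by
    have := w₁.comp₂_add w₂ fG fG (Φ := diff) (c := 1) (by
      intro a b a' b'
      rw [diff_coe, diff_coe, EReal.coe_sub, EReal.coe_sub]
      exact abs_sub_sub_sub_le a b a' b')
    simpa using this
  -- Where the difference vanishes the gradient may be dropped as on any level set, and elsewhere
  -- `G` is zero a.e.
  have wU0 : WeakGrad hp0 (μ.comap ((↑) : V → X)) (fun _ => 0) U := by
    refine wU.of_ne (eventually_lineIntegral_ne_top hp0 wU.1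
      (lintegral_add_rpow_ne_top hp.le w₁.1 fG fG).2) 0 measurable_const ?_
    filter_upwards [hlt, hgt] with x h3 h4 hx
    have hne : u₁ x ≠ u₂ x := fun h => hx (by
      rw [EReal.coe_zero]
      exact diff_eq_zero_iff.2 h)
    have : G x = 0 := hne.lt_or_gt.elim h3 h4
    simp [this]
  have wW : WeakGrad hp0 μ (fun _ => 0) (extZero V U) := by
    have := wU0.zeroExtension_of_le hV hp.le h₁.1.2.1 h₂.1.2.1 fun x => abs_diff_le _ _ _
    convert this using 1
    funext x
    by_cases hx : x ∈ V <;> simp [extZero, hx]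
  have mU : AEMeasurable U (μ.comap ((↑) : V → X)) := by
    have m₁ := h₁.1.1.1
    have m₂ := h₂.1.1.1
    refine ⟨fun x => diff (m₁.mk u₁ x) (m₂.mk u₂ x), ?_, ?_⟩
    · refine Measurable.ite (measurableSet_eq_fun m₁.measurable_mk m₂.measurable_mk)
        measurable_const ?_
      simp_rw [sub_eq_add_neg]
      exact m₁.measurable_mk.add (measurable_neg.comp m₂.measurable_mk)
    · filter_upwards [m₁.ae_eq_mk, m₂.ae_eq_mk] with x h3 h4
      rw [hU]
      simp only
      rw [← h3, ← h4]
  have mW : AEMeasurable (extZero V U) μ := aemeasurable_extZero hV mU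
  -- Maz'ya's inequality with gradient zero on the right.
  have hW0 : ∀ᵐ x ∂μ, extZero V U x = 0 := by
    refine hμω.ae_le ?_
    have h3 := hmaz _ _ mW (fun x hx => extZero_of_notMem _ hx) wW (by simp [hp0])
    simp only [ENNReal.zero_rpow_of_pos hp0, lintegral_zero, mul_zero, nonpos_iff_eq_zero] at h3
    replace h3 := (lintegral_eq_zero_iff' (f := fun x => (extZero V U x).abs ^ p)
      (((measurable_abs_ereal.comp_aemeasurable mW).mono_ac hωμ).pow_const p)).1 h3
    filter_upwards [h3] with x hx
    exact EReal.abs_eq_zero_iff.1 ((ENNReal.rpow_eq_zero_iff_of_pos hp0).1 hx)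
  have hsub : ((↑) '' {x : V | ¬ u₁ x = u₂ x} : Set X) ⊆ {x | ¬ extZero V U x = 0} := by
    rintro _ ⟨x, hx, rfl⟩ h0
    rw [extZero_coe] at h0
    exact hx (diff_eq_zero_iff.1 h0)
  refine (capacity_eq_zero_iff hp0 hμ0).2 ⟨measure_mono_null hsub hW0, ?_⟩
  filter_upwards [wW.eventually_forall_eq_zero hW0] with γ hγ t ht hmem
  exact hsub hmem (hγ t ht)

end Obstacle

end

end ObstacleProblem

theorem theorem3p4 {X : Type*} [MetricSpace X] [ProperSpace X] [MeasurableSpace X] [BorelSpace X]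
    (μ : Measure X)
    (hμ : ∀ (x : X) (r : ℝ), 0 < r → 0 < μ (Metric.ball x r) ∧ μ (Metric.ball x r) < ∞)
    (p : ℝ) (hp : 1 < p)
    (hPI : ObstacleProblem.SupportsPoincare p p μ)
    (Ω : Set X) (hΩ : IsOpen Ω) (hΩne : Ω.Nonempty)
    (hcap : 0 < ObstacleProblem.capacity p μ Ωᶜ)
    (ψ f : Ω → EReal)
    (hf : ObstacleProblem.MemDirichlet p (μ.comap ((↑) : Ω → X)) f)
    (hK : (ObstacleProblem.admissible p μ Ω ψ f).Nonempty) :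
    (∃ u : Ω → EReal, ObstacleProblem.IsObstacleSolution p μ Ω ψ f u) ∧
      ∀ u₁ u₂ : Ω → EReal,
        ObstacleProblem.IsObstacleSolution p μ Ω ψ f u₁ →
        ObstacleProblem.IsObstacleSolution p μ Ω ψ f u₂ →
        ObstacleProblem.QEOn p μ Ω (fun x => u₁ x = u₂ x) := by
  obtain ⟨z, -⟩ := hΩne
  have hμ0 : μ ≠ 0 := by
    rintro rfl
    simpa using (hμ z 1 one_pos).1
  exact ⟨ObstacleProblem.exists_obstacleSolution hp hPI hμ hμ0 z hΩ.measurableSet hcap.ne' hf hK,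
    fun u₁ u₂ h₁ h₂ => h₁.qeOn_eq hp hPI hμ hμ0 z hΩ.measurableSet hcap.ne' hf h₂⟩
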